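/- **Setting.** Let $t_0<T$ and let $F(t)\in\mathbb R^{n\times n}$, $G(t)\in\mathbb R^{n\times d}$, $Q(t)\in\mathbb R^{d\times d}$, $H(t)\in\mathbb R^{m\times n}$, $R(t)\in\mathbb R^{m\times m}$ be matrix functions on $[t_0,T]$ with $F\in L^1$, $G\in L^2$, $Q\in L^1$, $Q(t)\succcurlyeq 0$ a.e., $GQG^*\in L^1$, $H\in L^2$, $R\in L^2$ and $R(t)\succcurlyeq r\,\mathrm{Id}$ a.e. for some $r>0$. Let $\Pi_0,\Sigma_T\in\mathbb R^{n\times n}$ be symmetric positive semidefinite and $\tilde y\in L^2([t_0,T];\mathbb R^m)$. $\Sigma_T^{\ominus}$ denotes the Moore–Penrose inverse. **Primal problem.** $\mathcal S_x$ is the set of absolutely continuous $x:[t_0,T]\to\mathbb R^n$ for which there are $u\in L^2([t_0,T];\mathbb R^d)$ and $\xi\in\mathbb R^n$ with $x'=Fx+GQ^{1/2}u$ a.e. and $x(t_0)=\Pi_0^{1/2}\xi$. The representative of $x$ is the pair $(\xi,u)$ of this kind minimizing $\|\xi\|^2+\int\|u\|^2$, and with it $$\|x\|_{\mathcal S_x}^2=\|\xi\|^2+\langle\Sigma_Tx(T),x(T)\rangle+\int_{t_0}^T\|u\|^2dt+\int_{t_0}^T\langle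 H^*R^{-1}Hx,x\rangle dt.$$ The primal smoothing problem is $\min_{x\in\mathcal S_x}L_x(x)$, where $$L_x(x)=\|R^{-1/2}\tilde y\|_{L^2}^2+\|x\|_{\mathcal S_x}^2-2\int_{t_0}^T\langle H^*R^{-1}\tilde y,x\rangle dt .$$ **Information vectors.** $\mathcal S_\lambda$ is the set of absolutely continuous $\lambda:[t_0,T]\to\mathbb R^n$ for which there are $v\in L^2([t_0,T];\mathbb R^m)$ with $\int\langle Rv,v\rangle<\infty$ and $z\in\mathbb R^n$ with $-\lambda'=F^*\lambda+H^*v$ a.e. and $\lambda(T)=\Sigma_T^{1/2}z$. The representative of $\lambda$ is the pair $(z,v)$ of this kind minimizing $\|z\|^2+\int\langle Rv,v\rangle$, and with it $$\|\lambda\|_{\mathcal S_\lambda}^2=\langle\Pi_0\lambda(t_0),\lambda(t_0)\rangle+\|z\|^2+\int_{t_0}^T\langle GQG^*\lambda,\lambda\rangle dt+\int_{t_0}^T\langle Rv,v\rangle dt.$$ **Lagrangian.** For $\xi\in\mathbb R^n$, $u\in L^2$, $x$ absolutely continuous, and multipliers $\lambda$ absolutely continuous, $\lambda_0\in\mathbb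 R^n$, put $$\begin{aligned}L(\xi,u,x,\lambda,\lambda_0)={}&\|\xi\|^2+\langle\Sigma_Tx(T),x(T)\rangle+\int\|u\|^2+\int\langle H^*R^{-1}(Hx-2\tilde y),x\rangle\\&+2\int\langle\lambda,x'-Fx-GQ^{1/2}u\rangle+2\langle x(t_0)-\Pi_0^{1/2}\xi,\lambda_0\rangle+\|R^{-1/2}\tilde y\|_{L^2}^2 .\end{aligned}$$ **Statement.** The representatives exist and are unique (up to a.e. equality of $u$, $v$). For a.e. $t$ there is a unique decomposition $R^{-1}(t)\tilde y(t)=p_{H}(t)+p_{K}(t)$ with $p_{H}(t)\in R(t)^{-1}\operatorname{Im}H(t)$ and $p_{K}(t)\in\operatorname{Ker}H^*(t)$; it satisfies $\langle R(t)p_H(t),p_K(t)\rangle=0$, the functions $p_H$ and $p_K$ are in $L^2$, and $\langle Rp_H,p_H\rangle$, $\langle Rp_K,p_K\rangle$ are integrable. For $\lambda\in\mathcal S_\lambda$ with representative $(z,v)$ let $$L_\lambda(\lambda)=\|\lambda\|_{\mathcal S_\lambda}^2-2\int_{t_0}^T\langle R(t)p_H(t),v(t)\rangle dt-\|R^{1/2}p_K\|_{L^2}^2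 .$$ Then the convex (Lagrange) dual of the primal problem is, up to the sign that turns a maximum into a minimum, $\min_{\lambda\in\mathcal S_\lambda}L_\lambda(\lambda)$. That is: 1. for every absolutely continuous $x$, $\inf_{\xi,u}\sup_{\lambda,\lambda_0}L$ equals $L_x(x)$ if $x\in\mathcal S_x$ and $+\infty$ otherwise; 2. for all multipliers, $\inf_{\xi,u,x}L(\xi,u,x,\lambda,\lambda_0)$ equals $-L_\lambda(\lambda)$ if $\lambda\in\mathcal S_\lambda$ and $\lambda_0=\lambda(t_0)$, and $-\infty$ otherwise; 3. both minima are attained and $$\min_{x\in\mathcal S_x}L_x(x)=\sup_{\lambda,\lambda_0}\inf_{\xi,u,x}L=-\min_{\lambda\in\mathcal S_\lambda}L_\lambda(\lambda);$$ 4. for every $\lambda\in\mathcal S_\lambda$ with representative $(z,v)$, $L_\lambda$ has the least-squares form $$\begin{aligned}L_\lambda(\lambda)={}&\int_{t_0}^T\langle R(p_H-v),p_H-v\rangle dt+\int_{t_0}^T\langle GQG^*\lambda,\lambda\rangle dt\\&+\langle\Pi_0\lambda(t_0),\lambda(t_0)\rangle+\langle\Sigma_T^{\ominus}\lambda(T),\lambda(T)\rangle-\|R^{-1/2}\tilde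 y\|_{L^2}^2.\end{aligned}$$ -/

import Mathlib

open MeasureTheory Set Matrix

open scoped MatrixOrder in
/-- The positive semidefinite square root `A^{1/2}` of a positive semidefinite real matrix. -/
noncomputable def psdSqrt {k : ℕ} (A : Matrix (Fin k) (Fin k) ℝ) : Matrix (Fin k) (Fin k) ℝ :=
  CFC.sqrt A

/-- The Moore-Penrose pseudo-inverse of a real symmetric matrix: its nonzero eigenvalues are
inverted and its kernel is kept. -/
noncomputable def symPinv {k : ℕ} (A : Matrix (Fin k) (Fin k) ℝ) : Matrix (Fin k) (Fin k) ℝ :=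
  cfc (fun x : ℝ => x⁻¹) A

open scoped MatrixOrder in
/-- `psdSqrt` is the positive semidefinite square root. -/
theorem psdSqrt_spec {k : ℕ} {A : Matrix (Fin k) (Fin k) ℝ} (hA : A.PosSemidef) :
    (psdSqrt A).PosSemidef ∧ psdSqrt A * psdSqrt A = A :=
  ⟨Matrix.nonneg_iff_posSemidef.mp (CFC.sqrt_nonneg A),
    CFC.sqrt_mul_sqrt_self A (Matrix.nonneg_iff_posSemidef.mpr hA)⟩

/-- `symPinv` satisfies the four Penrose equations. -/
theorem symPinv_spec {k : ℕ} {A : Matrix (Fin k) (Fin k) ℝ} (hA : A.IsHermitian) :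
    A * symPinv A * A = A ∧ symPinv A * A * symPinv A = symPinv A ∧
      (A * symPinv A).IsHermitian ∧ (symPinv A * A).IsHermitian := by
  have ha : IsSelfAdjoint A := hA
  have hc : ∀ f : ℝ → ℝ, ContinuousOn f (spectrum ℝ A) := fun f =>
    (Matrix.finite_real_spectrum (A := A)).continuousOn f
  have h1 : A * symPinv A = cfc (fun x : ℝ => x * x⁻¹) A := by
    rw [cfc_mul (fun x : ℝ => x) (fun x : ℝ => x⁻¹) A (hc _) (hc _), cfc_id' ℝ A]
    rfl
  have h2 : symPinv A * A = cfc (fun x : ℝ => x⁻¹ * x) A := by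
    rw [cfc_mul (fun x : ℝ => x⁻¹) (fun x : ℝ => x) A (hc _) (hc _), cfc_id' ℝ A]
    rfl
  refine ⟨?_, ?_, ?_, ?_⟩
  · rw [h1]
    conv_lhs => rw [← cfc_id' ℝ A]
    rw [cfc_id' ℝ A]
    have : cfc (fun x : ℝ => x * x⁻¹) A * cfc (fun x : ℝ => x) A = cfc (fun x : ℝ => x) A := by
      rw [← cfc_mul _ _ A (hc _) (hc _)]
      congr 1
      funext x
      exact mul_inv_mul_cancel x
    rwa [cfc_id' ℝ A] at this
  · rw [h2]
    unfold symPinv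
    rw [← cfc_mul _ _ A (hc _) (hc _)]
    congr 1
    funext x
    by_cases hx : x = 0 <;> simp [hx]
  · rw [h1]
    exact cfc_predicate (R := ℝ) _ A
  · rw [h2]
    exact cfc_predicate (R := ℝ) _ A

/-- The data of the linear smoothing problem on `[t₀, T]`: dynamics `F`, `G`, covariance `Q` of the
model noise, observation matrix `H`, covariance `R` of the observation noise, initial covariance
`P0`, terminal weight `ST`, and a realization `y` of the centred observation. -/
structure SmoothingData (n d m : ℕ) where
  t₀ : ℝ
  T : ℝ
  F : ℝ → Matrix (Fin n) (Fin n) ℝ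
  G : ℝ → Matrix (Fin n) (Fin d) ℝ
  Q : ℝ → Matrix (Fin d) (Fin d) ℝ
  H : ℝ → Matrix (Fin m) (Fin n) ℝ
  R : ℝ → Matrix (Fin m) (Fin m) ℝ
  P0 : Matrix (Fin n) (Fin n) ℝ
  ST : Matrix (Fin n) (Fin n) ℝ
  y : ℝ → Fin m → ℝ

namespace SmoothingData

variable {n d m : ℕ} (D : SmoothingData n d m)

/-- Lebesgue measure on `[t₀, T]`. -/
noncomputable def μ : Measure ℝ := volume.restrict (Icc D.t₀ D.T)

/-- Standing assumptions. A matrix function is in `L^p` when all its entries are. The last but one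
field, `GQG^* ∈ L¹`, is what makes `G Q^{1/2} u` integrable for all square-integrable `u`. -/
structure Standing : Prop where
  lt : D.t₀ < D.T
  F_L1 : ∀ i j, MemLp (fun t => D.F t i j) 1 D.μ
  G_L2 : ∀ i j, MemLp (fun t => D.G t i j) 2 D.μ
  Q_L1 : ∀ i j, MemLp (fun t => D.Q t i j) 1 D.μ
  Q_psd : ∀ᵐ t ∂D.μ, (D.Q t).PosSemidef
  H_L2 : ∀ i j, MemLp (fun t => D.H t i j) 2 D.μ
  R_L2 : ∀ i j, MemLp (fun t => D.R t i j) 2 D.μ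
  R_coercive : ∃ r : ℝ, 0 < r ∧
    ∀ᵐ t ∂D.μ, (D.R t - r • (1 : Matrix (Fin m) (Fin m) ℝ)).PosSemidef
  P0_psd : D.P0.PosSemidef
  ST_psd : D.ST.PosSemidef
  GQG_L1 : ∀ i j, MemLp (fun t => (D.G t * D.Q t * (D.G t)ᵀ) i j) 1 D.μ
  y_L2 : MemLp D.y 2 D.μ

/-! ### The space of trajectories and the primal problem -/

/-- `x` is absolutely continuous on `[t₀, T]`, `u ∈ L²`, `x' = F x + G Q^{1/2} u` almost everywhere
and `x(t₀) = P0^{1/2} ξ`. Here `p = (ξ, u)`. -/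
def IsControlled (x : ℝ → Fin n → ℝ) (p : (Fin n → ℝ) × (ℝ → Fin d → ℝ)) : Prop :=
  AbsolutelyContinuousOnInterval x D.t₀ D.T ∧ MemLp p.2 2 D.μ ∧
    (∀ᵐ t ∂D.μ, HasDerivAt x (D.F t *ᵥ x t + (D.G t * psdSqrt (D.Q t)) *ᵥ p.2 t) t) ∧
    x D.t₀ = psdSqrt D.P0 *ᵥ p.1

/-- The space `S_x` of controlled trajectories. -/
def Sx : Set (ℝ → Fin n → ℝ) := {x | ∃ p, D.IsControlled x p}

/-- `‖ξ‖² + ∫ ‖u‖²`. -/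
noncomputable def controlCost (p : (Fin n → ℝ) × (ℝ → Fin d → ℝ)) : ℝ :=
  p.1 ⬝ᵥ p.1 + ∫ t, p.2 t ⬝ᵥ p.2 t ∂D.μ

/-- `p = (ξ, u)` is a representative of `x`: a pair of minimal cost generating `x`. -/
def IsRep (x : ℝ → Fin n → ℝ) (p : (Fin n → ℝ) × (ℝ → Fin d → ℝ)) : Prop :=
  D.IsControlled x p ∧ ∀ q, D.IsControlled x q → D.controlCost p ≤ D.controlCost q

/-- The representative of `x ∈ S_x`. -/
noncomputable def rep (x : ℝ → Fin n → ℝ) : (Fin n → ℝ) × (ℝ → Fin d → ℝ) :=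
  Classical.epsilon (D.IsRep x)

/-- The squared norm of `S_x`:
`‖ξ‖² + ⟨ST x(T), x(T)⟩ + ∫ ‖u‖² + ∫ ⟨H^* R⁻¹ H x, x⟩` for the representative `(ξ, u)`. -/
noncomputable def normSqSx (x : ℝ → Fin n → ℝ) : ℝ :=
  (D.rep x).1 ⬝ᵥ (D.rep x).1 + (D.ST *ᵥ x D.T) ⬝ᵥ x D.T
    + (∫ t, (D.rep x).2 t ⬝ᵥ (D.rep x).2 t ∂D.μ)
    + ∫ t, (((D.H t)ᵀ * (D.R t)⁻¹ * D.H t) *ᵥ x t) ⬝ᵥ x t ∂D.μ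

/-- `‖R^{-1/2} y‖²` in `L²`. -/
noncomputable def obsNormSq : ℝ := ∫ t, ((D.R t)⁻¹ *ᵥ D.y t) ⬝ᵥ D.y t ∂D.μ

/-- The primal objective `L_x` on `S_x`. -/
noncomputable def primalObj (x : ℝ → Fin n → ℝ) : ℝ :=
  D.obsNormSq + D.normSqSx x
    - 2 * ∫ t, (((D.H t)ᵀ * (D.R t)⁻¹) *ᵥ D.y t) ⬝ᵥ x t ∂D.μ

/-! ### The space of information vectors and the dual objective -/

/-- `l` is absolutely continuous on `[t₀, T]`, `v ∈ L²` with `⟨R v, v⟩ ∈ L¹`,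
`-l' = F^* l + H^* v` almost everywhere and `l(T) = ST^{1/2} z`. Here `p = (z, v)`. -/
def IsInfoControlled (l : ℝ → Fin n → ℝ) (p : (Fin n → ℝ) × (ℝ → Fin m → ℝ)) : Prop :=
  AbsolutelyContinuousOnInterval l D.t₀ D.T ∧ MemLp p.2 2 D.μ ∧
    Integrable (fun t => (D.R t *ᵥ p.2 t) ⬝ᵥ p.2 t) D.μ ∧
    (∀ᵐ t ∂D.μ, HasDerivAt l (-((D.F t)ᵀ *ᵥ l t + (D.H t)ᵀ *ᵥ p.2 t)) t) ∧
    l D.T = psdSqrt D.ST *ᵥ p.1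

/-- The space `S_λ` of information vectors. -/
def Sl : Set (ℝ → Fin n → ℝ) := {l | ∃ p, D.IsInfoControlled l p}

/-- `‖z‖² + ∫ ⟨R v, v⟩`. -/
noncomputable def infoCost (p : (Fin n → ℝ) × (ℝ → Fin m → ℝ)) : ℝ :=
  p.1 ⬝ᵥ p.1 + ∫ t, (D.R t *ᵥ p.2 t) ⬝ᵥ p.2 t ∂D.μ

/-- `p = (z, v)` is a representative of `l`: a pair of minimal cost generating `l`. -/
def IsInfoRep (l : ℝ → Fin n → ℝ) (p : (Fin n → ℝ) × (ℝ → Fin m → ℝ)) : Prop :=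
  D.IsInfoControlled l p ∧ ∀ q, D.IsInfoControlled l q → D.infoCost p ≤ D.infoCost q

/-- The representative of `l ∈ S_λ`. -/
noncomputable def infoRep (l : ℝ → Fin n → ℝ) : (Fin n → ℝ) × (ℝ → Fin m → ℝ) :=
  Classical.epsilon (D.IsInfoRep l)

/-- The squared norm of `S_λ`:
`⟨P0 l(t₀), l(t₀)⟩ + ‖z‖² + ∫ ⟨G Q G^* l, l⟩ + ∫ ⟨R v, v⟩` for the representative `(z, v)`. -/
noncomputable def normSqSl (l : ℝ → Fin n → ℝ) : ℝ :=
  (D.P0 *ᵥ l D.t₀) ⬝ᵥ l D.t₀ + (D.infoRep l).1 ⬝ᵥ (D.infoRep l).1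
    + (∫ t, ((D.G t * D.Q t * (D.G t)ᵀ) *ᵥ l t) ⬝ᵥ l t ∂D.μ)
    + ∫ t, (D.R t *ᵥ (D.infoRep l).2 t) ⬝ᵥ (D.infoRep l).2 t ∂D.μ

/-- `(a, b)` decomposes `R(t)⁻¹ y(t) = a + b` with `a ∈ R(t)⁻¹ Im H(t)` and `b ∈ Ker H^*(t)`. -/
def IsDecomp (t : ℝ) (p : (Fin m → ℝ) × (Fin m → ℝ)) : Prop :=
  (∃ w : Fin n → ℝ, p.1 = (D.R t)⁻¹ *ᵥ (D.H t *ᵥ w)) ∧ (D.H t)ᵀ *ᵥ p.2 = 0 ∧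
    p.1 + p.2 = (D.R t)⁻¹ *ᵥ D.y t

/-- The component of `R(t)⁻¹ y(t)` in `R(t)⁻¹ Im H(t)`. -/
noncomputable def projIm (t : ℝ) : Fin m → ℝ := (Classical.epsilon (D.IsDecomp t)).1

/-- The component of `R(t)⁻¹ y(t)` in `Ker H^*(t)`. -/
noncomputable def projKer (t : ℝ) : Fin m → ℝ := (Classical.epsilon (D.IsDecomp t)).2

/-- The dual objective `L_λ` on `S_λ`, with `v` taken from the representative. -/
noncomputable def dualObj (l : ℝ → Fin n → ℝ) : ℝ :=
  D.normSqSl l - 2 * (∫ t, (D.R t *ᵥ D.projIm t) ⬝ᵥ (D.infoRep l).2 t ∂D.μ)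
    - ∫ t, (D.R t *ᵥ D.projKer t) ⬝ᵥ D.projKer t ∂D.μ

/-- The least-squares form of the dual objective. -/
noncomputable def dualLeastSquares (l : ℝ → Fin n → ℝ) : ℝ :=
  (∫ t, (D.R t *ᵥ (D.projIm t - (D.infoRep l).2 t)) ⬝ᵥ (D.projIm t - (D.infoRep l).2 t) ∂D.μ)
    + (∫ t, ((D.G t * D.Q t * (D.G t)ᵀ) *ᵥ l t) ⬝ᵥ l t ∂D.μ)
    + (D.P0 *ᵥ l D.t₀) ⬝ᵥ l D.t₀ + (symPinv D.ST *ᵥ l D.T) ⬝ᵥ l D.T - D.obsNormSq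

/-! ### Lagrangian duality -/

/-- The absolutely continuous functions on `[t₀, T]`. -/
def AC : Set (ℝ → Fin n → ℝ) := {x | AbsolutelyContinuousOnInterval x D.t₀ D.T}

/-- The controls, i.e. the square-integrable functions on `[t₀, T]`. -/
def Controls : Set (ℝ → Fin d → ℝ) := {u | MemLp u 2 D.μ}

/-- The Lagrangian of the primal problem, written over `(ξ, u, x)` with the two constraints
`x' = F x + G Q^{1/2} u` (multiplier `2 l`) and `x(t₀) = P0^{1/2} ξ` (multiplier `2 l₀`). -/
noncomputable def lagrangian (ξ : Fin n → ℝ) (u : ℝ → Fin d → ℝ) (x l : ℝ → Fin n → ℝ)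
    (l₀ : Fin n → ℝ) : ℝ :=
  ξ ⬝ᵥ ξ + (D.ST *ᵥ x D.T) ⬝ᵥ x D.T + (∫ t, u t ⬝ᵥ u t ∂D.μ)
    + (∫ t, (((D.H t)ᵀ * (D.R t)⁻¹) *ᵥ (D.H t *ᵥ x t - (2 : ℝ) • D.y t)) ⬝ᵥ x t ∂D.μ)
    + 2 * (∫ t, l t ⬝ᵥ (deriv x t - D.F t *ᵥ x t - (D.G t * psdSqrt (D.Q t)) *ᵥ u t) ∂D.μ)
    + 2 * ((x D.t₀ - psdSqrt D.P0 *ᵥ ξ) ⬝ᵥ l₀) + D.obsNormSq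

/-- The Lagrange dual function `(l, l₀) ↦ inf_{ξ, u, x} L(ξ, u, x, l, l₀)`. -/
noncomputable def dualFunction (l : ℝ → Fin n → ℝ) (l₀ : Fin n → ℝ) : EReal :=
  ⨅ (ξ : Fin n → ℝ), ⨅ u ∈ D.Controls, ⨅ x ∈ D.AC, ((D.lagrangian ξ u x l l₀ : ℝ) : EReal)

/-- The primal problem in the form `inf sup`: for a fixed trajectory `x`, the infimum over
`(ξ, u)` of the supremum of the Lagrangian over the multipliers. -/
noncomputable def primalFunction (x : ℝ → Fin n → ℝ) : EReal :=
  ⨅ (ξ : Fin n → ℝ), ⨅ u ∈ D.Controls, ⨆ l ∈ D.AC, ⨆ (l₀ : Fin n → ℝ),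
    ((D.lagrangian ξ u x l l₀ : ℝ) : EReal)

end SmoothingData

/-! Write `M = H^* R⁻¹ H` and `g = H^* R⁻¹ y + l' + F^* l`. Integrating `⟨l, x'⟩` by parts and
completing squares in `ξ` and `u` (`lagrangian_eq`) splits the Lagrangian into two squares, a term
depending only on the multipliers, a quadratic form in the endpoint values of `x`, and `∫ ⟨M x, x⟩ -
2 ⟨g, x⟩`. The squares vanish for the right `ξ` and `u`, so the dual function is decided by the
infimum over `x`.

Absolutely continuous functions with prescribed endpoints approximate every bounded measurable
function a.e. with a uniform bound, so the endpoint form and the integral can be treated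
independently. The endpoint form is bounded below only if `l₀ = l(t₀)` and `l(T)` lies in the range
of `ST^{1/2}`. The integral is bounded below exactly when `g = H^* v` for some `v` of finite
`R`-energy, and its infimum is then minus the least such energy. The hard direction is
`exists_energy_le_of_bounded_below`: the pointwise minimizer, a solution of `M x = g`, need be
neither bounded nor known to exist, so one tests with clipped Tikhonov solutions `(M + ε)⁻¹ g` and
passes to the limit by Fatou. The least-energy `v` takes values in `R⁻¹ Im H` and equals `p_H` minus
the control of the representative of `l`. This gives the least-squares form, the constant being
settled by Pythagoras for `p_H` and `p_K`.

For fixed `x` the supremum over multipliers is infinite unless both constraints hold, by the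
fundamental lemma of the calculus of variations, which is the case `H = 0` of the same result.

Attainment and the absence of a gap come from the optimality system rather than from compactness.
The linear Hamiltonian boundary value problem is solved by shooting: its homogeneous version forces
`l(t₀) = 0` (`initial_eq_zero`), and an injective endomorphism of a finite-dimensional space is
onto. By convexity a solution minimizes the Lagrangian at its own multiplier, while its trajectory
is feasible; weak duality does the rest. -/

set_option linter.unusedSectionVars false

/-! ### Linear algebra -/

section LinearAlgebra

open Filter Topology

theorem dot_self_nonneg {ι : Type*} [Fintype ι] (x : ι → ℝ) : 0 ≤ x ⬝ᵥ x :=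
  Finset.sum_nonneg fun i _ => mul_self_nonneg (x i)

variable {ι κ : Type*} [Fintype ι] [Fintype κ] [DecidableEq ι] [DecidableEq κ]

theorem Matrix.PosSemidef.transpose_eq {A : Matrix ι ι ℝ} (hA : A.PosSemidef) : Aᵀ = A := by
  rw [← conjTranspose_eq_transpose_of_trivial]
  exact hA.1

theorem Matrix.PosSemidef.quad_nonneg {A : Matrix ι ι ℝ} (hA : A.PosSemidef) (x : ι → ℝ) :
    0 ≤ (A *ᵥ x) ⬝ᵥ x := by
  simpa [dotProduct_comm] using hA.dotProduct_mulVec_nonneg x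

theorem Matrix.PosSemidef.mulVec_eq_zero {A : Matrix ι ι ℝ} (hA : A.PosSemidef) {x : ι → ℝ}
    (h : (A *ᵥ x) ⬝ᵥ x = 0) : A *ᵥ x = 0 :=
  (hA.dotProduct_mulVec_zero_iff x).1 (by simpa [dotProduct_comm] using h)

theorem mulVec_dotProduct (A : Matrix κ ι ℝ) (x : ι → ℝ) (y : κ → ℝ) :
    (A *ᵥ x) ⬝ᵥ y = (Aᵀ *ᵥ y) ⬝ᵥ x := by
  rw [dotProduct_comm, dotProduct_mulVec, mulVec_transpose]

theorem Matrix.PosSemidef.symm_quad {A : Matrix ι ι ℝ} (hA : A.PosSemidef) (x y : ι → ℝ) :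
    (A *ᵥ x) ⬝ᵥ y = (A *ᵥ y) ⬝ᵥ x := by
  rw [mulVec_dotProduct, hA.transpose_eq]

theorem psdSqrt_mulVec_dotProduct {k : ℕ} {A : Matrix (Fin k) (Fin k) ℝ} (hA : A.PosSemidef)
    (x y : Fin k → ℝ) : (psdSqrt A *ᵥ x) ⬝ᵥ (psdSqrt A *ᵥ y) = (A *ᵥ x) ⬝ᵥ y := by
  rw [dotProduct_comm, mulVec_dotProduct, (psdSqrt_spec hA).1.transpose_eq, mulVec_mulVec,
    (psdSqrt_spec hA).2]

/-- Solvability of a linear system: the right-hand side is orthogonal to the cokernel. -/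
theorem exists_mulVec_eq_of_forall_dotProduct_eq_zero (A : Matrix κ ι ℝ) (g : κ → ℝ)
    (h : ∀ p, Aᵀ *ᵥ p = 0 → g ⬝ᵥ p = 0) : ∃ w, A *ᵥ w = g := by
  by_contra hn
  have hg : g ∉ LinearMap.range A.mulVecLin := by
    rintro ⟨w, hw⟩
    exact hn ⟨w, hw⟩
  obtain ⟨f, hf, hle⟩ := Submodule.exists_le_ker_of_notMem hg
  have hfp : ∀ x, f x = x ⬝ᵥ fun i => f (Pi.single i 1) := fun x => by
    rw [LinearMap.pi_apply_eq_sum_univ f x]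
    simp only [dotProduct, smul_eq_mul]
    congr! with i _ j
    simp only [Pi.single_apply, eq_comm]
  refine hf ((hfp g).trans (h _ ?_))
  have h0 : ∀ w, w ⬝ᵥ Aᵀ *ᵥ (fun i => f (Pi.single i 1)) = 0 := fun w => by
    rw [dotProduct_comm, ← mulVec_dotProduct, ← hfp]
    exact hle ⟨w, rfl⟩
  exact dotProduct_self_eq_zero.1 (h0 _)

theorem Matrix.PosSemidef.add_smul_one_posDef {M : Matrix ι ι ℝ} (hM : M.PosSemidef) {ε : ℝ}
    (hε : 0 < ε) : (M + ε • (1 : Matrix ι ι ℝ)).PosDef :=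
  (Matrix.PosDef.one.smul hε).posSemidef_add hM

/-- The regularized solution `(M + ε)⁻¹ g` of `M x = g`. -/
noncomputable def regSol (M : Matrix ι ι ℝ) (g : ι → ℝ) (ε : ℝ) : ι → ℝ :=
  (M + ε • (1 : Matrix ι ι ℝ))⁻¹ *ᵥ g

variable {M : Matrix ι ι ℝ} {g : ι → ℝ} {ε : ℝ}

theorem mulVec_regSol (hM : M.PosSemidef) (hε : 0 < ε) :
    M *ᵥ regSol M g ε + ε • regSol M g ε = g := by
  have hu := (hM.add_smul_one_posDef hε).isUnit
  have h : (M + ε • (1 : Matrix ι ι ℝ)) *ᵥ regSol M g ε = g := by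
    rw [regSol, mulVec_mulVec, Matrix.mul_nonsing_inv _ ((Matrix.isUnit_iff_isUnit_det _).1 hu),
      one_mulVec]
  simpa [add_mulVec, smul_mulVec] using h

theorem dotProduct_regSol (hM : M.PosSemidef) (hε : 0 < ε) :
    g ⬝ᵥ regSol M g ε =
      (M *ᵥ regSol M g ε) ⬝ᵥ regSol M g ε + ε * (regSol M g ε ⬝ᵥ regSol M g ε) := by
  have := congrArg (· ⬝ᵥ regSol M g ε) (mulVec_regSol (g := g) hM hε)
  simpa [add_dotProduct] using this.symm

theorem dotProduct_regSol_nonneg (hM : M.PosSemidef) (hε : 0 < ε) : 0 ≤ g ⬝ᵥ regSol M g ε := by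
  rw [dotProduct_regSol hM hε]
  have := hM.quad_nonneg (regSol M g ε)
  have := dot_self_nonneg (regSol M g ε)
  positivity

/-- Expanding `|M x + ε x|²` leaves only nonnegative terms besides `ε² |x|²`. This growth rate in `1
/ ε` determines how fast the clipping level of `clipSol` must increase. -/
theorem mul_dotProduct_regSol_self_le (hM : M.PosSemidef) (hε : 0 < ε) :
    ε ^ 2 * (regSol M g ε ⬝ᵥ regSol M g ε) ≤ g ⬝ᵥ g := by
  set x := regSol M g ε with hx
  have e := mulVec_regSol (g := g) hM hε
  rw [← hx] at e
  have h1 := hM.quad_nonneg x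
  have h2 := dot_self_nonneg (M *ᵥ x)
  rw [← e]
  simp only [add_dotProduct, dotProduct_add, smul_dotProduct, dotProduct_smul, smul_eq_mul]
  rw [dotProduct_comm x (M *ᵥ x)]
  nlinarith [mul_nonneg hε.le h1]

/-- The error of the regularized solution is small in energy. -/
theorem regSol_sub_energy (hM : M.PosSemidef) (hε : 0 < ε) (w : ι → ℝ) :
    (M *ᵥ (regSol M (M *ᵥ w) ε - w)) ⬝ᵥ (regSol M (M *ᵥ w) ε - w) ≤ ε * (w ⬝ᵥ w) := by
  set d := regSol M (M *ᵥ w) ε - w with hd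
  have hx : regSol M (M *ᵥ w) ε = d + w := by simp [hd]
  have e := mulVec_regSol (g := M *ᵥ w) hM hε
  rw [hx, mulVec_add, smul_add] at e
  -- The error equation. Pairing it with `d` and bounding `-⟨w, d⟩` by `(|d|² + |w|²) / 2` gives the
  -- estimate.
  have e2 : M *ᵥ d + ε • d + ε • w = 0 := by
    have : M *ᵥ d + ε • d + ε • w + M *ᵥ w = 0 + M *ᵥ w := by
      rw [zero_add]; conv_rhs => rw [← e]
      abel
    exact add_right_cancel this
  have e3 : (M *ᵥ d + ε • d + ε • w) ⬝ᵥ d = 0 := by rw [e2, zero_dotProduct]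
  simp only [add_dotProduct, smul_dotProduct, smul_eq_mul] at e3
  have h4 := dot_self_nonneg (d + w)
  simp only [add_dotProduct, dotProduct_add] at h4
  rw [dotProduct_comm d w] at h4
  have h5 := dot_self_nonneg d
  have h6 := dot_self_nonneg w
  nlinarith

/-- Some `p` in the kernel of `M` satisfies `⟨g, p⟩ ≠ 0`. The regularized solution `x` has `ε ⟨x, p⟩
= ⟨g, p⟩`, so Cauchy-Schwarz makes `ε |x|²`, which is at most `⟨g, x⟩`, of order `1 / ε`. -/
theorem regSol_unbounded (hM : M.PosSemidef) (hg : ¬ ∃ w, M *ᵥ w = g) :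
    ∃ c > 0, ∀ ε > 0, c / ε ≤ g ⬝ᵥ regSol M g ε := by
  have hp : ∃ p, M *ᵥ p = 0 ∧ g ⬝ᵥ p ≠ 0 := by
    by_contra! hcon
    exact hg (exists_mulVec_eq_of_forall_dotProduct_eq_zero M g (by rwa [hM.transpose_eq]))
  obtain ⟨p, hp0, hgp⟩ := hp
  have hpp : 0 < p ⬝ᵥ p := by
    refine lt_of_le_of_ne (dot_self_nonneg p) fun h => hgp ?_
    rw [dotProduct_self_eq_zero.1 h.symm, dotProduct_zero]
  refine ⟨(g ⬝ᵥ p) ^ 2 / (p ⬝ᵥ p), by positivity, fun ε hε => ?_⟩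
  set x := regSol M g ε with hx
  have e : ε * (x ⬝ᵥ p) = g ⬝ᵥ p := by
    have := congrArg (· ⬝ᵥ p) (mulVec_regSol (g := g) hM hε)
    simp only [add_dotProduct, smul_dotProduct, smul_eq_mul] at this
    rwa [hM.symm_quad, hp0, zero_dotProduct, zero_add] at this
  have hcs : (x ⬝ᵥ p) ^ 2 ≤ (x ⬝ᵥ x) * (p ⬝ᵥ p) := by
    simpa [dotProduct, pow_two] using Finset.sum_mul_sq_le_sq_mul_sq Finset.univ x p
  have hq := hM.quad_nonneg x
  rw [dotProduct_regSol hM hε, ← e, ← hx, div_div, div_le_iff₀ (by positivity)]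
  have h0 : (ε * x ⬝ᵥ p) ^ 2 ≤ ε * (x ⬝ᵥ x) * (p ⬝ᵥ p * ε) := by
    nlinarith [mul_le_mul_of_nonneg_left hcs (sq_nonneg ε)]
  nlinarith [mul_nonneg hq (mul_nonneg hpp.le hε.le)]

/-- The regularization parameters `1 / (k + 1)`. -/
noncomputable def regPar (k : ℕ) : ℝ := 1 / ((k : ℝ) + 1)

theorem regPar_pos (k : ℕ) : 0 < regPar k := by unfold regPar; positivity

theorem tendsto_regPar : Tendsto regPar atTop (𝓝 0) := tendsto_one_div_add_atTop_nhds_zero_nat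

theorem tendsto_dotProduct_regSol_atTop (hM : M.PosSemidef) (hg : ¬ ∃ w, M *ᵥ w = g) :
    Tendsto (fun k => g ⬝ᵥ regSol M g (regPar k)) atTop atTop := by
  obtain ⟨c, hc, h⟩ := regSol_unbounded hM hg
  refine tendsto_atTop_mono (fun k => h _ (regPar_pos k)) ?_
  have : (fun k => c / regPar k) = fun k : ℕ => c * ((k : ℝ) + 1) := by
    funext k; simp [regPar]
  rw [this]
  exact (tendsto_natCast_atTop_atTop.atTop_add tendsto_const_nhds).const_mul_atTop hc

theorem tendsto_regSol_energy (hM : M.PosSemidef) (w : ι → ℝ) :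
    Tendsto (fun k => (M *ᵥ (regSol M (M *ᵥ w) (regPar k) - w)) ⬝ᵥ
      (regSol M (M *ᵥ w) (regPar k) - w)) atTop (𝓝 0) := by
  refine squeeze_zero (fun k => hM.quad_nonneg _)
    (fun k => regSol_sub_energy hM (regPar_pos k) w) ?_
  simpa using tendsto_regPar.mul_const (w ⬝ᵥ w)

/-- Cauchy-Schwarz for the semi-inner product of `M` reduces this to the convergence in energy; no
convergence of the regularized solutions themselves is used. -/
theorem tendsto_dotProduct_regSol (hM : M.PosSemidef) (w : ι → ℝ) :
    Tendsto (fun k => (M *ᵥ w) ⬝ᵥ regSol M (M *ᵥ w) (regPar k)) atTop (𝓝 ((M *ᵥ w) ⬝ᵥ w)) := by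
  have hcs : ∀ x y : ι → ℝ, ((M *ᵥ x) ⬝ᵥ y) ^ 2 ≤ ((M *ᵥ x) ⬝ᵥ x) * ((M *ᵥ y) ⬝ᵥ y) := by
    intro x y
    have h : ∀ s : ℝ, 0 ≤ ((M *ᵥ y) ⬝ᵥ y) * (s * s) + (2 * ((M *ᵥ x) ⬝ᵥ y)) * s
        + (M *ᵥ x) ⬝ᵥ x := fun s => by
      have := hM.quad_nonneg (x + s • y)
      simp only [mulVec_add, mulVec_smul, add_dotProduct, dotProduct_add, smul_dotProduct,
        dotProduct_smul, smul_eq_mul] at this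
      rw [hM.symm_quad y x] at this
      linarith
    have := discrim_le_zero h
    unfold discrim at this
    nlinarith
  have h0 : Tendsto (fun k => (M *ᵥ w) ⬝ᵥ (regSol M (M *ᵥ w) (regPar k) - w)) atTop (𝓝 0) := by
    have hs : Tendsto (fun k => Real.sqrt (((M *ᵥ w) ⬝ᵥ w) *
        ((M *ᵥ (regSol M (M *ᵥ w) (regPar k) - w)) ⬝ᵥ (regSol M (M *ᵥ w) (regPar k) - w))))
        atTop (𝓝 0) := by
      simpa using ((tendsto_regSol_energy hM w).const_mul ((M *ᵥ w) ⬝ᵥ w)).sqrt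
    exact squeeze_zero_norm (fun k => Real.abs_le_sqrt (hcs _ _)) hs
  have := h0.add_const ((M *ᵥ w) ⬝ᵥ w)
  simpa [dotProduct_sub] using this

end LinearAlgebra

/-! ### Splitting along `R⁻¹ Im H` and `Ker H^*` -/

section Gram

open Filter Topology

variable {ι κ : Type*} [Fintype ι] [Fintype κ] [DecidableEq ι] [DecidableEq κ]
  {R : Matrix κ κ ℝ} {H : Matrix κ ι ℝ} {r : ℝ}

/-- The matrix `H^* R⁻¹ H`. -/
noncomputable def wGram (R : Matrix κ κ ℝ) (H : Matrix κ ι ℝ) : Matrix ι ι ℝ := Hᵀ * R⁻¹ * H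

/-- `R ≥ r > 0`. -/
def Coercive (r : ℝ) (R : Matrix κ κ ℝ) : Prop :=
  0 < r ∧ (R - r • (1 : Matrix κ κ ℝ)).PosSemidef

theorem coercive_one : Coercive 1 (1 : Matrix κ κ ℝ) :=
  ⟨one_pos, by simpa using Matrix.PosSemidef.zero⟩

theorem Coercive.posDef (h : Coercive r R) : R.PosDef := by
  have := h.2.add_smul_one_posDef h.1
  simpa using this

theorem Coercive.le_quad (h : Coercive r R) (x : κ → ℝ) : r * (x ⬝ᵥ x) ≤ (R *ᵥ x) ⬝ᵥ x := by
  have := h.2.quad_nonneg x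
  simp only [sub_mulVec, smul_mulVec, one_mulVec, sub_dotProduct, smul_dotProduct,
    smul_eq_mul] at this
  linarith

theorem Matrix.PosDef.mulVec_inv_mulVec (h : R.PosDef) (x : κ → ℝ) : R *ᵥ (R⁻¹ *ᵥ x) = x := by
  rw [mulVec_mulVec, Matrix.mul_nonsing_inv _ ((Matrix.isUnit_iff_isUnit_det _).1 h.isUnit),
    one_mulVec]

/-- The operator bound `|R⁻¹| ≤ 1 / r`. It depends on `r` alone, so multiplication by `R⁻¹`
preserves `L²`. -/
theorem Coercive.inv_quad_le (h : Coercive r R) (x : κ → ℝ) :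
    (R⁻¹ *ᵥ x) ⬝ᵥ (R⁻¹ *ᵥ x) ≤ r⁻¹ ^ 2 * (x ⬝ᵥ x) := by
  have hr := h.1
  have h1 := h.le_quad (R⁻¹ *ᵥ x)
  rw [h.posDef.mulVec_inv_mulVec] at h1
  set a := R⁻¹ *ᵥ x
  have h2 := dot_self_nonneg (x - r • a)
  simp only [sub_dotProduct, dotProduct_sub, smul_dotProduct, dotProduct_smul, smul_eq_mul] at h2
  rw [dotProduct_comm a x] at h2
  rw [inv_pow, inv_mul_eq_div, le_div_iff₀ (by positivity)]
  nlinarith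

theorem gram_posSemidef (hR : R.PosDef) : (wGram R H).PosSemidef := by
  simpa [wGram] using hR.inv.posSemidef.conjTranspose_mul_mul_same H

theorem gram_mulVec (w : ι → ℝ) : wGram R H *ᵥ w = Hᵀ *ᵥ (R⁻¹ *ᵥ (H *ᵥ w)) := by
  simp [wGram, mulVec_mulVec, Matrix.mul_assoc]

theorem gram_quad (hR : R.PosDef) (w x : ι → ℝ) :
    (wGram R H *ᵥ w) ⬝ᵥ x = (R *ᵥ (R⁻¹ *ᵥ (H *ᵥ w))) ⬝ᵥ (R⁻¹ *ᵥ (H *ᵥ x)) := by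
  rw [gram_mulVec, mulVec_dotProduct, transpose_transpose, hR.posSemidef.symm_quad,
    hR.mulVec_inv_mulVec]

theorem mulVec_eq_zero_of_gram (hR : R.PosDef) {p : ι → ℝ} (hp : wGram R H *ᵥ p = 0) :
    H *ᵥ p = 0 := by
  have h := gram_quad (H := H) hR p p
  rw [hp, zero_dotProduct, hR.mulVec_inv_mulVec] at h
  have h2 := hR.inv.posSemidef
  by_contra hne
  have := hR.inv.dotProduct_mulVec_pos hne
  simp only [star_trivial] at this
  linarith

/-- `H^* R⁻¹ H` and `H` have the same kernel, and `H^* v` is orthogonal to it. These normal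
equations yield the splitting of any vector. -/
theorem exists_gram_mulVec_eq (hR : R.PosDef) (v : κ → ℝ) : ∃ w, wGram R H *ᵥ w = Hᵀ *ᵥ v := by
  refine exists_mulVec_eq_of_forall_dotProduct_eq_zero _ _ fun p hp => ?_
  rw [(gram_posSemidef hR).transpose_eq] at hp
  rw [mulVec_dotProduct, transpose_transpose, mulVec_eq_zero_of_gram hR hp, zero_dotProduct]

/-- The component in `R⁻¹ Im H` of a solution of `H^* a = g`, as a limit of regularizations. -/
theorem tendsto_regSol_gram (h : Coercive r R) (w : ι → ℝ) :
    Tendsto (fun k => R⁻¹ *ᵥ (H *ᵥ regSol (wGram R H) (wGram R H *ᵥ w) (regPar k))) atTop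
      (𝓝 (R⁻¹ *ᵥ (H *ᵥ w))) := by
  have hr := h.1
  set x := fun k => regSol (wGram R H) (wGram R H *ᵥ w) (regPar k)
  set d := fun k => R⁻¹ *ᵥ (H *ᵥ (x k - w))
  -- The energy of `x k - w` for the Gram matrix is the `R`-energy of `d k`, which coercivity turns
  -- into a Euclidean bound.
  have hd : Tendsto (fun k => d k ⬝ᵥ d k) atTop (𝓝 0) := by
    refine squeeze_zero (fun k => dot_self_nonneg _) (fun k => ?_)
      (g := fun k => r⁻¹ * ((wGram R H *ᵥ (x k - w)) ⬝ᵥ (x k - w))) ?_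
    · rw [gram_quad h.posDef, inv_mul_eq_div, le_div_iff₀ hr]
      have := h.le_quad (d k)
      linarith
    · simpa using (tendsto_regSol_energy (gram_posSemidef (H := H) h.posDef) w).const_mul r⁻¹
  rw [tendsto_pi_nhds]
  intro i
  rw [← tendsto_sub_nhds_zero_iff]
  have hs : Tendsto (fun k => Real.sqrt (d k ⬝ᵥ d k)) atTop (𝓝 0) := by simpa using hd.sqrt
  refine squeeze_zero_norm (fun k => Real.abs_le_sqrt ?_) hs
  have e : (R⁻¹ *ᵥ (H *ᵥ x k)) i - (R⁻¹ *ᵥ (H *ᵥ w)) i = d k i := by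
    simp [d, mulVec_sub]
  change ((R⁻¹ *ᵥ (H *ᵥ x k)) i - (R⁻¹ *ᵥ (H *ᵥ w)) i) ^ 2 ≤ _
  rw [e, pow_two]
  exact Finset.single_le_sum (f := fun i => d k i * d k i) (fun i _ => mul_self_nonneg _)
    (Finset.mem_univ i)

/-- `(a, b)` splits `f` along `R⁻¹ Im H` and `Ker H^*`. -/
def IsSplit (R : Matrix κ κ ℝ) (H : Matrix κ ι ℝ) (f a b : κ → ℝ) : Prop :=
  (∃ w, a = R⁻¹ *ᵥ (H *ᵥ w)) ∧ Hᵀ *ᵥ b = 0 ∧ a + b = f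

/-- The component of `f` in `R⁻¹ Im H`. -/
noncomputable def splitIm (R : Matrix κ κ ℝ) (H : Matrix κ ι ℝ) (f : κ → ℝ) : κ → ℝ :=
  Classical.epsilon fun a => ∃ b, IsSplit R H f a b

theorem isSplit_splitIm (hR : R.PosDef) (f : κ → ℝ) :
    IsSplit R H f (splitIm R H f) (f - splitIm R H f) := by
  obtain ⟨w, hw⟩ := exists_gram_mulVec_eq (H := H) hR f
  have : ∃ a b, IsSplit R H f a b := by
    refine ⟨R⁻¹ *ᵥ (H *ᵥ w), f - R⁻¹ *ᵥ (H *ᵥ w), ⟨w, rfl⟩, ?_, by abel⟩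
    rw [mulVec_sub, ← gram_mulVec, hw, sub_self]
  obtain ⟨b, hb⟩ := Classical.epsilon_spec (p := fun a => ∃ b, IsSplit R H f a b) this
  have e : f - splitIm R H f = b := by
    exact sub_eq_of_eq_add' hb.2.2.symm
  rw [e]
  exact hb

theorem dotProduct_eq_zero_of_im_ker (hR : R.PosDef) {a b : κ → ℝ}
    (ha : ∃ w : ι → ℝ, a = R⁻¹ *ᵥ (H *ᵥ w)) (hb : Hᵀ *ᵥ b = 0) : (R *ᵥ a) ⬝ᵥ b = 0 := by
  obtain ⟨w, rfl⟩ := ha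
  rw [hR.mulVec_inv_mulVec, mulVec_dotProduct, hb, zero_dotProduct]

theorem eq_zero_of_quad_eq_zero (hR : R.PosDef) {a : κ → ℝ} (h : (R *ᵥ a) ⬝ᵥ a = 0) : a = 0 := by
  by_contra hne
  have := hR.dotProduct_mulVec_pos hne
  simp only [star_trivial] at this
  rw [dotProduct_comm] at this
  linarith

/-- `R⁻¹ Im H` and `Ker H^*` are `R`-orthogonal, so `H^*` is injective on `R⁻¹ Im H`. All uniqueness
statements for `p_H`, for representatives and for misfits rest on this. -/
theorem eq_of_im_of_mulVec_eq (hR : R.PosDef) {a a' : κ → ℝ}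
    (ha : ∃ w : ι → ℝ, a = R⁻¹ *ᵥ (H *ᵥ w)) (ha' : ∃ w : ι → ℝ, a' = R⁻¹ *ᵥ (H *ᵥ w))
    (h : Hᵀ *ᵥ a = Hᵀ *ᵥ a') : a = a' := by
  have h1 : ∃ w : ι → ℝ, a - a' = R⁻¹ *ᵥ (H *ᵥ w) := by
    obtain ⟨w, rfl⟩ := ha
    obtain ⟨w', rfl⟩ := ha'
    exact ⟨w - w', by simp [mulVec_sub]⟩
  have h2 : Hᵀ *ᵥ (a - a') = 0 := by rw [mulVec_sub, h, sub_self]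
  exact sub_eq_zero.1 (eq_zero_of_quad_eq_zero hR (dotProduct_eq_zero_of_im_ker hR h1 h2))

/-- `splitIm` is defined by choice at each point; this limit of explicit rational expressions is
what makes it measurable in a parameter. -/
theorem tendsto_splitIm (h : Coercive r R) (f : κ → ℝ) :
    Tendsto (fun k => R⁻¹ *ᵥ (H *ᵥ regSol (wGram R H) (Hᵀ *ᵥ f) (regPar k))) atTop
      (𝓝 (splitIm R H f)) := by
  obtain ⟨w, hw⟩ := exists_gram_mulVec_eq (H := H) h.posDef f
  rw [← hw]
  convert tendsto_regSol_gram (H := H) h w using 2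
  obtain ⟨h1, h2, -⟩ := isSplit_splitIm (H := H) h.posDef f
  refine eq_of_im_of_mulVec_eq h.posDef h1 ⟨w, rfl⟩ ?_
  rw [← gram_mulVec, hw]
  rw [mulVec_sub, sub_eq_zero] at h2
  exact h2.symm

/-- Pythagoras in the inner product of `R`. -/
theorem quad_add_of_orthogonal (hR : R.PosSemidef) {a b : κ → ℝ} (h : (R *ᵥ a) ⬝ᵥ b = 0) :
    (R *ᵥ (a + b)) ⬝ᵥ (a + b) = (R *ᵥ a) ⬝ᵥ a + (R *ᵥ b) ⬝ᵥ b := by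
  simp only [mulVec_add, add_dotProduct, dotProduct_add]
  rw [hR.symm_quad b a, h]
  ring

theorem quad_splitIm_le (hR : R.PosDef) (f : κ → ℝ) :
    (R *ᵥ splitIm R H f) ⬝ᵥ splitIm R H f ≤ (R *ᵥ f) ⬝ᵥ f := by
  obtain ⟨h1, h2, h3⟩ := isSplit_splitIm (H := H) hR f
  have := quad_add_of_orthogonal hR.posSemidef (dotProduct_eq_zero_of_im_ker hR h1 h2)
  rw [h3] at this
  have := hR.posSemidef.quad_nonneg (f - splitIm R H f)
  linarith

end Gram

/-! ### Measurability of matrix functions -/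

section Measurability

open scoped MatrixOrder Matrix.Norms.L2Operator in
theorem continuousOn_psdSqrt {k : ℕ} :
    ContinuousOn (psdSqrt : Matrix (Fin k) (Fin k) ℝ → _) {A | A.PosSemidef} := by
  have h := CFC.continuousOn_sqrt (A := Matrix (Fin k) (Fin k) ℝ)
  have e : {A : Matrix (Fin k) (Fin k) ℝ | A.PosSemidef} = {A | 0 ≤ A} := by
    ext A; exact Matrix.nonneg_iff_posSemidef.symm
  rw [e]
  exact h

open scoped MatrixOrder in
theorem psdSqrt_mul_self {k : ℕ} {B : Matrix (Fin k) (Fin k) ℝ} (h : B.PosSemidef) :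
    psdSqrt (B * B) = B :=
  CFC.sqrt_unique rfl (Matrix.nonneg_iff_posSemidef.mpr h)

theorem transpose_mul_self_posSemidef {m n : ℕ} (A : Matrix (Fin m) (Fin n) ℝ) :
    (Aᵀ * A).PosSemidef := by
  simpa using Matrix.posSemidef_conjTranspose_mul_self A

/-- The square root is continuous only on the semidefinite cone, while measurability needs a map
defined and continuous on all matrices. Since `Aᵀ A` is always semidefinite and its root is `A` on
the cone, this composition is such an extension of `psdSqrt`. -/
theorem continuous_psdSqrt_psdSqrt_transpose_mul_self {k : ℕ} :
    Continuous fun A : Matrix (Fin k) (Fin k) ℝ => psdSqrt (psdSqrt (Aᵀ * A)) := by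
  have h1 : Continuous fun A : Matrix (Fin k) (Fin k) ℝ => Aᵀ * A := by fun_prop
  exact continuousOn_psdSqrt.comp_continuous
    (continuousOn_psdSqrt.comp_continuous h1 transpose_mul_self_posSemidef)
    fun A => (psdSqrt_spec (transpose_mul_self_posSemidef A)).1

variable {α : Type*} [MeasurableSpace α] {μ : Measure α}

theorem aestronglyMeasurable_psdSqrt {k : ℕ}
    {A : α → Matrix (Fin k) (Fin k) ℝ} (hA : AEStronglyMeasurable A μ)
    (hp : ∀ᵐ t ∂μ, (A t).PosSemidef) : AEStronglyMeasurable (fun t => psdSqrt (A t)) μ := by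
  refine (continuous_psdSqrt_psdSqrt_transpose_mul_self.comp_aestronglyMeasurable hA).congr ?_
  filter_upwards [hp] with t ht
  have : psdSqrt ((A t)ᵀ * A t) = A t := by
    rw [ht.transpose_eq, psdSqrt_mul_self ht]
  simp only [this]

variable {ι κ : Type*} [Fintype ι] [Fintype κ] [DecidableEq ι] [DecidableEq κ]

theorem aestronglyMeasurable_of_entries {A : α → Matrix κ ι ℝ}
    (h : ∀ i j, AEStronglyMeasurable (fun t => A t i j) μ) : AEStronglyMeasurable A μ := by
  have key : ∀ B : α → κ → ι → ℝ, (∀ i j, AEStronglyMeasurable (fun t => B t i j) μ) →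
      AEStronglyMeasurable B μ := fun B hB => AEMeasurable.aestronglyMeasurable <|
    aemeasurable_pi_lambda _ fun i => aemeasurable_pi_lambda _ fun j => (hB i j).aemeasurable
  exact key A h

/-- Cramer's rule: determinant and adjugate are continuous, and scalar inversion is measurable even
through zero. -/
theorem AEStronglyMeasurable.matrix_inv {A : α → Matrix ι ι ℝ} (h : AEStronglyMeasurable A μ) :
    AEStronglyMeasurable (fun t => (A t)⁻¹) μ := by
  have e : (fun t => (A t)⁻¹) = fun t => ((A t).det)⁻¹ • (A t).adjugate := by
    funext t
    rw [Matrix.inv_def, Ring.inverse_eq_inv']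
  rw [e]
  have h1 : AEStronglyMeasurable (fun t => (A t).det) μ :=
    continuous_id.matrix_det.comp_aestronglyMeasurable h
  have h2 : AEStronglyMeasurable (fun t => (A t).adjugate) μ :=
    continuous_id.matrix_adjugate.comp_aestronglyMeasurable h
  exact h1.aemeasurable.inv.aestronglyMeasurable.smul h2

theorem AEStronglyMeasurable.regSol {M : α → Matrix ι ι ℝ} {g : α → ι → ℝ}
    (hM : AEStronglyMeasurable M μ) (hg : AEStronglyMeasurable g μ) (ε : ℝ) :
    AEStronglyMeasurable (fun t => regSol (M t) (g t) ε) μ := by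
  have h1 : AEStronglyMeasurable (fun t => M t + ε • (1 : Matrix ι ι ℝ)) μ := by fun_prop
  have h2 := AEStronglyMeasurable.matrix_inv h1
  unfold _root_.regSol
  fun_prop

theorem AEStronglyMeasurable.wGram {R : α → Matrix κ κ ℝ} {H : α → Matrix κ ι ℝ}
    (hR : AEStronglyMeasurable R μ) (hH : AEStronglyMeasurable H μ) :
    AEStronglyMeasurable (fun t => _root_.wGram (R t) (H t)) μ := by
  have := AEStronglyMeasurable.matrix_inv hR
  unfold _root_.wGram
  fun_prop

theorem AEStronglyMeasurable.splitIm {r : ℝ} {R : α → Matrix κ κ ℝ} {H : α → Matrix κ ι ℝ}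
    {f : α → κ → ℝ} (hR : AEStronglyMeasurable R μ) (hH : AEStronglyMeasurable H μ)
    (hf : AEStronglyMeasurable f μ) (hr : ∀ᵐ t ∂μ, Coercive r (R t)) :
    AEStronglyMeasurable (fun t => splitIm (R t) (H t) (f t)) μ := by
  have h1 := AEStronglyMeasurable.matrix_inv hR
  have h2 : AEStronglyMeasurable (fun t => (H t)ᵀ *ᵥ f t) μ := by fun_prop
  refine aestronglyMeasurable_of_tendsto_ae Filter.atTop (f := fun k t => (R t)⁻¹ *ᵥ (H t *ᵥ
    _root_.regSol (_root_.wGram (R t) (H t)) ((H t)ᵀ *ᵥ f t) (regPar k))) (fun k => ?_) ?_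
  · have h3 := AEStronglyMeasurable.regSol (AEStronglyMeasurable.wGram hR hH) h2 (regPar k)
    fun_prop
  · filter_upwards [hr] with t ht using tendsto_splitIm ht (f t)

end Measurability

/-! ### Integrability of products -/

section Products

open scoped ENNReal

variable {α : Type*} [MeasurableSpace α] {μ : Measure α} {ι κ : Type*} [Fintype ι] [Fintype κ]

theorem MemLp.mulVec {p q s : ℝ≥0∞} [ENNReal.HolderTriple p q s] {A : α → Matrix κ ι ℝ}
    {f : α → ι → ℝ} (hA : ∀ i j, MemLp (fun t => A t i j) p μ) (hf : MemLp f q μ) :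
    MemLp (fun t => A t *ᵥ f t) s μ := by
  refine MemLp.of_eval fun i => ?_
  simp only [Matrix.mulVec, dotProduct]
  exact memLp_finsetSum _ fun j _ => (hf.eval j).mul (hA i j)

theorem MemLp.integrable_dotProduct {p q : ℝ≥0∞} [ENNReal.HolderTriple p q 1] {f g : α → ι → ℝ}
    (hf : MemLp f p μ) (hg : MemLp g q μ) : Integrable (fun t => f t ⬝ᵥ g t) μ := by
  simp only [dotProduct]
  exact integrable_finsetSum _ fun j _ =>
    memLp_one_iff_integrable.1 ((hg.eval j).mul (hf.eval j))

theorem integrable_dotProduct_self {f : α → ι → ℝ} (hf : MemLp f 2 μ) :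
    Integrable (fun t => f t ⬝ᵥ f t) μ := MemLp.integrable_dotProduct hf hf

theorem memLp_two_of_integrable_dotProduct_self {f : α → ι → ℝ} (hm : AEStronglyMeasurable f μ)
    (h : Integrable (fun t => f t ⬝ᵥ f t) μ) : MemLp f 2 μ := by
  refine MemLp.of_eval fun i => ?_
  have hmi : AEStronglyMeasurable (fun t => f t i) μ := by fun_prop
  rw [memLp_two_iff_integrable_sq hmi]
  refine h.mono' (by fun_prop) (Filter.Eventually.of_forall fun t => ?_)
  rw [Real.norm_eq_abs, abs_of_nonneg (sq_nonneg _), pow_two]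
  exact Finset.single_le_sum (f := fun i => f t i * f t i) (fun i _ => mul_self_nonneg _)
    (Finset.mem_univ i)

theorem memLp_two_entries_of_dotProduct {f g : α → ι → ℝ} (hf : MemLp f 2 μ)
    (hg : AEStronglyMeasurable g μ) {C : ℝ} (h : ∀ᵐ t ∂μ, g t ⬝ᵥ g t ≤ C * (f t ⬝ᵥ f t)) :
    MemLp g 2 μ := by
  refine memLp_two_of_integrable_dotProduct_self hg ?_
  refine ((integrable_dotProduct_self hf).const_mul C).mono' (by fun_prop) ?_
  filter_upwards [h] with t ht
  rwa [Real.norm_eq_abs, abs_of_nonneg (dot_self_nonneg _)]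

end Products

/-! ### Vector-valued absolutely continuous functions -/

section AbsolutelyContinuous

open Filter Topology
open scoped ENNReal

variable {ι : Type*} [Fintype ι] {a b : ℝ}

theorem absolutelyContinuousOnInterval_pi_iff {x : ℝ → ι → ℝ} :
    AbsolutelyContinuousOnInterval x a b ↔
      ∀ i, AbsolutelyContinuousOnInterval (fun t => x t i) a b := by
  constructor
  · intro h i
    refine squeeze_zero (fun E => Finset.sum_nonneg fun _ _ => dist_nonneg) (fun E => ?_) h
    exact Finset.sum_le_sum fun k _ => dist_le_pi_dist _ _ i
  · intro h
    have hs := tendsto_finsetSum (Finset.univ : Finset ι) fun i _ => h i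
    rw [Finset.sum_const_zero] at hs
    refine squeeze_zero (fun E => Finset.sum_nonneg fun _ _ => dist_nonneg) (fun E => ?_) hs
    rw [Finset.sum_comm]
    refine Finset.sum_le_sum fun k _ => ?_
    refine (dist_pi_le_iff (Finset.sum_nonneg fun _ _ => dist_nonneg)).2 fun i => ?_
    exact Finset.single_le_sum (f := fun i => dist (x (E.2 k).1 i) (x (E.2 k).2 i))
      (fun _ _ => dist_nonneg) (Finset.mem_univ i)

theorem ae_restrict_Icc_iff_Ioo {p : ℝ → Prop} :
    (∀ᵐ t ∂volume.restrict (Icc a b), p t) ↔ ∀ᵐ t ∂volume.restrict (Ioo a b), p t := by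
  rw [Measure.restrict_congr_set Ioo_ae_eq_Icc]

variable {x l : ℝ → ι → ℝ}

theorem AbsolutelyContinuousOnInterval.ae_hasDerivAt_pi (hab : a ≤ b)
    (hx : AbsolutelyContinuousOnInterval x a b) :
    ∀ᵐ t ∂volume.restrict (Icc a b), HasDerivAt x (deriv x t) t := by
  have h := fun i => (absolutelyContinuousOnInterval_pi_iff.1 hx i).ae_differentiableAt
  rw [uIcc_of_le hab] at h
  rw [ae_restrict_iff' measurableSet_Icc]
  filter_upwards [ae_all_iff.2 h] with t ht hts
  exact (differentiableAt_pi.2 fun i => ht i hts).hasDerivAt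

theorem AbsolutelyContinuousOnInterval.memLp_top (hab : a ≤ b)
    (hx : AbsolutelyContinuousOnInterval x a b) : MemLp x ∞ (volume.restrict (Icc a b)) := by
  obtain ⟨C, hC⟩ := hx.exists_bound
  have hc := hx.continuousOn
  rw [uIcc_of_le hab] at hC hc
  exact memLp_top_of_bound (hc.aestronglyMeasurable measurableSet_Icc) C
    ((ae_restrict_iff' measurableSet_Icc).2 (Eventually.of_forall hC))

theorem AbsolutelyContinuousOnInterval.memLp_deriv (hab : a ≤ b)
    (hx : AbsolutelyContinuousOnInterval x a b) :
    MemLp (deriv x) 1 (volume.restrict (Icc a b)) := by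
  refine MemLp.of_eval fun i => ?_
  rw [memLp_one_iff_integrable]
  have h := (absolutelyContinuousOnInterval_pi_iff.1 hx i).intervalIntegrable_deriv
  rw [intervalIntegrable_iff_integrableOn_Icc_of_le hab] at h
  refine Integrable.congr h ?_
  filter_upwards [hx.ae_hasDerivAt_pi hab] with t ht
  exact ((hasDerivAt_pi.1 ht) i).deriv

/-- Scalar integration by parts in each coordinate. The coordinates of `deriv x` are the derivatives
of the coordinates only where `x` is differentiable, hence the a.e. replacements. -/
theorem AbsolutelyContinuousOnInterval.integral_dotProduct_deriv (hab : a ≤ b)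
    (hl : AbsolutelyContinuousOnInterval l a b) (hx : AbsolutelyContinuousOnInterval x a b) :
    ∫ t, l t ⬝ᵥ deriv x t ∂volume.restrict (Icc a b) =
      l b ⬝ᵥ x b - l a ⬝ᵥ x a - ∫ t, deriv l t ⬝ᵥ x t ∂volume.restrict (Icc a b) := by
  have key : ∀ i, ∫ t, l t i * deriv x t i ∂volume.restrict (Icc a b) =
      l b i * x b i - l a i * x a i
        - ∫ t, deriv l t i * x t i ∂volume.restrict (Icc a b) := by
    intro i
    have h := (absolutelyContinuousOnInterval_pi_iff.1 hl i).integral_mul_deriv_eq_deriv_mul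
      (absolutelyContinuousOnInterval_pi_iff.1 hx i)
    rw [intervalIntegral.integral_of_le hab, intervalIntegral.integral_of_le hab,
      ← integral_Icc_eq_integral_Ioc, ← integral_Icc_eq_integral_Ioc] at h
    convert h using 1
    · refine integral_congr_ae ?_
      filter_upwards [hx.ae_hasDerivAt_pi hab] with t ht
      rw [((hasDerivAt_pi.1 ht) i).deriv]
    · congr 1
      refine integral_congr_ae ?_
      filter_upwards [hl.ae_hasDerivAt_pi hab] with t ht
      rw [((hasDerivAt_pi.1 ht) i).deriv]
  have h1 : ∀ i, Integrable (fun t => l t i * deriv x t i) (volume.restrict (Icc a b)) := fun i =>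
    memLp_one_iff_integrable.1 (((hx.memLp_deriv hab).eval i).mul ((hl.memLp_top hab).eval i))
  have h2 : ∀ i, Integrable (fun t => deriv l t i * x t i) (volume.restrict (Icc a b)) := fun i =>
    memLp_one_iff_integrable.1 (((hx.memLp_top hab).eval i).mul ((hl.memLp_deriv hab).eval i))
  simp only [dotProduct]
  rw [integral_finsetSum _ fun i _ => h1 i, integral_finsetSum _ fun i _ => h2 i,
    ← Finset.sum_sub_distrib, ← Finset.sum_sub_distrib]
  exact Finset.sum_congr rfl fun i _ => key i

/-- The primitive of an integrable function. -/
theorem absolutelyContinuousOnInterval_primitive (hab : a ≤ b) {f : ℝ → ι → ℝ}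
    (hf : MemLp f 1 (volume.restrict (Icc a b))) (c : ι → ℝ) :
    AbsolutelyContinuousOnInterval (fun t i => c i + ∫ s in a..t, f s i) a b ∧
      ∀ᵐ t ∂volume.restrict (Icc a b),
        HasDerivAt (fun t i => c i + ∫ s in a..t, f s i) (f t) t := by
  have hi : ∀ i, IntervalIntegrable (fun s => f s i) volume a b := fun i => by
    rw [intervalIntegrable_iff_integrableOn_Icc_of_le hab]
    exact memLp_one_iff_integrable.1 (hf.eval i)
  constructor
  · refine absolutelyContinuousOnInterval_pi_iff.2 fun i => ?_
    have hc : AbsolutelyContinuousOnInterval (fun _ : ℝ => c i) a b :=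
      (LipschitzWith.const (c i)).lipschitzOnWith.absolutelyContinuousOnInterval
    exact hc.fun_add ((hi i).absolutelyContinuousOnInterval_intervalIntegral left_mem_uIcc)
  · rw [ae_restrict_iff' measurableSet_Icc]
    filter_upwards [ae_all_iff.2 fun i => (hi i).ae_hasDerivAt_integral] with t ht hts
    rw [uIcc_of_le hab] at ht
    exact hasDerivAt_pi.2 fun i => (ht i hts a (left_mem_Icc.2 hab)).const_add (c i)

/-- A bounded measurable function is a bounded a.e. limit of absolutely continuous functions with
prescribed boundary values. -/
theorem exists_seq_absolutelyContinuous_tendsto_real (hab : a < b) {h : ℝ → ℝ}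
    (hm : AEStronglyMeasurable h (volume.restrict (Icc a b))) {C : ℝ} (hC : ∀ t, |h t| ≤ C)
    (p q : ℝ) :
    ∃ x : ℕ → ℝ → ℝ, (∀ k, AbsolutelyContinuousOnInterval (x k) a b ∧ x k a = p ∧ x k b = q ∧
      ∀ t ∈ Icc a b, |x k t| ≤ C + (|p| + |q|)) ∧
      ∀ᵐ t ∂volume.restrict (Icc a b), Tendsto (fun k => x k t) atTop (𝓝 (h t)) := by
  have hC0 : 0 ≤ C := (abs_nonneg _).trans (hC 0)
  -- Extension by zero makes `h` integrable on the whole line, so that the averages below may reach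
  -- to the left of `a`.
  set h1 : ℝ → ℝ := (Icc a b).indicator h with hh1
  have hb1 : ∀ t, |h1 t| ≤ C := fun t => by
    by_cases ht : t ∈ Icc a b
    · simpa [hh1, ht] using hC t
    · simpa [hh1, ht] using hC0
  have hint : Integrable h1 := by
    rw [hh1, integrable_indicator_iff measurableSet_Icc]
    exact Integrable.of_bound hm C (Eventually.of_forall fun t => hC t)
  set Φ : ℝ → ℝ := fun t => ∫ s in a..t, h1 s with hΦ
  have hΦsub : ∀ s t, Φ t - Φ s = ∫ u in s..t, h1 u := fun s t =>
    intervalIntegral.integral_interval_sub_left hint.intervalIntegrable hint.intervalIntegrable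
  have hΦL : ∀ s t, |Φ t - Φ s| ≤ C * |t - s| := fun s t => by
    rw [hΦsub]
    exact intervalIntegral.norm_integral_le_of_norm_le_const (f := h1) fun u _ => hb1 u
  have hK : ∀ k : ℕ, (0 : ℝ) < (k : ℝ) + 1 := fun k => by positivity
  -- Backward averages of `h1` over length `1 / (k + 1)`: Lipschitz, bounded by `C`, and convergent
  -- to `h` a.e. by Lebesgue differentiation.
  set y : ℕ → ℝ → ℝ := fun k t => ((k : ℝ) + 1) * (Φ t - Φ (t - ((k : ℝ) + 1)⁻¹)) with hy
  have hyb : ∀ k t, |y k t| ≤ C := fun k t => by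
    have := hΦL (t - ((k : ℝ) + 1)⁻¹) t
    rw [sub_sub_cancel, abs_of_pos (inv_pos.2 (hK k)), ← div_eq_mul_inv, le_div_iff₀ (hK k)] at this
    rw [hy]
    simp only [abs_mul, abs_of_pos (hK k)]
    linarith
  have hyac : ∀ k, AbsolutelyContinuousOnInterval (y k) a b := fun k => by
    have hL : LipschitzWith (C.toNNReal) Φ := LipschitzWith.of_dist_le_mul fun s t => by
      rw [Real.dist_eq, Real.dist_eq, Real.coe_toNNReal C hC0]
      exact hΦL t s
    have hL2 : LipschitzWith (C.toNNReal * 1) fun t => Φ (t - ((k : ℝ) + 1)⁻¹) :=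
      hL.comp (LipschitzWith.of_dist_le_mul fun s t => by simp)
    exact (hL.lipschitzOnWith.absolutelyContinuousOnInterval.fun_sub
      hL2.lipschitzOnWith.absolutelyContinuousOnInterval).const_mul _
  have hylim : ∀ᵐ t ∂volume.restrict (Icc a b), Tendsto (fun k => y k t) atTop (𝓝 (h t)) := by
    rw [ae_restrict_iff' measurableSet_Icc]
    filter_upwards [LocallyIntegrable.ae_hasDerivAt_integral hint.locallyIntegrable] with t ht hts
    have hd : HasDerivAt Φ (h t) t := by
      have := ht a
      rwa [hh1, indicator_of_mem hts] at this
    have hs : Tendsto (fun k : ℕ => t - ((k : ℝ) + 1)⁻¹) atTop (𝓝[≠] t) := by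
      rw [tendsto_nhdsWithin_iff]
      constructor
      · have := (tendsto_one_div_add_atTop_nhds_zero_nat (𝕜 := ℝ)).const_sub t
        simpa using this
      · refine Eventually.of_forall fun k => ?_
        have := inv_pos.2 (hK k)
        simp only [mem_compl_iff, mem_singleton_iff]
        linarith
    refine ((hasDerivAt_iff_tendsto_slope.1 hd).comp hs).congr fun k => ?_
    have := (hK k).ne'
    simp only [Function.comp, slope, vsub_eq_sub, smul_eq_mul, hy, sub_sub_cancel_left, inv_neg,
      inv_inv]
    ring
  -- A Lipschitz cutoff, zero at both endpoints and eventually equal to one at each interior point.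
  set χ : ℕ → ℝ → ℝ := fun k t => min 1 (((k : ℝ) + 1) * min (t - a) (b - t)) with hχ
  have hχac : ∀ k, AbsolutelyContinuousOnInterval (χ k) a b := fun k => by
    have h1 : LipschitzWith 1 fun t : ℝ => t - a := LipschitzWith.of_dist_le_mul fun s t => by simp
    have h2 : LipschitzWith 1 fun t : ℝ => b - t := LipschitzWith.of_dist_le_mul fun s t => by
      rw [dist_sub_left]; simp
    have h3 : LipschitzWith (Real.toNNReal ((k : ℝ) + 1) * max 1 1)
        fun t : ℝ => ((k : ℝ) + 1) * min (t - a) (b - t) := by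
      refine LipschitzWith.comp (f := fun s => ((k : ℝ) + 1) * s) ?_ (h1.min h2)
      exact LipschitzWith.of_dist_le_mul fun s t => by
        rw [Real.dist_eq, Real.dist_eq, Real.coe_toNNReal _ (hK k).le, ← mul_sub, abs_mul,
          abs_of_pos (hK k)]
    exact (h3.const_min 1).lipschitzOnWith.absolutelyContinuousOnInterval
  have hχ01 : ∀ k, ∀ t ∈ Icc a b, 0 ≤ χ k t ∧ χ k t ≤ 1 := fun k t ht => by
    refine ⟨le_min zero_le_one (mul_nonneg (hK k).le (le_min ?_ ?_)), min_le_left _ _⟩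
    · linarith [ht.1]
    · linarith [ht.2]
  -- The affine interpolant of the boundary values, blended in by the cutoff.
  set ψ : ℝ → ℝ := fun t => p + (t - a) * ((q - p) / (b - a)) with hψ
  have hψac : AbsolutelyContinuousOnInterval ψ a b := by
    have : ContDiff ℝ 1 ψ := by rw [hψ]; fun_prop
    exact this.contDiffOn.absolutelyContinuousOnInterval
  have hψb : ∀ t ∈ Icc a b, |ψ t| ≤ |p| + |q| := fun t ht => by
    have hba : 0 < b - a := by linarith
    have e : ψ t = (b - t) / (b - a) * p + (t - a) / (b - a) * q := by
      rw [hψ]; field_simp; ring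
    have e1 : 0 ≤ (b - t) / (b - a) := div_nonneg (by linarith [ht.2]) hba.le
    have e2 : 0 ≤ (t - a) / (b - a) := div_nonneg (by linarith [ht.1]) hba.le
    have e3 : (b - t) / (b - a) ≤ 1 := (div_le_one hba).2 (by linarith [ht.1])
    have e4 : (t - a) / (b - a) ≤ 1 := (div_le_one hba).2 (by linarith [ht.2])
    rw [e]
    refine (abs_add_le _ _).trans (add_le_add ?_ ?_)
    · rw [abs_mul, abs_of_nonneg e1]
      exact mul_le_of_le_one_left (abs_nonneg _) e3
    · rw [abs_mul, abs_of_nonneg e2]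
      exact mul_le_of_le_one_left (abs_nonneg _) e4
  refine ⟨fun k t => χ k t * y k t + (1 - χ k t) * ψ t, fun k => ⟨?_, ?_, ?_, fun t ht => ?_⟩, ?_⟩
  · have hc : AbsolutelyContinuousOnInterval (fun _ : ℝ => (1 : ℝ)) a b :=
      (LipschitzWith.const (1 : ℝ)).lipschitzOnWith.absolutelyContinuousOnInterval
    exact ((hχac k).mul (hyac k)).fun_add ((hc.fun_sub (hχac k)).mul hψac)
  · have : χ k a = 0 := by
      simp [hχ, hab.le]
    simp [this, hψ]
  · have : χ k b = 0 := by
      simp [hχ, hab.le]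
    have hba : b - a ≠ 0 := by linarith
    simp only [this, hψ]
    field_simp
    ring
  · obtain ⟨h0, h1⟩ := hχ01 k t ht
    refine (abs_add_le _ _).trans (add_le_add ?_ ?_)
    · rw [abs_mul, abs_of_nonneg h0]
      exact (mul_le_of_le_one_left (abs_nonneg _) h1).trans (hyb k t)
    · rw [abs_mul, abs_of_nonneg (by linarith)]
      exact (mul_le_of_le_one_left (abs_nonneg _) (by linarith)).trans (hψb t ht)
  · have hint : ∀ᵐ t ∂volume.restrict (Icc a b), t ∈ Ioo a b :=
      ae_restrict_Icc_iff_Ioo.2 (ae_restrict_mem measurableSet_Ioo)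
    filter_upwards [hylim, hint] with t ht hts
    have hχ1 : ∀ᶠ k in atTop, χ k t = 1 := by
      have hpos : 0 < min (t - a) (b - t) :=
        lt_min (by linarith [hts.1]) (by linarith [hts.2])
      have := ((tendsto_natCast_atTop_atTop (R := ℝ)).atTop_add
        (tendsto_const_nhds (x := (1 : ℝ)))).atTop_mul_const hpos
      filter_upwards [this.eventually_ge_atTop 1] with k hk
      exact min_eq_left hk
    refine ht.congr' ?_
    filter_upwards [hχ1] with k hk
    rw [hk]; ring

theorem exists_seq_absolutelyContinuous_tendsto (hab : a < b) {h : ℝ → ι → ℝ}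
    (hm : AEStronglyMeasurable h (volume.restrict (Icc a b))) {C : ℝ} (hC : ∀ t i, |h t i| ≤ C)
    (p q : ι → ℝ) :
    ∃ x : ℕ → ℝ → ι → ℝ, ∃ C', (∀ k, AbsolutelyContinuousOnInterval (x k) a b ∧ x k a = p ∧
      x k b = q ∧ ∀ t ∈ Icc a b, ∀ i, |x k t i| ≤ C') ∧
      ∀ᵐ t ∂volume.restrict (Icc a b), Tendsto (fun k => x k t) atTop (𝓝 (h t)) := by
  have hmi : ∀ i, AEStronglyMeasurable (fun t => h t i) (volume.restrict (Icc a b)) := fun i => by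
    fun_prop
  choose y hy hlim using fun i =>
    exists_seq_absolutelyContinuous_tendsto_real hab (hmi i) (fun t => hC t i) (p i) (q i)
  refine ⟨fun k t i => y i k t, C + (‖p‖ + ‖q‖), fun k => ⟨?_, ?_, ?_, fun t ht i => ?_⟩, ?_⟩
  · exact absolutelyContinuousOnInterval_pi_iff.2 fun i => (hy i k).1
  · exact funext fun i => (hy i k).2.1
  · exact funext fun i => (hy i k).2.2.1
  · refine ((hy i k).2.2.2 t ht).trans ?_
    gcongr
    · exact norm_le_pi_norm p i
    · exact norm_le_pi_norm q i
  · filter_upwards [ae_all_iff.2 hlim] with t ht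
    exact tendsto_pi_nhds.2 ht

end AbsolutelyContinuous

/-! ### Linear differential equations with integrable coefficients -/

section LinearODE

open Filter Topology
open scoped ENNReal

variable {ι : Type*} [Fintype ι] {a b : ℝ}

/-- With `φ` the primitive of `α`, the integrand is a.e. the derivative of `φ ^ (k + 1) / (k + 1)`.
This produces the factorials for the Volterra iterates when `α` is merely integrable. -/
theorem integral_mul_primitive_pow (hab : a ≤ b) {α : ℝ → ℝ}
    (hα : IntervalIntegrable α volume a b) (k : ℕ) {t : ℝ} (ht : t ∈ Icc a b) :
    ∫ s in a..t, α s * (∫ u in a..s, α u) ^ k = (∫ u in a..t, α u) ^ (k + 1) / (k + 1) := by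
  have hsub : uIcc a t ⊆ uIcc a b := by
    rw [uIcc_of_le hab, uIcc_of_le ht.1]
    exact Icc_subset_Icc_right ht.2
  have hαt : IntervalIntegrable α volume a t := hα.mono_set hsub
  set φ : ℝ → ℝ := fun s => ∫ u in a..s, α u with hφ
  have hac : AbsolutelyContinuousOnInterval φ a t :=
    hαt.absolutelyContinuousOnInterval_intervalIntegral left_mem_uIcc
  have hpow : ∀ j : ℕ, AbsolutelyContinuousOnInterval (φ ^ j) a t := fun j => by
    induction j with
    | zero =>
      rw [pow_zero]
      exact (LipschitzWith.const (1 : ℝ)).lipschitzOnWith.absolutelyContinuousOnInterval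
    | succ j ih => rw [pow_succ]; exact ih.mul hac
  have hint := (hpow (k + 1)).integral_deriv_eq_sub
  have hφa : φ a = 0 := by simp [hφ]
  have h2 : ∫ s in a..t, deriv (φ ^ (k + 1)) s = ∫ s in a..t, ((k : ℝ) + 1) * (α s * φ s ^ k) := by
    refine intervalIntegral.integral_congr_ae ?_
    filter_upwards [hαt.ae_hasDerivAt_integral] with s hs hst
    have := ((hs (uIoc_subset_uIcc hst) a left_mem_uIcc).pow (k + 1)).deriv
    rw [show (φ ^ (k + 1)) = (fun x => ∫ u in a..x, α u) ^ (k + 1) from rfl, this]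
    push_cast
    ring
  rw [h2, intervalIntegral.integral_const_mul] at hint
  simp only [Pi.pow_apply, hφa] at hint
  rw [eq_div_iff (by positivity), mul_comm]
  simpa using hint

theorem norm_mulVec_le_sum (A : Matrix ι ι ℝ) (z : ι → ℝ) (i : ι) :
    |(A *ᵥ z) i| ≤ (∑ i, ∑ j, |A i j|) * ‖z‖ := by
  have h1 : |(A *ᵥ z) i| ≤ (∑ j, |A i j|) * ‖z‖ := by
    simp only [mulVec, dotProduct]
    rw [Finset.sum_mul]
    refine (Finset.abs_sum_le_sum_abs _ _).trans (Finset.sum_le_sum fun j _ => ?_)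
    rw [abs_mul]
    exact mul_le_mul_of_nonneg_left (norm_le_pi_norm z j) (abs_nonneg _)
  refine h1.trans (mul_le_mul_of_nonneg_right ?_ (norm_nonneg z))
  exact Finset.single_le_sum (f := fun i => ∑ j, |A i j|)
    (fun i _ => Finset.sum_nonneg fun j _ => abs_nonneg _) (Finset.mem_univ i)

/-- The primitive, as a continuous function on the interval. -/
noncomputable def primitiveC (hab : a ≤ b) (f : ℝ → ι → ℝ)
    (hf : MemLp f 1 (volume.restrict (Icc a b))) : C(Icc a b, ι → ℝ) :=
  ⟨fun t i => ∫ s in a..t, f s i, by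
    have h := (absolutelyContinuousOnInterval_primitive hab hf 0).1.continuousOn
    rw [uIcc_of_le hab] at h
    have h2 := continuousOn_iff_continuous_domRestrict.1 h
    simp only [Pi.zero_apply, zero_add] at h2
    exact h2⟩

variable {A : ℝ → Matrix ι ι ℝ}

theorem memLp_mulVec_continuousMap (hab : a ≤ b)
    (hA : ∀ i j, MemLp (fun t => A t i j) 1 (volume.restrict (Icc a b))) (z : C(Icc a b, ι → ℝ)) :
    MemLp (fun s => A s *ᵥ z (projIcc a b hab s)) 1 (volume.restrict (Icc a b)) := by
  refine MemLp.mulVec (p := 1) (q := ∞) hA (memLp_top_of_bound ?_ ‖z‖ ?_)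
  · exact (z.continuous.comp continuous_projIcc).aestronglyMeasurable
  · exact Eventually.of_forall fun t => z.norm_coe_le_norm _

theorem intervalIntegrable_of_memLp (hab : a ≤ b) {f : ℝ → ι → ℝ}
    (hf : MemLp f 1 (volume.restrict (Icc a b))) (i : ι) {t : ℝ} (ht : t ∈ Icc a b) :
    IntervalIntegrable (fun s => f s i) volume a t := by
  have : IntervalIntegrable (fun s => f s i) volume a b := by
    rw [intervalIntegrable_iff_integrableOn_Icc_of_le hab]
    exact memLp_one_iff_integrable.1 (hf.eval i)
  refine this.mono_set ?_
  rw [uIcc_of_le hab, uIcc_of_le ht.1]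
  exact Icc_subset_Icc_right ht.2

/-- The Volterra operator `z ↦ ∫_a^t A z`. -/
noncomputable def volterra (hab : a ≤ b)
    (hA : ∀ i j, MemLp (fun t => A t i j) 1 (volume.restrict (Icc a b))) :
    C(Icc a b, ι → ℝ) →ₗ[ℝ] C(Icc a b, ι → ℝ) where
  toFun z := primitiveC hab _ (memLp_mulVec_continuousMap hab hA z)
  map_add' z w := by
    ext t i
    change ∫ s in a..t, (A s *ᵥ (z + w) (projIcc a b hab s)) i =
      (∫ s in a..t, (A s *ᵥ z (projIcc a b hab s)) i) +
        ∫ s in a..t, (A s *ᵥ w (projIcc a b hab s)) i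
    rw [← intervalIntegral.integral_add
      (intervalIntegrable_of_memLp hab (memLp_mulVec_continuousMap hab hA z) i t.2)
      (intervalIntegrable_of_memLp hab (memLp_mulVec_continuousMap hab hA w) i t.2)]
    simp [mulVec_add]
  map_smul' c z := by
    ext t i
    change ∫ s in a..t, (A s *ᵥ (c • z) (projIcc a b hab s)) i =
      c * ∫ s in a..t, (A s *ᵥ z (projIcc a b hab s)) i
    rw [← intervalIntegral.integral_const_mul]
    simp [mulVec_smul]

theorem volterra_apply (hab : a ≤ b)
    (hA : ∀ i j, MemLp (fun t => A t i j) 1 (volume.restrict (Icc a b))) (z : C(Icc a b, ι → ℝ))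
    (t : Icc a b) (i : ι) :
    volterra hab hA z t i = ∫ s in a..t, (A s *ᵥ z (projIcc a b hab s)) i := rfl

theorem volterra_iterate_bound (hab : a ≤ b)
    (hA : ∀ i j, MemLp (fun t => A t i j) 1 (volume.restrict (Icc a b))) (z : C(Icc a b, ι → ℝ))
    (k : ℕ) (t : Icc a b) :
    ‖((volterra hab hA) ^ k) z t‖ ≤
      (∫ s in a..t, ∑ i, ∑ j, |A s i j|) ^ k / (k.factorial : ℝ) * ‖z‖ := by
  have hα : IntervalIntegrable (fun s => ∑ i, ∑ j, |A s i j|) volume a b := by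
    rw [intervalIntegrable_iff_integrableOn_Icc_of_le hab]
    exact integrable_finsetSum _ fun i _ => integrable_finsetSum _ fun j _ =>
      (memLp_one_iff_integrable.1 (hA i j)).abs
  have hα0 : ∀ s, 0 ≤ ∑ i, ∑ j, |A s i j| := fun s =>
    Finset.sum_nonneg fun i _ => Finset.sum_nonneg fun j _ => abs_nonneg _
  have hφ0 : ∀ s ∈ Icc a b, 0 ≤ ∫ u in a..s, ∑ i, ∑ j, |A u i j| := fun s hs =>
    intervalIntegral.integral_nonneg hs.1 fun u _ => hα0 u
  induction k generalizing t with
  | zero => simpa using z.norm_coe_le_norm t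
  | succ k ih =>
    have hnn : 0 ≤ (∫ s in a..t, ∑ i, ∑ j, |A s i j|) ^ (k + 1) / ((k + 1).factorial : ℝ) * ‖z‖ :=
      mul_nonneg (div_nonneg (pow_nonneg (hφ0 t t.2) _) (Nat.cast_nonneg _)) (norm_nonneg _)
    refine (pi_norm_le_iff_of_nonneg hnn).2 fun i => ?_
    rw [pow_succ', Module.End.mul_apply, volterra_apply]
    set w := ((volterra hab hA) ^ k) z
    have hsub : uIcc a (t : ℝ) ⊆ uIcc a b := by
      rw [uIcc_of_le hab, uIcc_of_le t.2.1]
      exact Icc_subset_Icc_right t.2.2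
    have hαt := hα.mono_set hsub
    have hφc : ContinuousOn (fun s => ∫ u in a..s, ∑ i, ∑ j, |A u i j|) (uIcc a (t : ℝ)) :=
      (hαt.absolutelyContinuousOnInterval_intervalIntegral left_mem_uIcc).continuousOn
    calc ‖∫ s in a..t, (A s *ᵥ w (projIcc a b hab s)) i‖
        ≤ ∫ s in a..t, (∑ i, ∑ j, |A s i j|) * (∫ u in a..s, ∑ i, ∑ j, |A u i j|) ^ k
            * (‖z‖ / (k.factorial : ℝ)) := by
          refine intervalIntegral.norm_integral_le_of_norm_le t.2.1 ?_
            ((hαt.mul_continuousOn (hφc.pow k)).mul_const _)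
          refine Eventually.of_forall fun s hs => (norm_mulVec_le_sum _ _ i).trans ?_
          have hsI : s ∈ Icc a b := ⟨hs.1.le, hs.2.trans t.2.2⟩
          have := ih ⟨s, hsI⟩
          rw [projIcc_of_mem hab hsI, mul_assoc]
          refine mul_le_mul_of_nonneg_left (this.trans (le_of_eq ?_)) (hα0 s)
          ring
      _ = _ := by
          rw [intervalIntegral.integral_mul_const, integral_mul_primitive_pow hab hα k t.2,
            Nat.factorial_succ]
          push_cast
          field_simp

/-- The iterates are bounded by `c ^ k / k!`, so some power of the Volterra operator `V` is a strict
contraction. Then `1 - V ^ k` is invertible, and `1 - V` is a commuting factor of it. -/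
theorem isUnit_one_sub_volterra (hab : a ≤ b)
    (hA : ∀ i j, MemLp (fun t => A t i j) 1 (volume.restrict (Icc a b))) :
    Function.Bijective fun z => z - volterra hab hA z := by
  set c := ∫ s in a..b, ∑ i, ∑ j, |A s i j| with hc
  have hα : IntervalIntegrable (fun s => ∑ i, ∑ j, |A s i j|) volume a b := by
    rw [intervalIntegrable_iff_integrableOn_Icc_of_le hab]
    exact integrable_finsetSum _ fun i _ => integrable_finsetSum _ fun j _ =>
      (memLp_one_iff_integrable.1 (hA i j)).abs
  have hα0 : ∀ s, 0 ≤ ∑ i, ∑ j, |A s i j| := fun s =>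
    Finset.sum_nonneg fun i _ => Finset.sum_nonneg fun j _ => abs_nonneg _
  have hc0 : 0 ≤ c := intervalIntegral.integral_nonneg hab fun u _ => hα0 u
  have hbound : ∀ k z, ‖((volterra hab hA) ^ k) z‖ ≤ c ^ k / (k.factorial : ℝ) * ‖z‖ := by
    intro k z
    refine (ContinuousMap.norm_le _ (by positivity)).2 fun t => ?_
    refine (volterra_iterate_bound hab hA z k t).trans ?_
    gcongr
    · exact intervalIntegral.integral_nonneg t.2.1 fun u _ => hα0 u
    · exact intervalIntegral.integral_mono_interval le_rfl t.2.1 t.2.2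
        (Eventually.of_forall hα0) hα
  let V : C(Icc a b, ι → ℝ) →L[ℝ] C(Icc a b, ι → ℝ) :=
    (volterra hab hA).mkContinuous c fun z => by simpa using hbound 1 z
  have hVk : ∀ k z, (V ^ k) z = ((volterra hab hA) ^ k) z := fun k => by
    induction k with
    | zero => intro z; rfl
    | succ k ih => intro z; rw [pow_succ', pow_succ', mul_apply_eq_comp, ih]; rfl
  obtain ⟨k, hk⟩ : ∃ k : ℕ, c ^ k / (k.factorial : ℝ) < 1 :=
    ((FloorSemiring.tendsto_pow_div_factorial_atTop c).eventually_lt_const one_pos).exists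
  have hnorm : ‖V ^ k‖ < 1 :=
    lt_of_le_of_lt (ContinuousLinearMap.opNorm_le_bound _ (by positivity) fun z => by
      rw [hVk]; exact hbound k z) hk
  have hu : IsUnit (1 - V) := by
    have h1 : IsUnit (1 - V ^ k) := isUnit_one_sub_of_norm_lt_one
      (R := C(Icc a b, ι → ℝ) →L[ℝ] C(Icc a b, ι → ℝ)) hnorm
    rw [← mul_neg_geom_sum] at h1
    refine (Commute.isUnit_mul_iff ?_).1 h1 |>.1
    exact (Commute.one_left _).sub_left
      (Commute.sum_right _ _ _ fun i _ => (Commute.refl V).pow_right i)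
  exact ContinuousLinearMap.isUnit_iff_bijective.1 hu

/-- Existence for the linear Cauchy problem. -/
theorem exists_linearODE_solution (hab : a ≤ b)
    (hA : ∀ i j, MemLp (fun t => A t i j) 1 (volume.restrict (Icc a b))) {f : ℝ → ι → ℝ}
    (hf : MemLp f 1 (volume.restrict (Icc a b))) (c : ι → ℝ) :
    ∃ x : ℝ → ι → ℝ, AbsolutelyContinuousOnInterval x a b ∧ x a = c ∧
      ∀ᵐ t ∂volume.restrict (Icc a b), HasDerivAt x (A t *ᵥ x t + f t) t := by
  obtain ⟨z, hz⟩ := (isUnit_one_sub_volterra hab hA).2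
    (ContinuousMap.const _ c + primitiveC hab f hf)
  have hm := memLp_mulVec_continuousMap hab hA z
  obtain ⟨h1, h2⟩ := absolutelyContinuousOnInterval_primitive hab (hm.add hf) c
  -- The fixed point `z` lives only on the interval; this primitive is defined on the line and
  -- agrees with `z` there.
  set x : ℝ → ι → ℝ := fun t i => c i + ∫ s in a..t,
    ((fun s => A s *ᵥ z (projIcc a b hab s)) + f) s i with hx
  have hxz : ∀ t (ht : t ∈ Icc a b), x t = z ⟨t, ht⟩ := fun t ht => by
    funext i
    have h := congrArg (fun w : C(Icc a b, ι → ℝ) => w ⟨t, ht⟩ i) hz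
    have e : z ⟨t, ht⟩ i - ∫ s in a..t, (A s *ᵥ z (projIcc a b hab s)) i =
      c i + ∫ s in a..t, f s i := h
    simp only [hx, Pi.add_apply]
    rw [intervalIntegral.integral_add (intervalIntegrable_of_memLp hab hm i ht)
      (intervalIntegrable_of_memLp hab hf i ht)]
    linarith
  refine ⟨x, h1, by simp [hx], ?_⟩
  filter_upwards [h2, ae_restrict_mem measurableSet_Icc] with t ht hts
  rw [hxz t hts]
  simpa [projIcc_of_mem hab hts] using ht

/-- Uniqueness for the linear Cauchy problem. -/
theorem linearODE_eq_zero (hab : a ≤ b)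
    (hA : ∀ i j, MemLp (fun t => A t i j) 1 (volume.restrict (Icc a b))) {x : ℝ → ι → ℝ}
    (hx : AbsolutelyContinuousOnInterval x a b) (hxa : x a = 0)
    (hd : ∀ᵐ t ∂volume.restrict (Icc a b), HasDerivAt x (A t *ᵥ x t) t) :
    ∀ t ∈ Icc a b, x t = 0 := by
  have hc := hx.continuousOn
  rw [uIcc_of_le hab] at hc
  let z : C(Icc a b, ι → ℝ) := ⟨_, continuousOn_iff_continuous_domRestrict.1 hc⟩
  have hz : z - volterra hab hA z = 0 := by
    ext t i
    change x t i - ∫ s in a..t, (A s *ᵥ x (projIcc a b hab s)) i = 0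
    have hsub : uIcc a (t : ℝ) ⊆ uIcc a b := by
      rw [uIcc_of_le hab, uIcc_of_le t.2.1]
      exact Icc_subset_Icc_right t.2.2
    have h := ((absolutelyContinuousOnInterval_pi_iff.1 hx i).mono hsub).integral_deriv_eq_sub
    rw [hxa, Pi.zero_apply, sub_zero] at h
    rw [← h, sub_eq_zero]
    refine intervalIntegral.integral_congr_ae ?_
    rw [ae_restrict_iff' measurableSet_Icc] at hd
    filter_upwards [hd] with s hs hst
    have hsI : s ∈ Icc a b := by
      have := hsub (uIoc_subset_uIcc hst)
      rwa [uIcc_of_le hab] at this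
    rw [projIcc_of_mem hab hsI]
    exact ((hasDerivAt_pi.1 (hs hsI)) i).deriv
  have hz0 : z = 0 := (isUnit_one_sub_volterra hab hA).1 (by simpa using hz)
  intro t ht
  exact congrArg (fun w : C(Icc a b, ι → ℝ) => w ⟨t, ht⟩) hz0

end LinearODE

/-! ### Quadratic functionals -/

section Quadratic

open Filter Topology
open scoped ENNReal

variable {α : Type*} [MeasurableSpace α] {μ : Measure α}
  {ι κ : Type*} [Fintype ι] [Fintype κ] [DecidableEq ι] [DecidableEq κ]

/-- Positivity of the form on `u + v` and `u - v` dominates the cross term by the two energies.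
Square integrability of `u` and `v` would not suffice, as no pointwise upper bound on `R` is
available. -/
theorem integrable_quad_cross {R : α → Matrix κ κ ℝ} {u v : α → κ → ℝ}
    (hR : AEStronglyMeasurable R μ) (hp : ∀ᵐ t ∂μ, (R t).PosSemidef)
    (hu : AEStronglyMeasurable u μ) (hv : AEStronglyMeasurable v μ)
    (hu2 : Integrable (fun t => (R t *ᵥ u t) ⬝ᵥ u t) μ)
    (hv2 : Integrable (fun t => (R t *ᵥ v t) ⬝ᵥ v t) μ) :
    Integrable (fun t => (R t *ᵥ u t) ⬝ᵥ v t) μ := by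
  refine (hu2.add hv2).mono' (by fun_prop) ?_
  filter_upwards [hp] with t ht
  have h1 := ht.quad_nonneg (u t + v t)
  have h2 := ht.quad_nonneg (u t - v t)
  simp only [mulVec_add, mulVec_sub, add_dotProduct, dotProduct_add, sub_dotProduct,
    dotProduct_sub] at h1 h2
  rw [ht.symm_quad (v t) (u t)] at h1 h2
  rw [Real.norm_eq_abs, abs_le, Pi.add_apply]
  have h3 := ht.quad_nonneg (u t)
  have h4 := ht.quad_nonneg (v t)
  constructor <;> linarith

theorem memLp_two_of_integrable_quad {r : ℝ} {R : α → Matrix κ κ ℝ} {u : α → κ → ℝ}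
    (hr : ∀ᵐ t ∂μ, Coercive r (R t)) (hu : AEStronglyMeasurable u μ)
    (hi : Integrable (fun t => (R t *ᵥ u t) ⬝ᵥ u t) μ) : MemLp u 2 μ := by
  refine memLp_two_of_integrable_dotProduct_self hu ?_
  refine (hi.const_mul r⁻¹).mono' (by fun_prop) ?_
  filter_upwards [hr] with t ht
  have h0 := ht.1
  rw [Real.norm_eq_abs, abs_of_nonneg (dot_self_nonneg _), inv_mul_eq_div, le_div_iff₀ h0]
  linarith [ht.le_quad (u t)]

theorem memLp_inv_mulVec {r : ℝ} {R : α → Matrix κ κ ℝ} {u : α → κ → ℝ}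
    (hR : AEStronglyMeasurable R μ) (hr : ∀ᵐ t ∂μ, Coercive r (R t)) (hu : MemLp u 2 μ) :
    MemLp (fun t => (R t)⁻¹ *ᵥ u t) 2 μ := by
  have h1 := AEStronglyMeasurable.matrix_inv hR
  have h2 := hu.1
  refine memLp_two_entries_of_dotProduct hu (by fun_prop) (C := r⁻¹ ^ 2) ?_
  filter_upwards [hr] with t ht using ht.inv_quad_le (u t)

theorem memLp_wGram {r : ℝ} {R : α → Matrix κ κ ℝ} {H : α → Matrix κ ι ℝ}
    (hR : AEStronglyMeasurable R μ) (hr : ∀ᵐ t ∂μ, Coercive r (R t))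
    (hH : ∀ i j, MemLp (fun t => H t i j) 2 μ) (i j : ι) :
    MemLp (fun t => wGram (R t) (H t) i j) 1 μ := by
  have hcol : ∀ j, MemLp (fun t => (H t).col j) 2 μ := fun j => MemLp.of_eval fun i => hH i j
  have e : (fun t => wGram (R t) (H t) i j) =
      fun t => (H t).col i ⬝ᵥ ((R t)⁻¹ *ᵥ (H t).col j) := by
    funext t
    simp only [wGram, Matrix.mul_assoc]
    rfl
  rw [e, memLp_one_iff_integrable]
  exact MemLp.integrable_dotProduct (hcol i) (memLp_inv_mulVec hR hr (hcol j))

/-- Among the pairs `(ξ, v)` with prescribed `A ξ` and `H^* v` there is exactly one of minimal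
energy; it lies in `Im A^*` and `R⁻¹ Im H`. -/
theorem exists_minimal_pair {ι' κ' : Type*} [Fintype ι'] [Fintype κ'] [DecidableEq ι']
    [DecidableEq κ'] {r : ℝ} {R : α → Matrix κ κ ℝ} {H : α → Matrix κ ι ℝ}
    (A : Matrix ι' κ' ℝ)
    (hR : AEStronglyMeasurable R μ) (hr : ∀ᵐ t ∂μ, Coercive r (R t))
    (hH : AEStronglyMeasurable H μ) (ξ₀ : κ' → ℝ) {v₀ : α → κ → ℝ} (hv₀ : MemLp v₀ 2 μ)
    (hi₀ : Integrable (fun t => (R t *ᵥ v₀ t) ⬝ᵥ v₀ t) μ) :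
    ∃ ξ₁ v₁, MemLp v₁ 2 μ ∧ Integrable (fun t => (R t *ᵥ v₁ t) ⬝ᵥ v₁ t) μ ∧
      A *ᵥ ξ₁ = A *ᵥ ξ₀ ∧ (∀ᵐ t ∂μ, (H t)ᵀ *ᵥ v₁ t = (H t)ᵀ *ᵥ v₀ t) ∧
      (∃ w, ξ₁ = Aᵀ *ᵥ w) ∧ (∀ᵐ t ∂μ, ∃ w, v₁ t = (R t)⁻¹ *ᵥ (H t *ᵥ w)) ∧
      ∀ ξ v, Integrable (fun t => (R t *ᵥ v t) ⬝ᵥ v t) μ → A *ᵥ ξ = A *ᵥ ξ₀ →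
        (∀ᵐ t ∂μ, (H t)ᵀ *ᵥ v t = (H t)ᵀ *ᵥ v₀ t) →
        ξ₁ ⬝ᵥ ξ₁ + ∫ t, (R t *ᵥ v₁ t) ⬝ᵥ v₁ t ∂μ ≤ ξ ⬝ᵥ ξ + ∫ t, (R t *ᵥ v t) ⬝ᵥ v t ∂μ ∧
        (ξ ⬝ᵥ ξ + ∫ t, (R t *ᵥ v t) ⬝ᵥ v t ∂μ ≤ ξ₁ ⬝ᵥ ξ₁ + ∫ t, (R t *ᵥ v₁ t) ⬝ᵥ v₁ t ∂μ →
          ξ = ξ₁ ∧ v =ᵐ[μ] v₁) := by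
  -- The vector component is minimized by the same splitting, with identity weight and `Aᵀ` in the
  -- role of `H`.
  set ξ₁ := splitIm (1 : Matrix κ' κ' ℝ) Aᵀ ξ₀ with hξ₁
  set v₁ := fun t => splitIm (R t) (H t) (v₀ t) with hv₁
  have hv₁m : AEStronglyMeasurable v₁ μ := AEStronglyMeasurable.splitIm hR hH hv₀.1 hr
  have h1 : (1 : Matrix κ' κ' ℝ).PosDef := Matrix.PosDef.one
  obtain ⟨⟨w, hw⟩, hk, -⟩ := isSplit_splitIm (H := Aᵀ) h1 ξ₀
  have hv₁i : Integrable (fun t => (R t *ᵥ v₁ t) ⬝ᵥ v₁ t) μ := by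
    refine hi₀.mono' (by fun_prop) ?_
    filter_upwards [hr] with t ht
    rw [Real.norm_eq_abs, abs_of_nonneg (ht.posDef.posSemidef.quad_nonneg _)]
    exact quad_splitIm_le ht.posDef _
  have hAξ : A *ᵥ ξ₁ = A *ᵥ ξ₀ := by
    rw [transpose_transpose, mulVec_sub, sub_eq_zero] at hk
    exact hk.symm
  have hHv : ∀ᵐ t ∂μ, (H t)ᵀ *ᵥ v₁ t = (H t)ᵀ *ᵥ v₀ t := by
    filter_upwards [hr] with t ht
    have := (isSplit_splitIm (H := H t) ht.posDef (v₀ t)).2.1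
    rw [mulVec_sub, sub_eq_zero] at this
    exact this.symm
  have hv₁im : ∀ᵐ t ∂μ, ∃ w, v₁ t = (R t)⁻¹ *ᵥ (H t *ᵥ w) := by
    filter_upwards [hr] with t ht using (isSplit_splitIm (H := H t) ht.posDef (v₀ t)).1
  refine ⟨ξ₁, v₁, memLp_two_of_integrable_quad hr hv₁m hv₁i, hv₁i, hAξ, hHv,
    ⟨w, hw.trans (by simp)⟩, hv₁im, fun ξ v hvi hξ hv => ?_⟩
  have eξ : ξ ⬝ᵥ ξ = ξ₁ ⬝ᵥ ξ₁ + (ξ - ξ₁) ⬝ᵥ (ξ - ξ₁) := by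
    have ho : ((1 : Matrix κ' κ' ℝ) *ᵥ ξ₁) ⬝ᵥ (ξ - ξ₁) = 0 :=
      dotProduct_eq_zero_of_im_ker h1 (H := Aᵀ) ⟨w, hw⟩
        (by rw [transpose_transpose, mulVec_sub, hξ, hAξ, sub_self])
    have := quad_add_of_orthogonal h1.posSemidef ho
    simpa using this
  have ev : ∀ᵐ t ∂μ, (R t *ᵥ (v t - v₁ t)) ⬝ᵥ (v t - v₁ t) =
      (R t *ᵥ v t) ⬝ᵥ v t - (R t *ᵥ v₁ t) ⬝ᵥ v₁ t := by
    filter_upwards [hr, hv, hHv, hv₁im] with t ht h2 h3 h4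
    have := quad_add_of_orthogonal ht.posDef.posSemidef (dotProduct_eq_zero_of_im_ker ht.posDef h4
      (show (H t)ᵀ *ᵥ (v t - v₁ t) = 0 by rw [mulVec_sub, h2, h3, sub_self]))
    rw [add_sub_cancel] at this
    linarith
  have hdi : Integrable (fun t => (R t *ᵥ (v t - v₁ t)) ⬝ᵥ (v t - v₁ t)) μ :=
    (hvi.sub hv₁i).congr (ev.mono fun t ht => ht.symm)
  have ei : ∫ t, (R t *ᵥ (v t - v₁ t)) ⬝ᵥ (v t - v₁ t) ∂μ =
      ∫ t, (R t *ᵥ v t) ⬝ᵥ v t ∂μ - ∫ t, (R t *ᵥ v₁ t) ⬝ᵥ v₁ t ∂μ := by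
    rw [integral_congr_ae ev, integral_sub hvi hv₁i]
  have hnn : ∀ᵐ t ∂μ, 0 ≤ (R t *ᵥ (v t - v₁ t)) ⬝ᵥ (v t - v₁ t) := by
    filter_upwards [hr] with t ht using ht.posDef.posSemidef.quad_nonneg _
  have h0 := integral_nonneg_of_ae hnn
  have h0' := dot_self_nonneg (ξ - ξ₁)
  refine ⟨by linarith, fun hle => ?_⟩
  have z1 : (ξ - ξ₁) ⬝ᵥ (ξ - ξ₁) = 0 := by linarith
  have z2 : ∫ t, (R t *ᵥ (v t - v₁ t)) ⬝ᵥ (v t - v₁ t) ∂μ = 0 := by linarith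
  refine ⟨sub_eq_zero.1 (dotProduct_self_eq_zero.1 z1), ?_⟩
  filter_upwards [hr, (integral_eq_zero_iff_of_nonneg_ae hnn hdi).1 z2] with t ht hz
  exact sub_eq_zero.1 (eq_zero_of_quad_eq_zero ht.posDef hz)

end Quadratic

/-! ### Quadratic integral functionals that are bounded below -/

section BoundedBelow

open Filter Topology
open scoped ENNReal

variable {ι κ : Type*} [Fintype ι] [Fintype κ] [DecidableEq ι] [DecidableEq κ] {a b : ℝ}

/-- A lower bound for a quadratic functional on absolutely continuous functions with given boundary
values holds for all bounded measurable functions. -/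
theorem le_integral_quad_of_bounded (hab : a < b) {M : ℝ → Matrix ι ι ℝ} {g : ℝ → ι → ℝ}
    (hM : ∀ i j, MemLp (fun t => M t i j) 1 (volume.restrict (Icc a b)))
    (hg : MemLp g 1 (volume.restrict (Icc a b))) {p q : ι → ℝ} {C : ℝ}
    (hC : ∀ x, AbsolutelyContinuousOnInterval x a b → x a = p → x b = q →
      C ≤ ∫ t, (M t *ᵥ x t) ⬝ᵥ x t - 2 * (g t ⬝ᵥ x t) ∂volume.restrict (Icc a b))
    {h : ℝ → ι → ℝ} (hm : AEStronglyMeasurable h (volume.restrict (Icc a b))) {B : ℝ}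
    (hB : ∀ t i, |h t i| ≤ B) :
    C ≤ ∫ t, (M t *ᵥ h t) ⬝ᵥ h t - 2 * (g t ⬝ᵥ h t) ∂volume.restrict (Icc a b) := by
  obtain ⟨x, B', hx, hlim⟩ := exists_seq_absolutelyContinuous_tendsto hab hm hB p q
  have hMm : AEStronglyMeasurable M (volume.restrict (Icc a b)) :=
    aestronglyMeasurable_of_entries fun i j => (hM i j).1
  have hgm := hg.1
  -- The approximants share the bound `B'`, so the integrability of `M` and `g` supplies a majorant.
  -- It uses `|B'|` because the sign of `B'` is not recorded.
  refine ge_of_tendsto' (tendsto_integral_of_dominated_convergence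
    (F := fun k t => (M t *ᵥ x k t) ⬝ᵥ x k t - 2 * (g t ⬝ᵥ x k t))
    (fun t => (∑ i, (∑ j, |M t i j| * |B'|) * |B'|) + 2 * ∑ i, |g t i| * |B'|)
    (fun k => ?_) ?_ (fun k => ?_) ?_) fun k => hC _ (hx k).1 (hx k).2.1 (hx k).2.2.1
  · have := ((hx k).1.memLp_top hab.le).1
    fun_prop
  · refine Integrable.add (integrable_finsetSum _ fun i _ => Integrable.mul_const
      (integrable_finsetSum _ fun j _ => Integrable.mul_const ?_ _) _)
      (Integrable.const_mul (integrable_finsetSum _ fun i _ => Integrable.mul_const ?_ _) _)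
    · exact (memLp_one_iff_integrable.1 (hM i j)).abs
    · exact (memLp_one_iff_integrable.1 (hg.eval i)).abs
  · filter_upwards [ae_restrict_mem measurableSet_Icc] with t ht
    have hb : ∀ i, |x k t i| ≤ |B'| := fun i => ((hx k).2.2.2 t ht i).trans (le_abs_self _)
    refine (norm_sub_le _ _).trans (add_le_add ?_ ?_)
    · refine (Finset.abs_sum_le_sum_abs _ _).trans (Finset.sum_le_sum fun i _ => ?_)
      rw [abs_mul]
      refine mul_le_mul ?_ (hb i) (abs_nonneg _) (by positivity)
      refine (Finset.abs_sum_le_sum_abs _ _).trans (Finset.sum_le_sum fun j _ => ?_)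
      rw [abs_mul]
      exact mul_le_mul_of_nonneg_left (hb j) (abs_nonneg _)
    · rw [norm_mul, Real.norm_ofNat]
      refine mul_le_mul_of_nonneg_left ?_ zero_le_two
      refine (Finset.abs_sum_le_sum_abs _ _).trans (Finset.sum_le_sum fun i _ => ?_)
      rw [abs_mul]
      exact mul_le_mul_of_nonneg_left (hb i) (abs_nonneg _)
  · filter_upwards [hlim] with t ht
    have hc : Continuous fun y : ι → ℝ => (M t *ᵥ y) ⬝ᵥ y - 2 * (g t ⬝ᵥ y) := by fun_prop
    exact (hc.tendsto _).comp ht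

/-- Endpoint values cost nothing: the zero function can be approximated with any prescribed ones, so
the integral cannot stay at or above one. -/
theorem exists_absolutelyContinuous_integral_quad_lt (hab : a < b) {M : ℝ → Matrix ι ι ℝ}
    {g : ℝ → ι → ℝ} (hM : ∀ i j, MemLp (fun t => M t i j) 1 (volume.restrict (Icc a b)))
    (hg : MemLp g 1 (volume.restrict (Icc a b))) (p q : ι → ℝ) :
    ∃ x, AbsolutelyContinuousOnInterval x a b ∧ x a = p ∧ x b = q ∧
      ∫ t, (M t *ᵥ x t) ⬝ᵥ x t - 2 * (g t ⬝ᵥ x t) ∂volume.restrict (Icc a b) < 1 := by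
  by_contra! hcon
  have := le_integral_quad_of_bounded hab hM hg hcon (h := 0) aestronglyMeasurable_zero (B := 0)
    (by simp)
  simp at this
  linarith

/-- The regularized solution, clipped to be bounded. -/
noncomputable def clipSol (M : Matrix ι ι ℝ) (g : ι → ℝ) (k : ℕ) : ι → ℝ :=
  (((k : ℝ) + 1) ^ 2 / max (((k : ℝ) + 1) ^ 2) ‖regSol M g (regPar k)‖) • regSol M g (regPar k)

theorem abs_clipSol_le (M : Matrix ι ι ℝ) (g : ι → ℝ) (k : ℕ) (i : ι) :
    |clipSol M g k i| ≤ ((k : ℝ) + 1) ^ 2 := by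
  have hN : (0 : ℝ) < ((k : ℝ) + 1) ^ 2 := by positivity
  refine (norm_le_pi_norm (clipSol M g k) i).trans ?_
  rw [clipSol, norm_smul, Real.norm_of_nonneg (by positivity), div_mul_eq_mul_div,
    div_le_iff₀ (lt_max_of_lt_left hN)]
  exact mul_le_mul_of_nonneg_left (le_max_right _ _) hN.le

/-- For the regularized solution, `⟨M x, x⟩ ≤ ⟨g, x⟩`. Scaling by `θ ∈ [0, 1]` preserves this, since
the left side acquires `θ²` and the right side only `θ`. -/
theorem quad_clipSol_le {M : Matrix ι ι ℝ} (hM : M.PosSemidef) (g : ι → ℝ) (k : ℕ) :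
    0 ≤ g ⬝ᵥ clipSol M g k ∧
    (M *ᵥ clipSol M g k) ⬝ᵥ clipSol M g k - 2 * (g ⬝ᵥ clipSol M g k) ≤ -(g ⬝ᵥ clipSol M g k) := by
  have hN : (0 : ℝ) < ((k : ℝ) + 1) ^ 2 := by positivity
  set x := regSol M g (regPar k) with hx
  set θ := ((k : ℝ) + 1) ^ 2 / max (((k : ℝ) + 1) ^ 2) ‖x‖ with hθ
  have e : clipSol M g k = θ • x := rfl
  have h0 : 0 ≤ θ := by positivity
  have h1 : θ ≤ 1 := (div_le_one (lt_max_of_lt_left hN)).2 (le_max_left _ _)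
  have h2 : (M *ᵥ x) ⬝ᵥ x ≤ g ⬝ᵥ x := by
    rw [hx, dotProduct_regSol hM (regPar_pos k)]
    have := mul_nonneg (regPar_pos k).le (dot_self_nonneg (regSol M g (regPar k)))
    linarith
  have h3 : 0 ≤ g ⬝ᵥ x := dotProduct_regSol_nonneg hM (regPar_pos k)
  rw [e]
  simp only [mulVec_smul, smul_dotProduct, dotProduct_smul, smul_eq_mul]
  refine ⟨mul_nonneg h0 h3, ?_⟩
  have h4 : θ * (θ * (M *ᵥ x) ⬝ᵥ x) ≤ θ * (1 * (g ⬝ᵥ x)) :=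
    mul_le_mul_of_nonneg_left (mul_le_mul h1 h2 (hM.quad_nonneg x) zero_le_one) h0
  linarith

/-- The regularized solution grows at most like `(k + 1) |g|`, so the level `(k + 1) ^ 2` overtakes
it at each point. -/
theorem eventually_clipSol_eq {M : Matrix ι ι ℝ} (hM : M.PosSemidef) (g : ι → ℝ) :
    ∀ᶠ k in atTop, clipSol M g k = regSol M g (regPar k) := by
  have ht : Tendsto (fun k : ℕ => ((k : ℝ) + 1) ^ 2) atTop atTop :=
    (tendsto_pow_atTop two_ne_zero).comp
      ((tendsto_natCast_atTop_atTop (R := ℝ)).atTop_add tendsto_const_nhds)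
  filter_upwards [ht.eventually_ge_atTop (g ⬝ᵥ g)] with k hk
  have hN : (0 : ℝ) < ((k : ℝ) + 1) ^ 2 := by positivity
  have hle : ‖regSol M g (regPar k)‖ ≤ ((k : ℝ) + 1) ^ 2 := by
    refine (pi_norm_le_iff_of_nonneg hN.le).2 fun i => ?_
    have h1 := mul_dotProduct_regSol_self_le (g := g) hM (regPar_pos k)
    have h2 : regSol M g (regPar k) i * regSol M g (regPar k) i ≤
        regSol M g (regPar k) ⬝ᵥ regSol M g (regPar k) :=
      Finset.single_le_sum (f := fun i => regSol M g (regPar k) i * regSol M g (regPar k) i)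
        (fun i _ => mul_self_nonneg _) (Finset.mem_univ i)
    refine abs_le_of_sq_le_sq ?_ hN.le
    have h3 : regPar k ^ 2 * ((k : ℝ) + 1) ^ 2 = 1 := by
      unfold regPar; field_simp
    have h4 : regSol M g (regPar k) ⬝ᵥ regSol M g (regPar k) ≤ ((k : ℝ) + 1) ^ 2 * (g ⬝ᵥ g) := by
      calc _ = ((k : ℝ) + 1) ^ 2 * (regPar k ^ 2 *
            (regSol M g (regPar k) ⬝ᵥ regSol M g (regPar k))) := by
              rw [← mul_assoc, mul_comm _ (regPar k ^ 2), h3, one_mul]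
        _ ≤ _ := mul_le_mul_of_nonneg_left h1 hN.le
    nlinarith
  rw [clipSol, max_eq_left hle, div_self hN.ne', one_smul]

/-- If the functional `∫ ⟨H^* R⁻¹ H x, x⟩ - 2 ⟨g, x⟩` is bounded below on absolutely continuous
functions with fixed boundary values, then `g = H^* v` for some `v` with values in `R⁻¹ Im H` and
with energy at most the bound. -/
theorem exists_energy_le_of_bounded_below (hab : a < b) {r : ℝ} {R : ℝ → Matrix κ κ ℝ}
    {H : ℝ → Matrix κ ι ℝ} {g : ℝ → ι → ℝ}
    (hR : AEStronglyMeasurable R (volume.restrict (Icc a b)))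
    (hr : ∀ᵐ t ∂volume.restrict (Icc a b), Coercive r (R t))
    (hH : ∀ i j, MemLp (fun t => H t i j) 2 (volume.restrict (Icc a b)))
    (hg : MemLp g 1 (volume.restrict (Icc a b))) {p q : ι → ℝ} {C : ℝ}
    (hC : ∀ x, AbsolutelyContinuousOnInterval x a b → x a = p → x b = q →
      -C ≤ ∫ t, (wGram (R t) (H t) *ᵥ x t) ⬝ᵥ x t - 2 * (g t ⬝ᵥ x t)
        ∂volume.restrict (Icc a b)) :
    ∃ v : ℝ → κ → ℝ, MemLp v 2 (volume.restrict (Icc a b)) ∧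
      Integrable (fun t => (R t *ᵥ v t) ⬝ᵥ v t) (volume.restrict (Icc a b)) ∧
      (∀ᵐ t ∂volume.restrict (Icc a b), (H t)ᵀ *ᵥ v t = g t ∧
        ∃ w, v t = (R t)⁻¹ *ᵥ (H t *ᵥ w)) ∧
      ∫ t, (R t *ᵥ v t) ⬝ᵥ v t ∂volume.restrict (Icc a b) ≤ C := by
  set μ : Measure ℝ := volume.restrict (Icc a b) with hμ
  have hHm : AEStronglyMeasurable H μ := aestronglyMeasurable_of_entries fun i j => (hH i j).1
  set M : ℝ → Matrix ι ι ℝ := fun t => wGram (R t) (H t) with hMdef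
  have hMm : AEStronglyMeasurable M μ := AEStronglyMeasurable.wGram hR hHm
  have hM1 : ∀ i j, MemLp (fun t => M t i j) 1 μ := memLp_wGram hR hr hH
  have hMp : ∀ᵐ t ∂μ, (M t).PosSemidef := by
    filter_upwards [hr] with t ht using gram_posSemidef ht.posDef
  have hgm := hg.1
  set h : ℕ → ℝ → ι → ℝ := fun k t => clipSol (M t) (g t) k with hh
  have hhm : ∀ k, AEStronglyMeasurable (h k) μ := fun k => by
    have h1 := AEStronglyMeasurable.regSol hMm hgm (regPar k)
    have h2 : AEMeasurable (fun t => ((k : ℝ) + 1) ^ 2 /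
        max (((k : ℝ) + 1) ^ 2) ‖regSol (M t) (g t) (regPar k)‖) μ :=
      aemeasurable_const.div (aemeasurable_const.max h1.norm.aemeasurable)
    exact h2.aestronglyMeasurable.smul h1
  have hhb : ∀ k t i, |h k t i| ≤ ((k : ℝ) + 1) ^ 2 := fun k t i => abs_clipSol_le _ _ _ _
  have hhL : ∀ k, MemLp (h k) ∞ μ := fun k =>
    memLp_top_of_bound (hhm k) (((k : ℝ) + 1) ^ 2) (Eventually.of_forall fun t =>
      (pi_norm_le_iff_of_nonneg (by positivity)).2 fun i => hhb k t i)
  have hghi : ∀ k, Integrable (fun t => g t ⬝ᵥ h k t) μ := fun k =>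
    MemLp.integrable_dotProduct hg (hhL k)
  have hgh0 : ∀ k, ∀ᵐ t ∂μ, 0 ≤ g t ⬝ᵥ h k t := fun k => by
    filter_upwards [hMp] with t ht using (quad_clipSol_le ht (g t) k).1
  -- On these test functions the functional is at most `-∫ ⟨g, h k⟩`, so its lower bound `-C`
  -- becomes an upper bound.
  have hbound : ∀ k, ∫ t, g t ⬝ᵥ h k t ∂μ ≤ C := fun k => by
    have h1 := le_integral_quad_of_bounded hab hM1 hg hC (hhm k) (hhb k)
    have h2 : ∫ t, (M t *ᵥ h k t) ⬝ᵥ h k t - 2 * (g t ⬝ᵥ h k t) ∂μ ≤ ∫ t, -(g t ⬝ᵥ h k t) ∂μ := by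
      refine integral_mono_ae ?_ (hghi k).neg ?_
      · exact (MemLp.integrable_dotProduct (p := 1) (q := ∞)
          (MemLp.mulVec (p := 1) (q := ∞) hM1 (hhL k)) (hhL k)).sub ((hghi k).const_mul 2)
      · filter_upwards [hMp] with t ht using (quad_clipSol_le ht (g t) k).2
    rw [integral_neg] at h2
    linarith
  have hC0 : 0 ≤ C := (integral_nonneg_of_ae (hgh0 0)).trans (hbound 0)
  have hfatou : ∫⁻ t, liminf (fun k => ENNReal.ofReal (g t ⬝ᵥ h k t)) atTop ∂μ ≤
      ENNReal.ofReal C := by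
    refine (lintegral_liminf_le' fun k => (hghi k).1.aemeasurable.ennreal_ofReal).trans ?_
    refine liminf_le_of_frequently_le' (Frequently.of_forall fun k => ?_)
    rw [← ofReal_integral_eq_lintegral_ofReal (hghi k) (hgh0 k)]
    exact ENNReal.ofReal_le_ofReal (hbound k)
  have hfin : ∀ᵐ t ∂μ, liminf (fun k => ENNReal.ofReal (g t ⬝ᵥ h k t)) atTop < ⊤ :=
    ae_lt_top' (by
      simp_rw [liminf_eq_iSup_iInf_of_nat]
      exact AEMeasurable.iSup fun n => AEMeasurable.biInf _ (to_countable _) fun k _ =>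
        (hghi k).1.aemeasurable.ennreal_ofReal)
      (hfatou.trans_lt ENNReal.ofReal_lt_top).ne
  -- Outside the range of `M t` the products `⟨g, h k⟩` tend to infinity, contradicting the finite
  -- `liminf`.
  have hrange : ∀ᵐ t ∂μ, ∃ w, M t *ᵥ w = g t := by
    filter_upwards [hfin, hMp] with t ht hp
    by_contra hn
    have h1 : Tendsto (fun k => g t ⬝ᵥ h k t) atTop atTop :=
      (tendsto_dotProduct_regSol_atTop hp hn).congr' (by
        filter_upwards [eventually_clipSol_eq hp (g t)] with k hk
        simp only [hh, hk])
    exact ht.ne (ENNReal.tendsto_ofReal_atTop.comp h1).liminf_eq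
  have hvlim : ∀ᵐ t ∂μ, ∀ w, M t *ᵥ w = g t →
      Tendsto (fun k => (R t)⁻¹ *ᵥ (H t *ᵥ regSol (M t) (g t) (regPar k))) atTop
        (𝓝 ((R t)⁻¹ *ᵥ (H t *ᵥ w))) := by
    filter_upwards [hr] with t ht w hw
    rw [← hw]
    exact tendsto_regSol_gram ht w
  -- The solutions `w` are chosen pointwise without measurability; `v` is obtained measurably as the
  -- limit of the regularizations.
  obtain ⟨v, hvm, hv⟩ := exists_stronglyMeasurable_limit_of_tendsto_ae (μ := μ)
    (f := fun k t => (R t)⁻¹ *ᵥ (H t *ᵥ regSol (M t) (g t) (regPar k))) (fun k => by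
      have h1 := AEStronglyMeasurable.regSol hMm hgm (regPar k)
      have h2 := AEStronglyMeasurable.matrix_inv hR
      fun_prop) (by
      filter_upwards [hrange, hvlim] with t ⟨w, hw⟩ ht using ⟨_, ht w hw⟩)
  have hvw : ∀ᵐ t ∂μ, ∃ w, M t *ᵥ w = g t ∧ v t = (R t)⁻¹ *ᵥ (H t *ᵥ w) := by
    filter_upwards [hrange, hvlim, hv] with t ⟨w, hw⟩ ht hvt
    exact ⟨w, hw, tendsto_nhds_unique hvt (ht w hw)⟩
  have hlim : ∀ᵐ t ∂μ, liminf (fun k => ENNReal.ofReal (g t ⬝ᵥ h k t)) atTop =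
      ENNReal.ofReal ((R t *ᵥ v t) ⬝ᵥ v t) := by
    filter_upwards [hvw, hr, hMp] with t ⟨w, hw, hvt⟩ ht hp
    refine Tendsto.liminf_eq ((ENNReal.continuous_ofReal.tendsto _).comp ?_)
    rw [hvt, ← gram_quad ht.posDef, ← hw]
    refine (tendsto_dotProduct_regSol hp w).congr' ?_
    filter_upwards [eventually_clipSol_eq hp (M t *ᵥ w)] with k hk
    simp only [hh, ← hw, hk]
  rw [lintegral_congr_ae hlim] at hfatou
  have hnn : ∀ᵐ t ∂μ, 0 ≤ (R t *ᵥ v t) ⬝ᵥ v t := by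
    filter_upwards [hr] with t ht using ht.posDef.posSemidef.quad_nonneg _
  have hvm' : AEStronglyMeasurable v μ := hvm.aestronglyMeasurable
  have hqm : AEStronglyMeasurable (fun t => (R t *ᵥ v t) ⬝ᵥ v t) μ := by fun_prop
  have hvi : Integrable (fun t => (R t *ᵥ v t) ⬝ᵥ v t) μ := by
    refine ⟨hqm, ?_⟩
    rw [hasFiniteIntegral_iff_ofReal hnn]
    exact hfatou.trans_lt ENNReal.ofReal_lt_top
  refine ⟨v, memLp_two_of_integrable_quad hr hvm' hvi, hvi, ?_, ?_⟩
  · filter_upwards [hvw] with t ⟨w, hw, hvt⟩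
    refine ⟨?_, w, hvt⟩
    rw [hvt, ← gram_mulVec]
    exact hw
  · rw [integral_eq_lintegral_of_nonneg_ae hnn hqm]
    exact ENNReal.toReal_le_of_le_ofReal hC0 hfatou

/-- The fundamental lemma of the calculus of variations. -/
theorem ae_eq_zero_of_forall_integral_dotProduct_eq_zero (hab : a < b) {g : ℝ → ι → ℝ}
    (hg : MemLp g 1 (volume.restrict (Icc a b)))
    (h : ∀ x, AbsolutelyContinuousOnInterval x a b →
      ∫ t, g t ⬝ᵥ x t ∂volume.restrict (Icc a b) = 0) :
    ∀ᵐ t ∂volume.restrict (Icc a b), g t = 0 := by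
  -- With `H = 0` the functional is `-2 ∫ ⟨g, x⟩ = 0`, hence bounded below, and the conclusion `g =
  -- H^* v` says that `g` vanishes.
  obtain ⟨v, -, -, hv, -⟩ := exists_energy_le_of_bounded_below hab (r := 1)
    (R := fun _ => (1 : Matrix ι ι ℝ)) (H := fun _ => (0 : Matrix ι ι ℝ)) (p := 0) (q := 0)
    (C := 0) aestronglyMeasurable_const (Eventually.of_forall fun _ => coercive_one)
    (fun i j => by simp) hg (fun x hx _ _ => by
      simp [wGram, integral_neg, integral_const_mul, h x hx])
  filter_upwards [hv] with t ht
  simpa using ht.1.symm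

end BoundedBelow

namespace SmoothingData

open scoped ENNReal

variable {n d m : ℕ} {D : SmoothingData n d m}

/-! ### Consequences of the standing assumptions -/

/-- The input matrix `G Q^{1/2}`. -/
noncomputable def inp (D : SmoothingData n d m) (t : ℝ) : Matrix (Fin n) (Fin d) ℝ :=
  D.G t * psdSqrt (D.Q t)

theorem Standing.exists_coercive (hD : D.Standing) :
    ∃ r : ℝ, 0 < r ∧ ∀ᵐ t ∂D.μ, Coercive r (D.R t) := by
  obtain ⟨r, hr, h⟩ := hD.R_coercive
  exact ⟨r, hr, h.mono fun t ht => ⟨hr, ht⟩⟩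

theorem Standing.R_posDef (hD : D.Standing) : ∀ᵐ t ∂D.μ, (D.R t).PosDef := by
  obtain ⟨r, -, h⟩ := hD.exists_coercive
  exact h.mono fun t ht => ht.posDef

theorem Standing.R_aesm (hD : D.Standing) : AEStronglyMeasurable D.R D.μ :=
  aestronglyMeasurable_of_entries fun i j => (hD.R_L2 i j).1

theorem Standing.H_aesm (hD : D.Standing) : AEStronglyMeasurable D.H D.μ :=
  aestronglyMeasurable_of_entries fun i j => (hD.H_L2 i j).1

theorem Standing.inp_aesm (hD : D.Standing) : AEStronglyMeasurable D.inp D.μ := by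
  have h1 : AEStronglyMeasurable D.G D.μ :=
    aestronglyMeasurable_of_entries fun i j => (hD.G_L2 i j).1
  have h2 : AEStronglyMeasurable D.Q D.μ :=
    aestronglyMeasurable_of_entries fun i j => (hD.Q_L1 i j).1
  have h3 := aestronglyMeasurable_psdSqrt h2 hD.Q_psd
  unfold inp
  fun_prop

theorem Standing.inp_mul_transpose (hD : D.Standing) :
    ∀ᵐ t ∂D.μ, D.inp t * (D.inp t)ᵀ = D.G t * D.Q t * (D.G t)ᵀ := by
  filter_upwards [hD.Q_psd] with t ht
  obtain ⟨h1, h2⟩ := psdSqrt_spec ht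
  rw [inp, transpose_mul, h1.transpose_eq, Matrix.mul_assoc, ← Matrix.mul_assoc (psdSqrt _), h2,
    Matrix.mul_assoc]

/-- The squared length of row `i` of `G Q^{1/2}` is the `i`-th diagonal entry of `G Q G^*`; this is
where the integrability of `G Q G^*` enters. -/
theorem Standing.inp_L2 (hD : D.Standing) (i : Fin n) (j : Fin d) :
    MemLp (fun t => D.inp t i j) 2 D.μ := by
  have hm := hD.inp_aesm
  have hrow : MemLp (fun t => (D.inp t).row i) 2 D.μ := by
    refine memLp_two_of_integrable_dotProduct_self ?_ ?_
    · exact ((continuous_apply i).comp continuous_id).comp_aestronglyMeasurable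
        (g := fun A : Fin n → Fin d → ℝ => A i) hm
    · refine (memLp_one_iff_integrable.1 (hD.GQG_L1 i i)).congr ?_
      filter_upwards [hD.inp_mul_transpose] with t ht
      rw [← ht]
      rfl
  exact hrow.eval j

theorem Standing.inp_transpose_L2 (hD : D.Standing) {l : ℝ → Fin n → ℝ} (hl : MemLp l ∞ D.μ) :
    MemLp (fun t => (D.inp t)ᵀ *ᵥ l t) 2 D.μ :=
  MemLp.mulVec (p := 2) (q := ∞) (fun i j => hD.inp_L2 j i) hl

theorem Standing.obs_L2 (hD : D.Standing) : MemLp (fun t => (D.R t)⁻¹ *ᵥ D.y t) 2 D.μ := by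
  obtain ⟨r, -, hr⟩ := hD.exists_coercive
  exact memLp_inv_mulVec hD.R_aesm hr hD.y_L2

theorem Standing.integrable_obs (hD : D.Standing) :
    Integrable (fun t => ((D.R t)⁻¹ *ᵥ D.y t) ⬝ᵥ D.y t) D.μ :=
  MemLp.integrable_dotProduct hD.obs_L2 hD.y_L2

theorem Standing.integrable_quad_obs (hD : D.Standing) :
    Integrable (fun t => (D.R t *ᵥ ((D.R t)⁻¹ *ᵥ D.y t)) ⬝ᵥ ((D.R t)⁻¹ *ᵥ D.y t)) D.μ := by
  refine hD.integrable_obs.congr ?_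
  filter_upwards [hD.R_posDef] with t ht
  rw [ht.mulVec_inv_mulVec, dotProduct_comm]

theorem Standing.wGram_L1 (hD : D.Standing) (i j : Fin n) :
    MemLp (fun t => wGram (D.R t) (D.H t) i j) 1 D.μ := by
  obtain ⟨r, -, hr⟩ := hD.exists_coercive
  exact memLp_wGram hD.R_aesm hr hD.H_L2 i j

/-! ### The decomposition of the observation -/

theorem IsDecomp.unique {t : ℝ} (hR : (D.R t).PosDef) {p q : (Fin m → ℝ) × (Fin m → ℝ)}
    (hp : D.IsDecomp t p) (hq : D.IsDecomp t q) : p = q := by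
  have h1 : p.1 = q.1 := by
    refine eq_of_im_of_mulVec_eq hR hp.1 hq.1 ?_
    have e1 := congrArg ((D.H t)ᵀ *ᵥ ·) hp.2.2
    have e2 := congrArg ((D.H t)ᵀ *ᵥ ·) hq.2.2
    simp only [mulVec_add, hp.2.1, hq.2.1, add_zero] at e1 e2
    exact e1.trans e2.symm
  have h2 : p.1 + p.2 = q.1 + q.2 := hp.2.2.trans hq.2.2.symm
  rw [h1] at h2
  exact Prod.ext h1 (add_left_cancel h2)

theorem isDecomp_proj {t : ℝ} (hR : (D.R t).PosDef) :
    D.IsDecomp t (D.projIm t, D.projKer t) :=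
  Classical.epsilon_spec (p := D.IsDecomp t) ⟨(_, _), isSplit_splitIm hR _⟩

theorem Standing.projIm_ae_eq (hD : D.Standing) :
    ∀ᵐ t ∂D.μ, D.projIm t = splitIm (D.R t) (D.H t) ((D.R t)⁻¹ *ᵥ D.y t) := by
  filter_upwards [hD.R_posDef] with t ht
  exact congrArg Prod.fst ((isDecomp_proj ht).unique ht (q := (_, _))
    (isSplit_splitIm (H := D.H t) ht _))

theorem quad_proj_orthogonal {t : ℝ} (hR : (D.R t).PosDef) :
    (D.R t *ᵥ D.projIm t) ⬝ᵥ D.projKer t = 0 :=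
  dotProduct_eq_zero_of_im_ker hR (isDecomp_proj hR).1 (isDecomp_proj hR).2.1

theorem quad_proj_add {t : ℝ} (hR : (D.R t).PosDef) :
    ((D.R t)⁻¹ *ᵥ D.y t) ⬝ᵥ D.y t =
      (D.R t *ᵥ D.projIm t) ⬝ᵥ D.projIm t + (D.R t *ᵥ D.projKer t) ⬝ᵥ D.projKer t := by
  rw [← quad_add_of_orthogonal hR.posSemidef (quad_proj_orthogonal hR), (isDecomp_proj hR).2.2,
    hR.mulVec_inv_mulVec, dotProduct_comm]

theorem Standing.projIm_memLp (hD : D.Standing) : MemLp D.projIm 2 D.μ ∧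
    Integrable (fun t => (D.R t *ᵥ D.projIm t) ⬝ᵥ D.projIm t) D.μ := by
  obtain ⟨r, -, hr⟩ := hD.exists_coercive
  have hm : AEStronglyMeasurable D.projIm D.μ :=
    (AEStronglyMeasurable.splitIm hD.R_aesm hD.H_aesm hD.obs_L2.1 hr).congr
      (hD.projIm_ae_eq.mono fun t ht => ht.symm)
  have hR := hD.R_aesm
  have hi : Integrable (fun t => (D.R t *ᵥ D.projIm t) ⬝ᵥ D.projIm t) D.μ := by
    refine hD.integrable_obs.mono' (by fun_prop) ?_
    filter_upwards [hD.R_posDef] with t ht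
    rw [Real.norm_eq_abs, abs_of_nonneg (ht.posSemidef.quad_nonneg _), quad_proj_add ht]
    linarith [ht.posSemidef.quad_nonneg (D.projKer t)]
  exact ⟨memLp_two_of_integrable_quad hr hm hi, hi⟩

theorem Standing.projKer_memLp (hD : D.Standing) : MemLp D.projKer 2 D.μ ∧
    Integrable (fun t => (D.R t *ᵥ D.projKer t) ⬝ᵥ D.projKer t) D.μ := by
  have e : ∀ᵐ t ∂D.μ, (D.R t)⁻¹ *ᵥ D.y t - D.projIm t = D.projKer t := by
    filter_upwards [hD.R_posDef] with t ht
    exact sub_eq_of_eq_add' (isDecomp_proj ht).2.2.symm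
  refine ⟨(hD.obs_L2.sub hD.projIm_memLp.1).ae_eq e, ?_⟩
  refine (hD.integrable_obs.sub hD.projIm_memLp.2).congr ?_
  filter_upwards [hD.R_posDef] with t ht
  rw [Pi.sub_apply, quad_proj_add ht]
  ring

/-! ### Representatives -/

/-- Derivatives are unique, so two pairs generating `x` differ only inside the kernels of `P0^{1/2}`
and `G Q^{1/2}`. Representatives thus become instances of `exists_minimal_pair`. -/
theorem IsControlled.inp_eq {x : ℝ → Fin n → ℝ} {p q : (Fin n → ℝ) × (ℝ → Fin d → ℝ)}
    (hp : D.IsControlled x p) (hq : D.IsControlled x q) :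
    psdSqrt D.P0 *ᵥ q.1 = psdSqrt D.P0 *ᵥ p.1 ∧
      ∀ᵐ t ∂D.μ, D.inp t *ᵥ q.2 t = D.inp t *ᵥ p.2 t := by
  refine ⟨hq.2.2.2.symm.trans hp.2.2.2, ?_⟩
  filter_upwards [hp.2.2.1, hq.2.2.1] with t h1 h2
  exact add_left_cancel (h2.unique h1)

/-- `exists_minimal_pair` with identity weight and the transposed input matrix as `H`. -/
theorem Standing.exists_isRep (hD : D.Standing) {x : ℝ → Fin n → ℝ} (hx : x ∈ D.Sx) :
    ∃ p, D.IsRep x p ∧ ∀ q, D.IsRep x q → q.1 = p.1 ∧ q.2 =ᵐ[D.μ] p.2 := by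
  obtain ⟨p₀, hp₀⟩ := hx
  have hR : AEStronglyMeasurable (fun _ : ℝ => (1 : Matrix (Fin d) (Fin d) ℝ)) D.μ :=
    aestronglyMeasurable_const
  have hB := hD.inp_aesm
  have hBt : AEStronglyMeasurable (fun t => (D.inp t)ᵀ) D.μ := by fun_prop
  obtain ⟨ξ, u, hu, -, hξ, hBu, -, -, hmin⟩ := exists_minimal_pair (psdSqrt D.P0) hR
    (Filter.Eventually.of_forall fun _ => coercive_one) hBt p₀.1 hp₀.2.1
    (by simpa using integrable_dotProduct_self hp₀.2.1)
  simp only [one_mulVec, transpose_transpose] at hmin hBu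
  have hc : D.IsControlled x (ξ, u) := by
    refine ⟨hp₀.1, hu, ?_, hp₀.2.2.2.trans hξ.symm⟩
    filter_upwards [hp₀.2.2.1, hBu] with t h1 h2
    change HasDerivAt x (D.F t *ᵥ x t + D.inp t *ᵥ u t) t
    rw [h2]
    exact h1
  have hq : ∀ q, D.IsControlled x q → D.controlCost (ξ, u) ≤ D.controlCost q ∧
      (D.controlCost q ≤ D.controlCost (ξ, u) → q.1 = ξ ∧ q.2 =ᵐ[D.μ] u) := fun q hq =>
    hmin q.1 q.2 (integrable_dotProduct_self hq.2.1) (hp₀.inp_eq hq).1 (hp₀.inp_eq hq).2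
  exact ⟨(ξ, u), ⟨hc, fun q h => (hq q h).1⟩, fun q h => (hq q h.1).2 (h.2 _ hc)⟩

theorem Standing.isRep_rep (hD : D.Standing) {x : ℝ → Fin n → ℝ} (hx : x ∈ D.Sx) :
    D.IsRep x (D.rep x) := by
  obtain ⟨p, hp, -⟩ := hD.exists_isRep hx
  exact Classical.epsilon_spec (p := D.IsRep x) ⟨p, hp⟩

theorem Standing.rep_unique (hD : D.Standing) {x : ℝ → Fin n → ℝ} (hx : x ∈ D.Sx)
    {p : (Fin n → ℝ) × (ℝ → Fin d → ℝ)} (hp : D.IsRep x p) :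
    p.1 = (D.rep x).1 ∧ p.2 =ᵐ[D.μ] (D.rep x).2 := by
  obtain ⟨p', -, hu⟩ := hD.exists_isRep hx
  obtain ⟨h1, h2⟩ := hu _ hp
  obtain ⟨h3, h4⟩ := hu _ (hD.isRep_rep hx)
  exact ⟨h1.trans h3.symm, h2.trans h4.symm⟩

theorem IsInfoControlled.inp_eq {l : ℝ → Fin n → ℝ} {p q : (Fin n → ℝ) × (ℝ → Fin m → ℝ)}
    (hp : D.IsInfoControlled l p) (hq : D.IsInfoControlled l q) :
    psdSqrt D.ST *ᵥ q.1 = psdSqrt D.ST *ᵥ p.1 ∧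
      ∀ᵐ t ∂D.μ, (D.H t)ᵀ *ᵥ q.2 t = (D.H t)ᵀ *ᵥ p.2 t := by
  refine ⟨hq.2.2.2.2.symm.trans hp.2.2.2.2, ?_⟩
  filter_upwards [hp.2.2.2.1, hq.2.2.2.1] with t h1 h2
  exact add_left_cancel (neg_injective (h2.unique h1))

/-- Besides minimality, the range conditions on `z` and `v` are kept: the pseudo-inverse identity
and the identification of the misfit need them. -/
theorem Standing.exists_isInfoRep (hD : D.Standing) {l : ℝ → Fin n → ℝ} (hl : l ∈ D.Sl) :
    ∃ p, D.IsInfoRep l p ∧ (∃ w, p.1 = psdSqrt D.ST *ᵥ w) ∧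
      (∀ᵐ t ∂D.μ, ∃ w, p.2 t = (D.R t)⁻¹ *ᵥ (D.H t *ᵥ w)) ∧
      ∀ q, D.IsInfoRep l q → q.1 = p.1 ∧ q.2 =ᵐ[D.μ] p.2 := by
  obtain ⟨p₀, hp₀⟩ := hl
  obtain ⟨r, -, hr⟩ := hD.exists_coercive
  obtain ⟨z, v, hv, hvi, hz, hHv, hzim, hvim, hmin⟩ := exists_minimal_pair (psdSqrt D.ST)
    hD.R_aesm hr hD.H_aesm p₀.1 hp₀.2.1 hp₀.2.2.1
  have hc : D.IsInfoControlled l (z, v) := by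
    refine ⟨hp₀.1, hv, hvi, ?_, hp₀.2.2.2.2.trans hz.symm⟩
    filter_upwards [hp₀.2.2.2.1, hHv] with t h1 h2
    change HasDerivAt l (-((D.F t)ᵀ *ᵥ l t + (D.H t)ᵀ *ᵥ v t)) t
    rw [h2]
    exact h1
  have hq : ∀ q, D.IsInfoControlled l q → D.infoCost (z, v) ≤ D.infoCost q ∧
      (D.infoCost q ≤ D.infoCost (z, v) → q.1 = z ∧ q.2 =ᵐ[D.μ] v) := fun q hq =>
    hmin q.1 q.2 hq.2.2.1 (hp₀.inp_eq hq).1 (hp₀.inp_eq hq).2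
  rw [(psdSqrt_spec hD.ST_psd).1.transpose_eq] at hzim
  exact ⟨(z, v), ⟨hc, fun q h => (hq q h).1⟩, hzim, hvim, fun q h => (hq q h.1).2 (h.2 _ hc)⟩

theorem Standing.isInfoRep_infoRep (hD : D.Standing) {l : ℝ → Fin n → ℝ} (hl : l ∈ D.Sl) :
    D.IsInfoRep l (D.infoRep l) := by
  obtain ⟨p, hp, -⟩ := hD.exists_isInfoRep hl
  exact Classical.epsilon_spec (p := D.IsInfoRep l) ⟨p, hp⟩

theorem Standing.infoRep_unique (hD : D.Standing) {l : ℝ → Fin n → ℝ} (hl : l ∈ D.Sl)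
    {p : (Fin n → ℝ) × (ℝ → Fin m → ℝ)} (hp : D.IsInfoRep l p) :
    p.1 = (D.infoRep l).1 ∧ p.2 =ᵐ[D.μ] (D.infoRep l).2 := by
  obtain ⟨p', -, -, -, hu⟩ := hD.exists_isInfoRep hl
  obtain ⟨h1, h2⟩ := hu _ hp
  obtain ⟨h3, h4⟩ := hu _ (hD.isInfoRep_infoRep hl)
  exact ⟨h1.trans h3.symm, h2.trans h4.symm⟩

theorem Standing.infoRep_mem_range (hD : D.Standing) {l : ℝ → Fin n → ℝ} (hl : l ∈ D.Sl) :
    (∃ w, (D.infoRep l).1 = psdSqrt D.ST *ᵥ w) ∧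
      ∀ᵐ t ∂D.μ, ∃ w, (D.infoRep l).2 t = (D.R t)⁻¹ *ᵥ (D.H t *ᵥ w) := by
  obtain ⟨p', -, h1, h2, hu⟩ := hD.exists_isInfoRep hl
  obtain ⟨h3, h4⟩ := hu _ (hD.isInfoRep_infoRep hl)
  refine ⟨h3 ▸ h1, ?_⟩
  filter_upwards [h2, h4] with t ht h
  rwa [h]

/-! ### The Lagrangian and the primal function -/

theorem Standing.memLp_top_of_mem_AC (hD : D.Standing) {x : ℝ → Fin n → ℝ} (hx : x ∈ D.AC) :
    MemLp x ∞ D.μ :=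
  AbsolutelyContinuousOnInterval.memLp_top hD.lt.le hx

theorem const_mem_AC (c : Fin n → ℝ) : (fun _ => c) ∈ D.AC :=
  (LipschitzWith.const c).lipschitzOnWith.absolutelyContinuousOnInterval

theorem Standing.ae_hasDerivAt (hD : D.Standing) {x : ℝ → Fin n → ℝ} (hx : x ∈ D.AC) :
    ∀ᵐ t ∂D.μ, HasDerivAt x (deriv x t) t :=
  AbsolutelyContinuousOnInterval.ae_hasDerivAt_pi hD.lt.le hx

theorem Standing.deriv_L1 (hD : D.Standing) {x : ℝ → Fin n → ℝ} (hx : x ∈ D.AC) :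
    MemLp (deriv x) 1 D.μ :=
  AbsolutelyContinuousOnInterval.memLp_deriv hD.lt.le hx

/-- `H^* R⁻¹ y`. -/
noncomputable def obsDrift (D : SmoothingData n d m) (t : ℝ) : Fin n → ℝ :=
  (D.H t)ᵀ *ᵥ ((D.R t)⁻¹ *ᵥ D.y t)

theorem Standing.obsDrift_L1 (hD : D.Standing) : MemLp D.obsDrift 1 D.μ :=
  MemLp.mulVec (p := 2) (q := 2) (fun i j => hD.H_L2 j i) hD.obs_L2

theorem Standing.integrable_gram_quad (hD : D.Standing) {x y : ℝ → Fin n → ℝ} (hx : MemLp x ∞ D.μ)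
    (hy : MemLp y ∞ D.μ) :
    Integrable (fun t => (wGram (D.R t) (D.H t) *ᵥ x t) ⬝ᵥ y t) D.μ :=
  MemLp.integrable_dotProduct (p := 1) (q := ∞)
    (MemLp.mulVec (p := 1) (q := ∞) hD.wGram_L1 hx) hy

theorem observation_term_eq (t : ℝ) (x : Fin n → ℝ) :
    (((D.H t)ᵀ * (D.R t)⁻¹) *ᵥ (D.H t *ᵥ x - (2 : ℝ) • D.y t)) ⬝ᵥ x =
      (wGram (D.R t) (D.H t) *ᵥ x) ⬝ᵥ x - 2 * (D.obsDrift t ⬝ᵥ x) := by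
  rw [gram_mulVec, obsDrift]
  simp only [mulVec_sub, mulVec_smul, ← mulVec_mulVec, sub_dotProduct, smul_dotProduct, smul_eq_mul]

/-- The part of the primal objective that depends on the trajectory only. -/
noncomputable def stateCost (D : SmoothingData n d m) (x : ℝ → Fin n → ℝ) : ℝ :=
  (D.ST *ᵥ x D.T) ⬝ᵥ x D.T
    + (∫ t, (wGram (D.R t) (D.H t) *ᵥ x t) ⬝ᵥ x t - 2 * (D.obsDrift t ⬝ᵥ x t) ∂D.μ) + D.obsNormSq

theorem Standing.primalObj_eq (hD : D.Standing) {x : ℝ → Fin n → ℝ} (hx : x ∈ D.AC) :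
    D.primalObj x = D.controlCost (D.rep x) + D.stateCost x := by
  have hxL := hD.memLp_top_of_mem_AC hx
  have e1 : ∫ t, (((D.H t)ᵀ * (D.R t)⁻¹) *ᵥ D.y t) ⬝ᵥ x t ∂D.μ =
      ∫ t, D.obsDrift t ⬝ᵥ x t ∂D.μ := by
    simp only [obsDrift, mulVec_mulVec]
  unfold primalObj normSqSx controlCost stateCost
  rw [e1, integral_sub (hD.integrable_gram_quad hxL hxL)
    ((MemLp.integrable_dotProduct (p := 1) (q := ∞) hD.obsDrift_L1 hxL).const_mul 2),
    integral_const_mul]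
  simp only [wGram]
  ring

/-- The defect in the state equation. -/
noncomputable def defect (D : SmoothingData n d m) (u : ℝ → Fin d → ℝ) (x : ℝ → Fin n → ℝ)
    (t : ℝ) : Fin n → ℝ :=
  deriv x t - D.F t *ᵥ x t - D.inp t *ᵥ u t

theorem Standing.defect_L1 (hD : D.Standing) {u : ℝ → Fin d → ℝ} {x : ℝ → Fin n → ℝ}
    (hu : u ∈ D.Controls) (hx : x ∈ D.AC) : MemLp (D.defect u x) 1 D.μ :=
  ((hD.deriv_L1 hx).sub (MemLp.mulVec (p := 1) (q := ∞) hD.F_L1 (hD.memLp_top_of_mem_AC hx))).sub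
    (MemLp.mulVec (p := 2) (q := 2) hD.inp_L2 hu)

theorem Standing.isControlled_iff (hD : D.Standing) {ξ : Fin n → ℝ} {u : ℝ → Fin d → ℝ}
    {x : ℝ → Fin n → ℝ} (hu : u ∈ D.Controls) (hx : x ∈ D.AC) :
    D.IsControlled x (ξ, u) ↔
      (∀ᵐ t ∂D.μ, D.defect u x t = 0) ∧ x D.t₀ - psdSqrt D.P0 *ᵥ ξ = 0 := by
  have hd := hD.ae_hasDerivAt hx
  constructor
  · rintro ⟨-, -, h1, h2⟩
    refine ⟨?_, sub_eq_zero.2 h2⟩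
    filter_upwards [h1] with t ht
    rw [defect, ht.deriv]
    simp [inp]
  · rintro ⟨h1, h2⟩
    refine ⟨hx, hu, ?_, sub_eq_zero.1 h2⟩
    filter_upwards [h1, hd] with t ht htd
    rw [defect, sub_sub, sub_eq_zero] at ht
    rw [ht] at htd
    exact htd

theorem lagrangian_eq_defect (ξ : Fin n → ℝ) (u : ℝ → Fin d → ℝ) (x l : ℝ → Fin n → ℝ)
    (l₀ : Fin n → ℝ) :
    D.lagrangian ξ u x l l₀ = D.controlCost (ξ, u) + D.stateCost x
      + 2 * (∫ t, D.defect u x t ⬝ᵥ l t ∂D.μ)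
      + 2 * ((x D.t₀ - psdSqrt D.P0 *ᵥ ξ) ⬝ᵥ l₀) := by
  unfold lagrangian controlCost stateCost
  simp only [observation_term_eq, defect, inp]
  rw [show (fun t => l t ⬝ᵥ (deriv x t - D.F t *ᵥ x t - (D.G t * psdSqrt (D.Q t)) *ᵥ u t)) =
    fun t => (deriv x t - D.F t *ᵥ x t - (D.G t * psdSqrt (D.Q t)) *ᵥ u t) ⬝ᵥ l t from
    funext fun t => dotProduct_comm _ _]
  ring

theorem Standing.lagrangian_of_isControlled (hD : D.Standing) {ξ : Fin n → ℝ}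
    {u : ℝ → Fin d → ℝ} {x : ℝ → Fin n → ℝ} (h : D.IsControlled x (ξ, u)) (l : ℝ → Fin n → ℝ)
    (l₀ : Fin n → ℝ) :
    D.lagrangian ξ u x l l₀ = D.controlCost (ξ, u) + D.stateCost x := by
  obtain ⟨h1, h2⟩ := (hD.isControlled_iff h.2.1 h.1).1 h
  have e : ∫ t, D.defect u x t ⬝ᵥ l t ∂D.μ = 0 := by
    rw [integral_eq_zero_of_ae]
    filter_upwards [h1] with t ht
    simp [ht]
  rw [lagrangian_eq_defect, e, h2]
  simp

theorem smul_mem_AC {l : ℝ → Fin n → ℝ} (hl : l ∈ D.AC) (s : ℝ) : (fun t => s • l t) ∈ D.AC :=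
  AbsolutelyContinuousOnInterval.const_smul s hl

/-- The Lagrangian is affine in the multipliers. A violated constraint makes the linear part nonzero
somewhere, by the fundamental lemma for the state equation or by a constant multiplier for the
initial condition, and scaling does the rest. -/
theorem Standing.iSup_lagrangian_eq_top (hD : D.Standing) {ξ : Fin n → ℝ}
    {u : ℝ → Fin d → ℝ} {x : ℝ → Fin n → ℝ} (hu : u ∈ D.Controls) (hx : x ∈ D.AC)
    (h : ¬ D.IsControlled x (ξ, u)) :
    (⨆ l ∈ D.AC, ⨆ (l₀ : Fin n → ℝ), ((D.lagrangian ξ u x l l₀ : ℝ) : EReal)) = ⊤ := by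
  have key : ∃ l ∈ D.AC, ∃ l₀ : Fin n → ℝ,
      (∫ t, D.defect u x t ⬝ᵥ l t ∂D.μ) + (x D.t₀ - psdSqrt D.P0 *ᵥ ξ) ⬝ᵥ l₀ ≠ 0 := by
    by_contra! hcon
    refine h ((hD.isControlled_iff hu hx).2 ⟨?_, ?_⟩)
    · refine ae_eq_zero_of_forall_integral_dotProduct_eq_zero hD.lt (hD.defect_L1 hu hx)
        fun l hl => ?_
      have h0 := hcon l hl 0
      simp only [dotProduct_zero, add_zero] at h0
      exact h0
    · have := hcon (fun _ => 0) (const_mem_AC 0) (x D.t₀ - psdSqrt D.P0 *ᵥ ξ)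
      exact dotProduct_self_eq_zero.1 (by simpa using this)
  obtain ⟨l, hl, l₀, hne⟩ := key
  set e := (∫ t, D.defect u x t ⬝ᵥ l t ∂D.μ) + (x D.t₀ - psdSqrt D.P0 *ᵥ ξ) ⬝ᵥ l₀ with he
  rw [EReal.eq_top_iff_forall_lt]
  intro c
  -- The scale at which the Lagrangian takes the value `c + 1`.
  set s := (c + 1 - (D.controlCost (ξ, u) + D.stateCost x)) / (2 * e) with hs
  have hval : D.lagrangian ξ u x (fun t => s • l t) (s • l₀) = c + 1 := by
    rw [lagrangian_eq_defect]
    simp only [dotProduct_smul, smul_eq_mul]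
    rw [integral_const_mul]
    have : 2 * e * s = c + 1 - (D.controlCost (ξ, u) + D.stateCost x) := by
      rw [hs]; field_simp
    rw [he] at this
    linarith
  refine lt_of_lt_of_le (b := ((c + 1 : ℝ) : EReal)) (by exact_mod_cast lt_add_one c) ?_
  rw [← hval]
  exact le_iSup₂_of_le _ (smul_mem_AC hl s) (le_iSup (fun l₀ : Fin n → ℝ =>
    ((D.lagrangian ξ u x (fun t => s • l t) l₀ : ℝ) : EReal)) (s • l₀))

theorem Standing.iSup_lagrangian_of_isControlled (hD : D.Standing) {ξ : Fin n → ℝ}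
    {u : ℝ → Fin d → ℝ} {x : ℝ → Fin n → ℝ} (h : D.IsControlled x (ξ, u)) :
    (⨆ l ∈ D.AC, ⨆ (l₀ : Fin n → ℝ), ((D.lagrangian ξ u x l l₀ : ℝ) : EReal)) =
      ((D.controlCost (ξ, u) + D.stateCost x : ℝ) : EReal) := by
  simp only [hD.lagrangian_of_isControlled h]
  refine le_antisymm (iSup₂_le fun l _ => iSup_le fun _ => le_rfl) ?_
  exact le_iSup₂_of_le (fun _ => 0) (const_mem_AC 0) (le_iSup (fun _ : Fin n → ℝ => _) 0)

theorem Standing.primalFunction_eq_top (hD : D.Standing) {x : ℝ → Fin n → ℝ} (hx : x ∈ D.AC)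
    (hn : x ∉ D.Sx) : D.primalFunction x = ⊤ := by
  unfold primalFunction
  refine iInf_eq_top.2 fun ξ => iInf₂_eq_top.2 fun u hu => ?_
  exact hD.iSup_lagrangian_eq_top hu hx fun h => hn ⟨_, h⟩

/-- Pairs not generating `x` contribute `⊤`; all others share the state cost, so the infimum is
attained at the cheapest control. -/
theorem Standing.primalFunction_eq (hD : D.Standing) {x : ℝ → Fin n → ℝ} (hx : x ∈ D.Sx) :
    D.primalFunction x = ((D.primalObj x : ℝ) : EReal) := by
  have hr := hD.isRep_rep hx
  have hac : x ∈ D.AC := hr.1.1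
  rw [hD.primalObj_eq hac]
  refine le_antisymm ?_ (le_iInf fun ξ => le_iInf₂ fun u hu => ?_)
  · exact (iInf_le _ (D.rep x).1).trans ((iInf₂_le (D.rep x).2 hr.1.2.1).trans
      (hD.iSup_lagrangian_of_isControlled hr.1).le)
  · by_cases h : D.IsControlled x (ξ, u)
    · rw [hD.iSup_lagrangian_of_isControlled h, EReal.coe_le_coe_iff]
      have := hr.2 _ h
      linarith
    · rw [hD.iSup_lagrangian_eq_top hu hac h]
      exact le_top

theorem dualFunction_le_primalFunction {x l : ℝ → Fin n → ℝ} (hx : x ∈ D.AC) (hl : l ∈ D.AC)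
    (l₀ : Fin n → ℝ) : D.dualFunction l l₀ ≤ D.primalFunction x := by
  refine le_iInf fun ξ => le_iInf₂ fun u hu => ?_
  refine le_trans ?_ (le_iSup₂_of_le l hl (le_iSup (fun l₀ : Fin n → ℝ =>
    ((D.lagrangian ξ u x l l₀ : ℝ) : EReal)) l₀))
  exact (iInf_le _ ξ).trans ((iInf₂_le u hu).trans (iInf₂_le x hx))

/-! ### The dual function -/

/-- The linear form of the Lagrangian in the state, after integration by parts. -/
noncomputable def adjDrift (D : SmoothingData n d m) (l : ℝ → Fin n → ℝ) (t : ℝ) : Fin n → ℝ :=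
  D.obsDrift t + deriv l t + (D.F t)ᵀ *ᵥ l t

theorem Standing.adjDrift_L1 (hD : D.Standing) {l : ℝ → Fin n → ℝ} (hl : l ∈ D.AC) :
    MemLp (D.adjDrift l) 1 D.μ :=
  (hD.obsDrift_L1.add (hD.deriv_L1 hl)).add
    (MemLp.mulVec (p := 1) (q := ∞) (fun i j => hD.F_L1 j i) (hD.memLp_top_of_mem_AC hl))

/-- The part of the dual function that comes from the controls and the initial condition. -/
noncomputable def inputCost (D : SmoothingData n d m) (l : ℝ → Fin n → ℝ) (l₀ : Fin n → ℝ) : ℝ :=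
  (D.P0 *ᵥ l₀) ⬝ᵥ l₀ + ∫ t, ((D.G t * D.Q t * (D.G t)ᵀ) *ᵥ l t) ⬝ᵥ l t ∂D.μ

/-- The Lagrangian with squares completed in `ξ` and `u`. -/
theorem Standing.lagrangian_eq (hD : D.Standing) {u : ℝ → Fin d → ℝ} {x l : ℝ → Fin n → ℝ}
    (hu : u ∈ D.Controls) (hx : x ∈ D.AC) (hl : l ∈ D.AC) (ξ l₀ : Fin n → ℝ) :
    D.lagrangian ξ u x l l₀ =
      (ξ - psdSqrt D.P0 *ᵥ l₀) ⬝ᵥ (ξ - psdSqrt D.P0 *ᵥ l₀)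
      + (∫ t, (u t - (D.inp t)ᵀ *ᵥ l t) ⬝ᵥ (u t - (D.inp t)ᵀ *ᵥ l t) ∂D.μ)
      - D.inputCost l l₀ + D.obsNormSq
      + ((D.ST *ᵥ x D.T) ⬝ᵥ x D.T + 2 * (l D.T ⬝ᵥ x D.T) + 2 * (x D.t₀ ⬝ᵥ (l₀ - l D.t₀)))
      + ∫ t, (wGram (D.R t) (D.H t) *ᵥ x t) ⬝ᵥ x t - 2 * (D.adjDrift l t ⬝ᵥ x t) ∂D.μ := by
  have hxL := hD.memLp_top_of_mem_AC hx
  have hlL := hD.memLp_top_of_mem_AC hl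
  have hBl := hD.inp_transpose_L2 hlL
  have iuu := integrable_dotProduct_self hu
  have ill := integrable_dotProduct_self hBl
  have iul := MemLp.integrable_dotProduct (p := 2) (q := 2) hBl hu
  have iM := hD.integrable_gram_quad hxL hxL
  have ib := MemLp.integrable_dotProduct (p := 1) (q := ∞) hD.obsDrift_L1 hxL
  have idl := MemLp.integrable_dotProduct (p := 1) (q := ∞) (hD.deriv_L1 hl) hxL
  have idx := MemLp.integrable_dotProduct (p := ∞) (q := 1) hlL (hD.deriv_L1 hx)
  have iF : Integrable (fun t => ((D.F t)ᵀ *ᵥ l t) ⬝ᵥ x t) D.μ :=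
    MemLp.integrable_dotProduct (p := 1) (q := ∞)
      (MemLp.mulVec (p := 1) (q := ∞) (fun i j => hD.F_L1 j i) hlL) hxL
  have iuul : Integrable (fun t => u t ⬝ᵥ u t - 2 * (((D.inp t)ᵀ *ᵥ l t) ⬝ᵥ u t)) D.μ :=
    iuu.sub (iul.const_mul 2)
  have idxF : Integrable (fun t => l t ⬝ᵥ deriv x t - ((D.F t)ᵀ *ᵥ l t) ⬝ᵥ x t) D.μ :=
    idx.sub iF
  have iMb : Integrable (fun t => (wGram (D.R t) (D.H t) *ᵥ x t) ⬝ᵥ x t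
      - 2 * (D.obsDrift t ⬝ᵥ x t)) D.μ := iM.sub (ib.const_mul 2)
  have iMbd : Integrable (fun t => (wGram (D.R t) (D.H t) *ᵥ x t) ⬝ᵥ x t
      - 2 * (D.obsDrift t ⬝ᵥ x t) - 2 * (deriv l t ⬝ᵥ x t)) D.μ := iMb.sub (idl.const_mul 2)
  have eu : ∫ t, (u t - (D.inp t)ᵀ *ᵥ l t) ⬝ᵥ (u t - (D.inp t)ᵀ *ᵥ l t) ∂D.μ =
      (∫ t, u t ⬝ᵥ u t ∂D.μ) - 2 * (∫ t, ((D.inp t)ᵀ *ᵥ l t) ⬝ᵥ u t ∂D.μ)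
        + ∫ t, ((D.inp t)ᵀ *ᵥ l t) ⬝ᵥ ((D.inp t)ᵀ *ᵥ l t) ∂D.μ := by
    rw [← integral_const_mul, ← integral_sub iuu (iul.const_mul 2),
      ← integral_add iuul ill]
    refine integral_congr_ae (Filter.Eventually.of_forall fun t => ?_)
    simp only [sub_dotProduct, dotProduct_sub]
    rw [dotProduct_comm (u t) (_ *ᵥ _)]
    ring
  have eN : ∫ t, ((D.inp t)ᵀ *ᵥ l t) ⬝ᵥ ((D.inp t)ᵀ *ᵥ l t) ∂D.μ =
      ∫ t, ((D.G t * D.Q t * (D.G t)ᵀ) *ᵥ l t) ⬝ᵥ l t ∂D.μ := by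
    refine integral_congr_ae ?_
    filter_upwards [hD.inp_mul_transpose] with t ht
    rw [← ht, mulVec_dotProduct, transpose_transpose, mulVec_mulVec]
  have eparts : ∫ t, l t ⬝ᵥ deriv x t ∂D.μ =
      l D.T ⬝ᵥ x D.T - l D.t₀ ⬝ᵥ x D.t₀ - ∫ t, deriv l t ⬝ᵥ x t ∂D.μ :=
    AbsolutelyContinuousOnInterval.integral_dotProduct_deriv hD.lt.le hl hx
  have edef : ∫ t, D.defect u x t ⬝ᵥ l t ∂D.μ =
      (∫ t, l t ⬝ᵥ deriv x t ∂D.μ) - (∫ t, ((D.F t)ᵀ *ᵥ l t) ⬝ᵥ x t ∂D.μ)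
        - ∫ t, ((D.inp t)ᵀ *ᵥ l t) ⬝ᵥ u t ∂D.μ := by
    rw [← integral_sub idx iF, ← integral_sub idxF iul]
    refine integral_congr_ae (Filter.Eventually.of_forall fun t => ?_)
    simp only [defect, sub_dotProduct]
    rw [dotProduct_comm (deriv x t), mulVec_dotProduct (D.F t), mulVec_dotProduct (D.inp t)]
  have eadj : ∫ t, (wGram (D.R t) (D.H t) *ᵥ x t) ⬝ᵥ x t - 2 * (D.adjDrift l t ⬝ᵥ x t) ∂D.μ =
      (∫ t, (wGram (D.R t) (D.H t) *ᵥ x t) ⬝ᵥ x t - 2 * (D.obsDrift t ⬝ᵥ x t) ∂D.μ)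
        - 2 * (∫ t, deriv l t ⬝ᵥ x t ∂D.μ) - 2 * ∫ t, ((D.F t)ᵀ *ᵥ l t) ⬝ᵥ x t ∂D.μ := by
    rw [← integral_const_mul, ← integral_const_mul,
      ← integral_sub iMb (idl.const_mul 2), ← integral_sub iMbd (iF.const_mul 2)]
    refine integral_congr_ae (Filter.Eventually.of_forall fun t => ?_)
    simp only [adjDrift, add_dotProduct]
    ring
  have eξ : (ξ - psdSqrt D.P0 *ᵥ l₀) ⬝ᵥ (ξ - psdSqrt D.P0 *ᵥ l₀) =
      ξ ⬝ᵥ ξ - 2 * ((psdSqrt D.P0 *ᵥ ξ) ⬝ᵥ l₀) + (D.P0 *ᵥ l₀) ⬝ᵥ l₀ := by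
    simp only [sub_dotProduct, dotProduct_sub]
    rw [psdSqrt_mulVec_dotProduct hD.P0_psd, (psdSqrt_spec hD.P0_psd).1.symm_quad ξ l₀,
      dotProduct_comm ξ (_ *ᵥ _)]
    ring
  rw [lagrangian_eq_defect, edef, eparts, eadj, eu, eN, eξ]
  unfold controlCost stateCost inputCost
  rw [sub_dotProduct, dotProduct_sub, dotProduct_comm (l D.t₀)]
  ring

theorem Standing.inputControl_mem (hD : D.Standing) {l : ℝ → Fin n → ℝ} (hl : l ∈ D.AC) :
    (fun t => (D.inp t)ᵀ *ᵥ l t) ∈ D.Controls :=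
  hD.inp_transpose_L2 (hD.memLp_top_of_mem_AC hl)

/-- With `z = A^{1/2} w` one has `A^{1/2} z = A w`, and the Penrose equation `A A⁺ A = A` reduces
the left side to `⟨A w, w⟩ = |z|²`. It fails for `z` outside the range of `A^{1/2}`, so the
minimality of `z` matters. -/
theorem symPinv_quad {k : ℕ} {A : Matrix (Fin k) (Fin k) ℝ} (hA : A.PosSemidef) {z : Fin k → ℝ}
    (hz : ∃ w, z = psdSqrt A *ᵥ w) :
    (symPinv A *ᵥ (psdSqrt A *ᵥ z)) ⬝ᵥ (psdSqrt A *ᵥ z) = z ⬝ᵥ z := by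
  obtain ⟨w, rfl⟩ := hz
  have e : psdSqrt A *ᵥ (psdSqrt A *ᵥ w) = A *ᵥ w := by rw [mulVec_mulVec, (psdSqrt_spec hA).2]
  rw [e, psdSqrt_mulVec_dotProduct hA, dotProduct_comm, mulVec_dotProduct, hA.transpose_eq, mulVec_mulVec, mulVec_mulVec,
    (symPinv_spec hA.1).1]

/-- The weighted distance of the information control to the observation. -/
noncomputable def misfit (D : SmoothingData n d m) (l : ℝ → Fin n → ℝ) (t : ℝ) : Fin m → ℝ :=
  D.projIm t - (D.infoRep l).2 t

theorem Standing.integrable_misfit (hD : D.Standing) {l : ℝ → Fin n → ℝ} (hl : l ∈ D.Sl) :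
    Integrable (fun t => (D.R t *ᵥ D.misfit l t) ⬝ᵥ D.misfit l t) D.μ ∧
    ∫ t, (D.R t *ᵥ D.misfit l t) ⬝ᵥ D.misfit l t ∂D.μ =
      (∫ t, (D.R t *ᵥ D.projIm t) ⬝ᵥ D.projIm t ∂D.μ)
      - 2 * (∫ t, (D.R t *ᵥ D.projIm t) ⬝ᵥ (D.infoRep l).2 t ∂D.μ)
      + ∫ t, (D.R t *ᵥ (D.infoRep l).2 t) ⬝ᵥ (D.infoRep l).2 t ∂D.μ := by
  have hrep := (hD.isInfoRep_infoRep hl).1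
  have hp := hD.R_posDef.mono fun t ht => ht.posSemidef
  have i1 := hD.projIm_memLp.2
  have i2 := hrep.2.2.1
  have i3 := integrable_quad_cross hD.R_aesm hp hD.projIm_memLp.1.1 hrep.2.1.1 i1 i2
  have e : ∀ᵐ t ∂D.μ, (D.R t *ᵥ D.projIm t) ⬝ᵥ D.projIm t
      - 2 * ((D.R t *ᵥ D.projIm t) ⬝ᵥ (D.infoRep l).2 t)
      + (D.R t *ᵥ (D.infoRep l).2 t) ⬝ᵥ (D.infoRep l).2 t =
      (D.R t *ᵥ D.misfit l t) ⬝ᵥ D.misfit l t := by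
    filter_upwards [hp] with t ht
    simp only [misfit, mulVec_sub, sub_dotProduct, dotProduct_sub]
    rw [ht.symm_quad ((D.infoRep l).2 t) (D.projIm t)]
    ring
  have i13 : Integrable (fun t => (D.R t *ᵥ D.projIm t) ⬝ᵥ D.projIm t
      - 2 * ((D.R t *ᵥ D.projIm t) ⬝ᵥ (D.infoRep l).2 t)) D.μ := i1.sub (i3.const_mul 2)
  refine ⟨(i13.add i2).congr e, ?_⟩
  rw [← integral_congr_ae e, integral_add i13 i2,
    integral_sub i1 (i3.const_mul 2), integral_const_mul]

theorem Standing.dualLeastSquares_eq (hD : D.Standing) {l : ℝ → Fin n → ℝ} (hl : l ∈ D.Sl) :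
    D.dualLeastSquares l = (∫ t, (D.R t *ᵥ D.misfit l t) ⬝ᵥ D.misfit l t ∂D.μ)
      + D.inputCost l (l D.t₀) + (D.infoRep l).1 ⬝ᵥ (D.infoRep l).1 - D.obsNormSq := by
  have hrep := (hD.isInfoRep_infoRep hl).1
  unfold dualLeastSquares misfit inputCost
  rw [hrep.2.2.2.2, symPinv_quad hD.ST_psd (hD.infoRep_mem_range hl).1]
  ring

/-- Expanding the square leaves the `R`-energy of `p_H`, which combines with that of `p_K` into
`obsNormSq` by Pythagoras. -/
theorem Standing.dualObj_eq_dualLeastSquares (hD : D.Standing) {l : ℝ → Fin n → ℝ}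
    (hl : l ∈ D.Sl) : D.dualObj l = D.dualLeastSquares l := by
  have hobs : D.obsNormSq = (∫ t, (D.R t *ᵥ D.projIm t) ⬝ᵥ D.projIm t ∂D.μ)
      + ∫ t, (D.R t *ᵥ D.projKer t) ⬝ᵥ D.projKer t ∂D.μ := by
    rw [← integral_add hD.projIm_memLp.2 hD.projKer_memLp.2]
    refine integral_congr_ae ?_
    filter_upwards [hD.R_posDef] with t ht using quad_proj_add ht
  rw [hD.dualLeastSquares_eq hl, (hD.integrable_misfit hl).2, hobs]
  unfold dualObj normSqSl inputCost
  ring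

/-- These two properties determine the misfit a.e.; it is therefore the minimal-energy solution of
`H^* v = adjDrift`, the same `v` that the lower-bound argument produces. -/
theorem Standing.misfit_spec (hD : D.Standing) {l : ℝ → Fin n → ℝ} (hl : l ∈ D.Sl) :
    ∀ᵐ t ∂D.μ, (D.H t)ᵀ *ᵥ D.misfit l t = D.adjDrift l t ∧
      ∃ w, D.misfit l t = (D.R t)⁻¹ *ᵥ (D.H t *ᵥ w) := by
  have hrep := (hD.isInfoRep_infoRep hl).1
  filter_upwards [hD.R_posDef, hrep.2.2.2.1, (hD.infoRep_mem_range hl).2] with t ht hd hw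
  obtain ⟨⟨w, hw1⟩, hk, hs⟩ := isDecomp_proj ht
  obtain ⟨w', hw'⟩ := hw
  constructor
  · have e := congrArg ((D.H t)ᵀ *ᵥ ·) hs
    simp only [mulVec_add, hk, add_zero] at e
    rw [misfit, mulVec_sub, e, adjDrift, hd.deriv, obsDrift]
    abel
  · refine ⟨w - w', ?_⟩
    simp only at hw1
    rw [misfit, hw1, hw']
    simp [mulVec_sub]

/-- Lower bound for the Lagrangian. -/
theorem Standing.neg_dualLeastSquares_le (hD : D.Standing) {u : ℝ → Fin d → ℝ}
    {x l : ℝ → Fin n → ℝ} (hu : u ∈ D.Controls) (hx : x ∈ D.AC) (hl : l ∈ D.Sl)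
    (ξ : Fin n → ℝ) : -D.dualLeastSquares l ≤ D.lagrangian ξ u x l (l D.t₀) := by
  have hrep := (hD.isInfoRep_infoRep hl).1
  have hac : l ∈ D.AC := hrep.1
  have hxL := hD.memLp_top_of_mem_AC hx
  rw [hD.lagrangian_eq hu hx hac, hD.dualLeastSquares_eq hl]
  have h1 := dot_self_nonneg (ξ - psdSqrt D.P0 *ᵥ l D.t₀)
  have h2 : 0 ≤ ∫ t, (u t - (D.inp t)ᵀ *ᵥ l t) ⬝ᵥ (u t - (D.inp t)ᵀ *ᵥ l t) ∂D.μ :=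
    integral_nonneg fun t => dot_self_nonneg _
  -- Completes the square `|ST^{1/2} x(T) + z|²`, using `l(T) = ST^{1/2} z`.
  have h3 : -((D.infoRep l).1 ⬝ᵥ (D.infoRep l).1) ≤
      (D.ST *ᵥ x D.T) ⬝ᵥ x D.T + 2 * (l D.T ⬝ᵥ x D.T) := by
    have h := dot_self_nonneg (psdSqrt D.ST *ᵥ x D.T + (D.infoRep l).1)
    simp only [add_dotProduct, dotProduct_add] at h
    rw [psdSqrt_mulVec_dotProduct hD.ST_psd] at h
    rw [hrep.2.2.2.2, (psdSqrt_spec hD.ST_psd).1.symm_quad]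
    rw [dotProduct_comm (D.infoRep l).1 (_ *ᵥ _)] at h
    linarith
  -- Completes the square of `R⁻¹ H x - misfit` pointwise in the `R`-inner product.
  have h4 : -(∫ t, (D.R t *ᵥ D.misfit l t) ⬝ᵥ D.misfit l t ∂D.μ) ≤
      ∫ t, (wGram (D.R t) (D.H t) *ᵥ x t) ⬝ᵥ x t - 2 * (D.adjDrift l t ⬝ᵥ x t) ∂D.μ := by
    rw [← integral_neg]
    refine integral_mono_ae (hD.integrable_misfit hl).1.neg
      ((hD.integrable_gram_quad hxL hxL).sub ((MemLp.integrable_dotProduct (p := 1) (q := ∞)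
        (hD.adjDrift_L1 hac) hxL).const_mul 2)) ?_
    filter_upwards [hD.misfit_spec hl, hD.R_posDef] with t ht hR
    have h := hR.posSemidef.quad_nonneg ((D.R t)⁻¹ *ᵥ (D.H t *ᵥ x t) - D.misfit l t)
    simp only [mulVec_sub, sub_dotProduct, dotProduct_sub] at h
    rw [hR.posSemidef.symm_quad (D.misfit l t), ← gram_quad hR, hR.mulVec_inv_mulVec,
      mulVec_dotProduct (D.H t), ht.1] at h
    linarith
  have h5 : x D.t₀ ⬝ᵥ (l D.t₀ - l D.t₀) = 0 := by simp
  rw [h5]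
  linarith

/-- A finite lower bound for the Lagrangian forces the multiplier to be an information vector, and
is at most the negative of the least-squares functional. -/
theorem Standing.mem_Sl_of_le_lagrangian (hD : D.Standing) {l : ℝ → Fin n → ℝ} (hl : l ∈ D.AC)
    {l₀ : Fin n → ℝ} {c : ℝ}
    (hc : ∀ ξ, ∀ u ∈ D.Controls, ∀ x ∈ D.AC, c ≤ D.lagrangian ξ u x l l₀) :
    l ∈ D.Sl ∧ l₀ = l D.t₀ ∧ c ≤ -D.dualLeastSquares l := by
  set K := D.obsNormSq - D.inputCost l l₀ with hK
  -- Choosing `ξ = P0^{1/2} l₀` and `u = (G Q^{1/2})^* l` removes both squares.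
  have hJ : ∀ x ∈ D.AC, c - K ≤
      ((D.ST *ᵥ x D.T) ⬝ᵥ x D.T + 2 * (l D.T ⬝ᵥ x D.T) + 2 * (x D.t₀ ⬝ᵥ (l₀ - l D.t₀)))
      + ∫ t, (wGram (D.R t) (D.H t) *ᵥ x t) ⬝ᵥ x t - 2 * (D.adjDrift l t ⬝ᵥ x t) ∂D.μ := by
    intro x hx
    have h := hc (psdSqrt D.P0 *ᵥ l₀) _ (hD.inputControl_mem hl) x hx
    rw [hD.lagrangian_eq (hD.inputControl_mem hl) hx hl] at h
    simp only [sub_self, dotProduct_zero, integral_zero] at h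
    linarith
  have hend : ∀ p q : Fin n → ℝ, c - K ≤
      (D.ST *ᵥ q) ⬝ᵥ q + 2 * (l D.T ⬝ᵥ q) + 2 * (p ⬝ᵥ (l₀ - l D.t₀)) + 1 := by
    intro p q
    obtain ⟨x, hx, hp, hq, hlt⟩ := exists_absolutelyContinuous_integral_quad_lt hD.lt hD.wGram_L1
      (hD.adjDrift_L1 hl) p q
    have h := hJ x hx
    rw [hp, hq] at h
    have hlt' := hlt.le
    change ∫ t, _ ∂D.μ ≤ 1 at hlt'
    linarith
  have hl₀ : l₀ = l D.t₀ := by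
    by_contra hne
    set e := (l₀ - l D.t₀) ⬝ᵥ (l₀ - l D.t₀) with he
    have hepos : 0 < e := lt_of_le_of_ne (dot_self_nonneg _) fun h =>
      hne (sub_eq_zero.1 (dotProduct_self_eq_zero.1 h.symm))
    -- This multiple makes the linear term `c - K - 2`; after adding the slack of one, the lower
    -- bound `c - K` is violated.
    have h := hend (((c - K - 2) / (2 * e)) • (l₀ - l D.t₀)) 0
    simp only [smul_dotProduct, smul_eq_mul, dotProduct_zero, ← he] at h
    have h2 : 2 * ((c - K - 2) / (2 * e) * e) = c - K - 2 := by field_simp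
    linarith
  -- On the kernel of `ST` the endpoint form is linear, so boundedness below forces `l(T)` to be
  -- orthogonal to that kernel.
  have hlT : ∃ w, psdSqrt D.ST *ᵥ w = l D.T := by
    refine exists_mulVec_eq_of_forall_dotProduct_eq_zero _ _ fun p hp => ?_
    rw [(psdSqrt_spec hD.ST_psd).1.transpose_eq] at hp
    have hST : D.ST *ᵥ p = 0 := by
      rw [← (psdSqrt_spec hD.ST_psd).2, ← mulVec_mulVec, hp, mulVec_zero]
    by_contra hne
    have h := hend 0 (((c - K - 2) / (2 * (l D.T ⬝ᵥ p))) • p)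
    simp only [mulVec_smul, hST, smul_zero, zero_dotProduct, dotProduct_smul, smul_eq_mul] at h
    have h2 : 2 * ((c - K - 2) / (2 * (l D.T ⬝ᵥ p)) * (l D.T ⬝ᵥ p)) = c - K - 2 := by field_simp
    linarith
  obtain ⟨z, hz, w, hw⟩ : ∃ z, psdSqrt D.ST *ᵥ z = l D.T ∧ ∃ w, z = psdSqrt D.ST *ᵥ w := by
    obtain ⟨z₀, hz₀⟩ := hlT
    obtain ⟨⟨w, hw⟩, hk, -⟩ := isSplit_splitIm (R := 1) (H := psdSqrt D.ST) Matrix.PosDef.one z₀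
    rw [(psdSqrt_spec hD.ST_psd).1.transpose_eq, mulVec_sub, sub_eq_zero] at hk
    exact ⟨_, hk.symm.trans hz₀, w, hw.trans (by simp)⟩
  have hzz : D.ST *ᵥ w = l D.T := by
    rw [← hz, hw, mulVec_mulVec, (psdSqrt_spec hD.ST_psd).2]
  have hzw : (D.ST *ᵥ w) ⬝ᵥ w = z ⬝ᵥ z := by rw [hw, psdSqrt_mulVec_dotProduct hD.ST_psd]
  obtain ⟨r, -, hr⟩ := hD.exists_coercive
  -- The endpoint `-w` minimizes the terminal form and gives it the value `-|z|²`. Fixing it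
  -- transfers the sharp remaining bound to the integral.
  obtain ⟨v, hv2, hvi, hvspec, hvle⟩ := exists_energy_le_of_bounded_below hD.lt hD.R_aesm hr
    hD.H_L2 (hD.adjDrift_L1 hl) (p := 0) (q := -w) (C := -(c - K) - z ⬝ᵥ z) (fun x hx hp hq => by
      have h := hJ x hx
      rw [hp, hq] at h
      simp only [mulVec_neg, neg_dotProduct, dotProduct_neg, neg_neg, zero_dotProduct, hzw] at h
      rw [← hzz, hzw] at h
      change -(-(c - K) - z ⬝ᵥ z) ≤ ∫ t, _ ∂D.μ
      linarith)
  have hSl : l ∈ D.Sl := by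
    have hobs := hD.obs_L2
    have hp := hD.R_posDef.mono fun t ht => ht.posSemidef
    have icross := integrable_quad_cross hD.R_aesm hp hobs.1 hv2.1 hD.integrable_quad_obs hvi
    -- `v` plays the role of a misfit, so `R⁻¹ y - v` drives `l`. It need not be the minimal
    -- control, since its `p_K` part is still included.
    refine ⟨(z, fun t => (D.R t)⁻¹ *ᵥ D.y t - v t), hl, hobs.sub hv2, ?_, ?_, hz.symm⟩
    · refine ((hD.integrable_quad_obs.sub (icross.const_mul 2)).add hvi).congr ?_
      filter_upwards [hp] with t ht
      simp only [mulVec_sub, sub_dotProduct, dotProduct_sub, Pi.add_apply, Pi.sub_apply]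
      rw [ht.symm_quad (v t) ((D.R t)⁻¹ *ᵥ D.y t)]
      ring
    · filter_upwards [hD.ae_hasDerivAt hl, hvspec] with t ht hvt
      convert ht using 1
      simp only [mulVec_sub, hvt.1]
      rw [adjDrift, obsDrift]
      abel
  refine ⟨hSl, hl₀, ?_⟩
  have hrep := (hD.isInfoRep_infoRep hSl).1
  have ez : (D.infoRep l).1 = z := by
    refine eq_of_im_of_mulVec_eq (R := 1) (H := psdSqrt D.ST) Matrix.PosDef.one ?_
      ⟨w, by simpa using hw⟩ ?_
    · obtain ⟨w', hw'⟩ := (hD.infoRep_mem_range hSl).1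
      exact ⟨w', by simpa using hw'⟩
    · rw [(psdSqrt_spec hD.ST_psd).1.transpose_eq, hz]
      exact hrep.2.2.2.2.symm
  have ev : ∫ t, (D.R t *ᵥ D.misfit l t) ⬝ᵥ D.misfit l t ∂D.μ =
      ∫ t, (D.R t *ᵥ v t) ⬝ᵥ v t ∂D.μ := by
    refine integral_congr_ae ?_
    filter_upwards [hD.misfit_spec hSl, hvspec, hD.R_posDef] with t h1 h2 hR
    rw [eq_of_im_of_mulVec_eq hR h1.2 h2.2 (h1.1.trans h2.1.symm)]
  rw [hD.dualLeastSquares_eq hSl, ez, ev, ← hl₀]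
  have : ∫ t, (D.R t *ᵥ v t) ⬝ᵥ v t ∂D.μ ≤ -(c - K) - z ⬝ᵥ z := hvle
  linarith

theorem le_dualFunction_iff {l : ℝ → Fin n → ℝ} {l₀ : Fin n → ℝ} {c : ℝ} :
    (c : EReal) ≤ D.dualFunction l l₀ ↔
      ∀ ξ, ∀ u ∈ D.Controls, ∀ x ∈ D.AC, c ≤ D.lagrangian ξ u x l l₀ := by
  simp only [dualFunction, le_iInf_iff, EReal.coe_le_coe_iff]

/-- Any real `c` below the dual function is a lower bound of the Lagrangian, and every such bound is
at most the claimed value; this avoids exhibiting a minimizing sequence. -/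
theorem Standing.dualFunction_eq (hD : D.Standing) {l : ℝ → Fin n → ℝ} (hl : l ∈ D.Sl) :
    D.dualFunction l (l D.t₀) = ((-D.dualObj l : ℝ) : EReal) := by
  have hac : l ∈ D.AC := (hD.isInfoRep_infoRep hl).1.1
  rw [hD.dualObj_eq_dualLeastSquares hl]
  refine le_antisymm ?_ (le_dualFunction_iff.2 fun ξ u hu x hx =>
    hD.neg_dualLeastSquares_le hu hx hl ξ)
  refine EReal.le_of_forall_lt_iff_le.1 fun c hc => ?_
  by_contra hlt
  exact absurd (hD.mem_Sl_of_le_lagrangian hac (le_dualFunction_iff.1 (not_le.1 hlt).le)).2.2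
    (not_le.2 (by exact_mod_cast hc))

theorem Standing.dualFunction_eq_bot (hD : D.Standing) {l : ℝ → Fin n → ℝ} (hl : l ∈ D.AC)
    {l₀ : Fin n → ℝ} (h : ¬ (l ∈ D.Sl ∧ l₀ = l D.t₀)) : D.dualFunction l l₀ = ⊥ := by
  rw [EReal.eq_bot_iff_forall_lt]
  intro c
  by_contra hlt
  obtain ⟨h1, h2, -⟩ := hD.mem_Sl_of_le_lagrangian hl (le_dualFunction_iff.1 (not_lt.1 hlt))
  exact h ⟨h1, h2⟩

/-! ### The Hamiltonian boundary value problem -/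

/-- `(x, l)` solves `x' = F x + G Q G^* l`, `l' = H^* R⁻¹ H x - F^* l - g`. -/
def IsHamiltonian (D : SmoothingData n d m) (g : ℝ → Fin n → ℝ) (x l : ℝ → Fin n → ℝ) : Prop :=
  x ∈ D.AC ∧ l ∈ D.AC ∧
    (∀ᵐ t ∂D.μ, HasDerivAt x (D.F t *ᵥ x t + (D.G t * D.Q t * (D.G t)ᵀ) *ᵥ l t) t) ∧
    ∀ᵐ t ∂D.μ, HasDerivAt l (wGram (D.R t) (D.H t) *ᵥ x t - (D.F t)ᵀ *ᵥ l t - g t) t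

/-- State and costate are stacked into one linear Cauchy problem of size `2n` with integrable
coefficients. -/
theorem Standing.exists_isHamiltonian (hD : D.Standing) {g : ℝ → Fin n → ℝ} (hg : MemLp g 1 D.μ)
    (c c' : Fin n → ℝ) : ∃ x l, D.IsHamiltonian g x l ∧ x D.t₀ = c ∧ l D.t₀ = c' := by
  set A : ℝ → Matrix (Fin n ⊕ Fin n) (Fin n ⊕ Fin n) ℝ := fun t =>
    fromBlocks (D.F t) (D.G t * D.Q t * (D.G t)ᵀ) (wGram (D.R t) (D.H t)) (-(D.F t)ᵀ) with hA
  have hA1 : ∀ i j, MemLp (fun t => A t i j) 1 D.μ := by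
    rintro (i | i) (j | j)
    · exact hD.F_L1 i j
    · exact hD.GQG_L1 i j
    · exact hD.wGram_L1 i j
    · exact (hD.F_L1 j i).neg
  have hf : MemLp (fun t => (Sum.elim 0 (-g t) : Fin n ⊕ Fin n → ℝ)) 1 D.μ := by
    refine MemLp.of_eval ?_
    rintro (i | i)
    · exact MemLp.zero' (ε := ℝ)
    · have h := (hg.eval i).neg
      exact h
  obtain ⟨z, hz, hz0, hzd⟩ := exists_linearODE_solution hD.lt.le hA1 hf (Sum.elim c c')
  have hac := absolutelyContinuousOnInterval_pi_iff.1 hz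
  have hx : AbsolutelyContinuousOnInterval (fun t i => z t (Sum.inl i)) D.t₀ D.T :=
    absolutelyContinuousOnInterval_pi_iff.2 fun i => hac (Sum.inl i)
  have hl : AbsolutelyContinuousOnInterval (fun t i => z t (Sum.inr i)) D.t₀ D.T :=
    absolutelyContinuousOnInterval_pi_iff.2 fun i => hac (Sum.inr i)
  refine ⟨fun t i => z t (Sum.inl i), fun t i => z t (Sum.inr i), ⟨?_, ?_, ?_, ?_⟩, ?_, ?_⟩
  · exact hx
  · exact hl
  · change ∀ᵐ t ∂D.μ, _ at hzd
    filter_upwards [hzd] with t ht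
    refine hasDerivAt_pi.2 fun i => ?_
    convert hasDerivAt_pi.1 ht (Sum.inl i) using 1
    simp [hA, fromBlocks_mulVec, Function.comp_def]
  · change ∀ᵐ t ∂D.μ, _ at hzd
    filter_upwards [hzd] with t ht
    refine hasDerivAt_pi.2 fun i => ?_
    convert hasDerivAt_pi.1 ht (Sum.inr i) using 1
    simp [hA, fromBlocks_mulVec, Function.comp_def, neg_mulVec, sub_eq_add_neg]
  · funext i
    simp [hz0]
  · funext i
    simp [hz0]

theorem IsHamiltonian.add {g g' x x' l l' : ℝ → Fin n → ℝ} (h : D.IsHamiltonian g x l)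
    (h' : D.IsHamiltonian g' x' l') : D.IsHamiltonian (g + g') (x + x') (l + l') := by
  refine ⟨AbsolutelyContinuousOnInterval.add h.1 h'.1,
    AbsolutelyContinuousOnInterval.add h.2.1 h'.2.1, ?_, ?_⟩
  · filter_upwards [h.2.2.1, h'.2.2.1] with t h1 h2
    refine (h1.add h2).congr_deriv ?_
    simp only [Pi.add_apply, mulVec_add]
    abel
  · filter_upwards [h.2.2.2, h'.2.2.2] with t h1 h2
    refine (h1.add h2).congr_deriv ?_
    simp only [Pi.add_apply, mulVec_add]
    abel

theorem IsHamiltonian.smul {g x l : ℝ → Fin n → ℝ} (h : D.IsHamiltonian g x l) (s : ℝ) :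
    D.IsHamiltonian (s • g) (s • x) (s • l) := by
  refine ⟨smul_mem_AC h.1 s, smul_mem_AC h.2.1 s, ?_, ?_⟩
  · filter_upwards [h.2.2.1] with t h1
    refine (h1.const_smul s).congr_deriv ?_
    simp only [Pi.smul_apply, mulVec_smul, smul_add]
  · filter_upwards [h.2.2.2] with t h1
    refine (h1.const_smul s).congr_deriv ?_
    simp only [Pi.smul_apply, mulVec_smul, smul_sub]

/-- The solutions of the homogeneous Hamiltonian system that satisfy the initial condition. -/
def hamiltonianSpace (D : SmoothingData n d m) :
    Submodule ℝ ((ℝ → Fin n → ℝ) × (ℝ → Fin n → ℝ)) where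
  carrier := {p | D.IsHamiltonian 0 p.1 p.2 ∧ p.1 D.t₀ = D.P0 *ᵥ p.2 D.t₀}
  zero_mem' := by
    refine ⟨⟨const_mem_AC 0, const_mem_AC 0, ?_, ?_⟩, by simp⟩ <;>
    · refine Filter.Eventually.of_forall fun t => ?_
      simp
  add_mem' := fun {p q} hp hq =>
    ⟨by simpa using hp.1.add hq.1, by simp [hp.2, hq.2, mulVec_add]⟩
  smul_mem' := fun s p hp => ⟨by simpa using hp.1.smul s, by simp [hp.2, mulVec_smul]⟩

/-- The terminal map `(x, l) ↦ l(T) + ST x(T)`. -/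
def terminalMap (D : SmoothingData n d m) : D.hamiltonianSpace →ₗ[ℝ] (Fin n → ℝ) where
  toFun p := p.1.2 D.T + D.ST *ᵥ p.1.1 D.T
  map_add' p q := by simp [mulVec_add]; abel
  map_smul' s p := by simp [mulVec_smul]

/-- The initial map `(x, l) ↦ l(t₀)`. -/
def initialMap (D : SmoothingData n d m) : D.hamiltonianSpace →ₗ[ℝ] (Fin n → ℝ) where
  toFun p := p.1.2 D.t₀
  map_add' p q := by simp
  map_smul' s p := by simp

theorem Standing.inputGram_posSemidef (hD : D.Standing) :
    ∀ᵐ t ∂D.μ, (D.G t * D.Q t * (D.G t)ᵀ).PosSemidef := by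
  filter_upwards [hD.inp_mul_transpose] with t ht
  rw [← ht]
  simpa using posSemidef_self_mul_conjTranspose (D.inp t)

/-- The Hamiltonian identity for solutions of the homogeneous system. -/
theorem Standing.integral_isHamiltonian (hD : D.Standing) {x l : ℝ → Fin n → ℝ}
    (h : D.IsHamiltonian 0 x l) :
    ∫ t, ((D.G t * D.Q t * (D.G t)ᵀ) *ᵥ l t) ⬝ᵥ l t
      + (wGram (D.R t) (D.H t) *ᵥ x t) ⬝ᵥ x t ∂D.μ = l D.T ⬝ᵥ x D.T - l D.t₀ ⬝ᵥ x D.t₀ := by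
  have hxL := hD.memLp_top_of_mem_AC h.1
  have hlL := hD.memLp_top_of_mem_AC h.2.1
  have i1 : Integrable (fun t => l t ⬝ᵥ deriv x t) D.μ :=
    MemLp.integrable_dotProduct (p := ∞) (q := 1) hlL (hD.deriv_L1 h.1)
  have i2 : Integrable (fun t => deriv l t ⬝ᵥ x t) D.μ :=
    MemLp.integrable_dotProduct (p := 1) (q := ∞) (hD.deriv_L1 h.2.1) hxL
  have hp : ∫ t, l t ⬝ᵥ deriv x t ∂D.μ =
      l D.T ⬝ᵥ x D.T - l D.t₀ ⬝ᵥ x D.t₀ - ∫ t, deriv l t ⬝ᵥ x t ∂D.μ :=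
    AbsolutelyContinuousOnInterval.integral_dotProduct_deriv hD.lt.le h.2.1 h.1
  rw [← eq_sub_iff_add_eq.1 hp, ← integral_add i1 i2]
  refine integral_congr_ae ?_
  filter_upwards [h.2.2.1, h.2.2.2] with t h1 h2
  rw [h1.deriv, h2.deriv]
  simp only [dotProduct_add, sub_dotProduct, Pi.zero_apply, sub_zero]
  rw [dotProduct_comm (l t) (_ *ᵥ _), dotProduct_comm (l t) (_ *ᵥ _), mulVec_dotProduct (D.F t)]
  ring

/-- The Hamiltonian identity equates a nonnegative integral with minus two nonnegative boundary
terms, so all of them vanish. Then `x` solves `x' = F x` from zero, whence `x(T) = 0` and `l(T) =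
0`, and `l` solves the adjoint equation. -/
theorem Standing.initial_eq_zero (hD : D.Standing) {x l : ℝ → Fin n → ℝ}
    (h : D.IsHamiltonian 0 x l) (h0 : x D.t₀ = D.P0 *ᵥ l D.t₀)
    (hT : l D.T + D.ST *ᵥ x D.T = 0) : l D.t₀ = 0 := by
  have hxL := hD.memLp_top_of_mem_AC h.1
  have hlL := hD.memLp_top_of_mem_AC h.2.1
  have hM : ∀ᵐ t ∂D.μ, (wGram (D.R t) (D.H t)).PosSemidef := by
    filter_upwards [hD.R_posDef] with t ht using gram_posSemidef ht
  have hnn : 0 ≤ᵐ[D.μ] fun t => ((D.G t * D.Q t * (D.G t)ᵀ) *ᵥ l t) ⬝ᵥ l t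
      + (wGram (D.R t) (D.H t) *ᵥ x t) ⬝ᵥ x t := by
    filter_upwards [hM, hD.inputGram_posSemidef] with t h1 h2 using
      add_nonneg (h2.quad_nonneg _) (h1.quad_nonneg _)
  have hi : Integrable (fun t => ((D.G t * D.Q t * (D.G t)ᵀ) *ᵥ l t) ⬝ᵥ l t
      + (wGram (D.R t) (D.H t) *ᵥ x t) ⬝ᵥ x t) D.μ :=
    (MemLp.integrable_dotProduct (p := 1) (q := ∞)
      (MemLp.mulVec (p := 1) (q := ∞) hD.GQG_L1 hlL) hlL).add (hD.integrable_gram_quad hxL hxL)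
  have hI := hD.integral_isHamiltonian h
  have hge := integral_nonneg_of_ae hnn
  have hP := hD.P0_psd.quad_nonneg (l D.t₀)
  have hS := hD.ST_psd.quad_nonneg (x D.T)
  have e1 : l D.T ⬝ᵥ x D.T = -((D.ST *ᵥ x D.T) ⬝ᵥ x D.T) := by
    rw [eq_neg_of_add_eq_zero_left hT, neg_dotProduct]
  have e2 : l D.t₀ ⬝ᵥ x D.t₀ = (D.P0 *ᵥ l D.t₀) ⬝ᵥ l D.t₀ := by rw [h0, dotProduct_comm]
  rw [hI] at hge
  have hx0 : x D.t₀ = 0 := h0.trans (hD.P0_psd.mulVec_eq_zero (by linarith))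
  have hz := (integral_eq_zero_iff_of_nonneg_ae hnn hi).1 (hI.trans (by linarith))
  have hzero : ∀ᵐ t ∂D.μ, (D.G t * D.Q t * (D.G t)ᵀ) *ᵥ l t = 0 ∧
      wGram (D.R t) (D.H t) *ᵥ x t = 0 := by
    filter_upwards [hz, hM, hD.inputGram_posSemidef] with t ht h1 h2
    have q1 := h1.quad_nonneg (x t)
    have q2 := h2.quad_nonneg (l t)
    simp only [Pi.zero_apply] at ht
    exact ⟨h2.mulVec_eq_zero (by linarith), h1.mulVec_eq_zero (by linarith)⟩
  have hxT : x D.T = 0 := by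
    refine linearODE_eq_zero hD.lt.le hD.F_L1 h.1 hx0 ?_ D.T (right_mem_Icc.2 hD.lt.le)
    change ∀ᵐ t ∂D.μ, _
    filter_upwards [h.2.2.1, hzero] with t h1 h2
    rwa [h2.1, add_zero] at h1
  have hlT : l D.T = 0 := by simpa [hxT] using hT
  -- The pairing of `l` with a solution of `c' = F c` is constant in time. Starting `c` at `l(t₀)`
  -- gives `|l(t₀)|² = ⟨l(T), c(T)⟩ = 0` without solving backwards.
  obtain ⟨c, hc, hc0, hcd⟩ := exists_linearODE_solution hD.lt.le hD.F_L1
    (MemLp.zero' (ε := Fin n → ℝ)) (l D.t₀)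
  change ∀ᵐ t ∂D.μ, _ at hcd
  have hp : ∫ t, l t ⬝ᵥ deriv c t ∂D.μ =
      l D.T ⬝ᵥ c D.T - l D.t₀ ⬝ᵥ c D.t₀ - ∫ t, deriv l t ⬝ᵥ c t ∂D.μ :=
    AbsolutelyContinuousOnInterval.integral_dotProduct_deriv hD.lt.le h.2.1 hc
  have he : ∫ t, l t ⬝ᵥ deriv c t ∂D.μ = -∫ t, deriv l t ⬝ᵥ c t ∂D.μ := by
    rw [← integral_neg]
    refine integral_congr_ae ?_
    filter_upwards [hcd, h.2.2.2, hzero] with t h1 h2 h3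
    rw [h1.deriv, h2.deriv, h3.2]
    simp only [add_zero, zero_sub, Pi.zero_apply, sub_zero, neg_dotProduct, neg_neg]
    rw [dotProduct_comm, mulVec_dotProduct]
  rw [hlT, hc0, zero_dotProduct] at hp
  exact dotProduct_self_eq_zero.1 (by linarith)

/-- Shooting from `l(t₀)`. Members of `hamiltonianSpace` are unconstrained off the interval, so
dimension counting happens on the initial values, through a linear right inverse of `initialMap`. -/
theorem Standing.terminalMap_surjective (hD : D.Standing) :
    Function.Surjective D.terminalMap := by
  have hs : LinearMap.range D.initialMap = ⊤ := LinearMap.range_eq_top.2 fun c => by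
    obtain ⟨x, l, h, hx, hl⟩ := hD.exists_isHamiltonian (g := 0) MemLp.zero (D.P0 *ᵥ c) c
    exact ⟨⟨(x, l), h, by simp only [hx, hl]⟩, hl⟩
  obtain ⟨s, hs⟩ := D.initialMap.exists_rightInverse_of_surjective hs
  have hinj : Function.Injective (D.terminalMap ∘ₗ s) := by
    refine (injective_iff_map_eq_zero _).2 fun c hc => ?_
    have h1 : D.initialMap (s c) = c := LinearMap.congr_fun hs c
    rw [← h1]
    exact hD.initial_eq_zero (s c).2.1 (s c).2.2 hc
  intro w
  obtain ⟨c, hc⟩ := LinearMap.injective_iff_surjective.1 hinj w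
  exact ⟨s c, hc⟩

/-- The optimality system has a solution. -/
theorem Standing.exists_optimality_system (hD : D.Standing) :
    ∃ x l, D.IsHamiltonian D.obsDrift x l ∧ x D.t₀ = D.P0 *ᵥ l D.t₀ ∧
      l D.T = -(D.ST *ᵥ x D.T) := by
  obtain ⟨x, l, h, hx, hl⟩ := hD.exists_isHamiltonian hD.obsDrift_L1 0 0
  obtain ⟨p, hp⟩ := hD.terminalMap_surjective (-(l D.T + D.ST *ᵥ x D.T))
  refine ⟨x + p.1.1, l + p.1.2, by simpa using h.add p.2.1, ?_, ?_⟩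
  · simp [hx, hl, p.2.2]
  · change p.1.2 D.T + D.ST *ᵥ p.1.1 D.T = _ at hp
    simp only [Pi.add_apply, mulVec_add]
    rw [← sub_eq_zero, sub_neg_eq_add]
    linear_combination (exp := 1) hp

/-- A solution of the optimality system is a saddle point of the Lagrangian. -/
theorem Standing.exists_saddle_point (hD : D.Standing) :
    ∃ (ξ : Fin n → ℝ) (u : ℝ → Fin d → ℝ) (x l : ℝ → Fin n → ℝ), D.IsControlled x (ξ, u) ∧
      l ∈ D.AC ∧ ∀ ξ', ∀ u' ∈ D.Controls, ∀ x' ∈ D.AC,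
        D.lagrangian ξ u x l (l D.t₀) ≤ D.lagrangian ξ' u' x' l (l D.t₀) := by
  obtain ⟨x, l, ⟨hx, hl, hxd, hld⟩, h0, hT⟩ := hD.exists_optimality_system
  have hu := hD.inputControl_mem hl
  have hxL := hD.memLp_top_of_mem_AC hx
  refine ⟨psdSqrt D.P0 *ᵥ l D.t₀, fun t => (D.inp t)ᵀ *ᵥ l t, x, l, ⟨hx, hu, ?_, ?_⟩, hl, fun ξ' u' hu' x' hx' => ?_⟩
  · filter_upwards [hxd, hD.inp_mul_transpose] with t h1 h2
    rw [← h2, ← mulVec_mulVec] at h1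
    exact h1
  · rw [h0, mulVec_mulVec, (psdSqrt_spec hD.P0_psd).2]
  · have hxL' := hD.memLp_top_of_mem_AC hx'
    rw [hD.lagrangian_eq hu hx hl, hD.lagrangian_eq hu' hx' hl, hT]
    have h1 := dot_self_nonneg (ξ' - psdSqrt D.P0 *ᵥ l D.t₀)
    have h2 : 0 ≤ ∫ t, (u' t - (D.inp t)ᵀ *ᵥ l t) ⬝ᵥ (u' t - (D.inp t)ᵀ *ᵥ l t) ∂D.μ :=
      integral_nonneg fun t => dot_self_nonneg _
    have h3 := hD.ST_psd.quad_nonneg (x' D.T - x D.T)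
    simp only [mulVec_sub, sub_dotProduct, dotProduct_sub] at h3
    rw [hD.ST_psd.symm_quad (x' D.T) (x D.T)] at h3
    have iq : ∀ y : ℝ → Fin n → ℝ, MemLp y ∞ D.μ → Integrable (fun t =>
        (wGram (D.R t) (D.H t) *ᵥ y t) ⬝ᵥ y t - 2 * (D.adjDrift l t ⬝ᵥ y t)) D.μ := fun y hy =>
      (hD.integrable_gram_quad hy hy).sub ((MemLp.integrable_dotProduct (p := 1) (q := ∞)
        (hD.adjDrift_L1 hl) hy).const_mul 2)
    have h4 := integral_mono_ae (iq x hxL) (iq x' hxL') (by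
      filter_upwards [hld, hD.R_posDef] with t hd hR
      -- The costate equation is stationarity of the integrand at `x`; convexity makes it a minimum.
      have e : D.adjDrift l t = wGram (D.R t) (D.H t) *ᵥ x t := by
        rw [adjDrift, hd.deriv]
        abel
      have hM := gram_posSemidef (H := D.H t) hR
      have h := hM.quad_nonneg (x' t - x t)
      simp only [mulVec_sub, sub_dotProduct, dotProduct_sub] at h
      rw [hM.symm_quad (x' t) (x t)] at h
      simp only [e]
      linarith)
    simp only [sub_self, dotProduct_zero, integral_zero, neg_dotProduct]
    linarith

end SmoothingData

/-! ### Strong duality and attainment -/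

theorem mainTheorem7 {n d m : ℕ} (D : SmoothingData n d m) (hD : D.Standing) :
    -- the pointwise decomposition of `R⁻¹ y`: existence, uniqueness, `R`-orthogonality
    (∀ᵐ t ∂D.μ, D.IsDecomp t (D.projIm t, D.projKer t) ∧
      (∀ p, D.IsDecomp t p → p = (D.projIm t, D.projKer t)) ∧
      (D.R t *ᵥ D.projIm t) ⬝ᵥ D.projKer t = 0) ∧
    (MemLp D.projIm 2 D.μ ∧ Integrable (fun t => (D.R t *ᵥ D.projIm t) ⬝ᵥ D.projIm t) D.μ ∧
      MemLp D.projKer 2 D.μ ∧ Integrable (fun t => (D.R t *ᵥ D.projKer t) ⬝ᵥ D.projKer t) D.μ) ∧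
    -- the representatives exist and are unique
    (∀ x ∈ D.Sx, D.IsRep x (D.rep x) ∧
      ∀ p, D.IsRep x p → p.1 = (D.rep x).1 ∧ p.2 =ᵐ[D.μ] (D.rep x).2) ∧
    (∀ l ∈ D.Sl, D.IsInfoRep l (D.infoRep l) ∧
      ∀ p, D.IsInfoRep l p → p.1 = (D.infoRep l).1 ∧ p.2 =ᵐ[D.μ] (D.infoRep l).2) ∧
    -- the Lagrangian is one of the primal problem `min_{S_x} L_x`
    (∀ x ∈ D.Sx, D.primalFunction x = ((D.primalObj x : ℝ) : EReal)) ∧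
    (∀ x ∈ D.AC, x ∉ D.Sx → D.primalFunction x = ⊤) ∧
    -- its dual function is `-L_λ` on `S_λ` and `-∞` for all other multipliers
    (∀ l ∈ D.Sl, D.dualFunction l (l D.t₀) = ((-D.dualObj l : ℝ) : EReal)) ∧
    (∀ l ∈ D.AC, ∀ l₀ : Fin n → ℝ, ¬ (l ∈ D.Sl ∧ l₀ = l D.t₀) → D.dualFunction l l₀ = ⊥) ∧
    -- the two forms of the dual objective agree
    (∀ l ∈ D.Sl, D.dualObj l = D.dualLeastSquares l) ∧
    -- both minima are attained and there is no duality gap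
    ∃ c : ℝ, IsLeast (D.dualObj '' D.Sl) c ∧ IsLeast (D.primalObj '' D.Sx) (-c) ∧
      (⨆ l ∈ D.AC, ⨆ l₀ : Fin n → ℝ, D.dualFunction l l₀) = ((-c : ℝ) : EReal) := by
  refine ⟨?_, ⟨hD.projIm_memLp.1, hD.projIm_memLp.2, hD.projKer_memLp.1, hD.projKer_memLp.2⟩,
    fun x hx => ⟨hD.isRep_rep hx, fun p hp => hD.rep_unique hx hp⟩,
    fun l hl => ⟨hD.isInfoRep_infoRep hl, fun p hp => hD.infoRep_unique hl hp⟩,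
    fun x hx => hD.primalFunction_eq hx, fun x hx hn => hD.primalFunction_eq_top hx hn,
    fun l hl => hD.dualFunction_eq hl, fun l hl l₀ h => hD.dualFunction_eq_bot hl h,
    fun l hl => hD.dualObj_eq_dualLeastSquares hl, ?_⟩
  · filter_upwards [hD.R_posDef] with t ht
    exact ⟨SmoothingData.isDecomp_proj ht,
      fun p hp => hp.unique ht (SmoothingData.isDecomp_proj ht),
      SmoothingData.quad_proj_orthogonal ht⟩
  · obtain ⟨ξ, u, x, l, hc, hl, hmin⟩ := hD.exists_saddle_point
    have hx : x ∈ D.Sx := ⟨_, hc⟩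
    -- The saddle value is a finite lower bound of the Lagrangian at this multiplier.
    have hlS : l ∈ D.Sl := (hD.mem_Sl_of_le_lagrangian hl hmin).1
    have hmem : ∀ l ∈ D.Sl, l ∈ D.AC := fun l ⟨_, h⟩ => h.1
    have hweak : ∀ l ∈ D.AC, ∀ l₀, ∀ x ∈ D.AC, D.dualFunction l l₀ ≤ D.primalFunction x :=
      fun l hl l₀ x hx => SmoothingData.dualFunction_le_primalFunction hx hl l₀
    have hle : D.primalObj x ≤ -D.dualObj l := by
      -- At a feasible triple the Lagrangian does not depend on the multipliers, so its supremum
      -- there is the saddle value itself.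
      have h1 : D.primalFunction x ≤ D.dualFunction l (l D.t₀) := by
        refine le_trans ?_ (SmoothingData.le_dualFunction_iff.2 hmin)
        refine (iInf_le _ ξ).trans ((iInf₂_le u hc.2.1).trans ?_)
        rw [hD.iSup_lagrangian_of_isControlled hc, hD.lagrangian_of_isControlled hc]
      rwa [hD.primalFunction_eq hx, hD.dualFunction_eq hlS, EReal.coe_le_coe_iff] at h1
    have hge : ∀ l ∈ D.Sl, ∀ x ∈ D.Sx, -D.dualObj l ≤ D.primalObj x := fun l hl x hx => by
      have h1 := hweak l (hmem l hl) (l D.t₀) x (hD.isRep_rep hx).1.1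
      rwa [hD.primalFunction_eq hx, hD.dualFunction_eq hl, EReal.coe_le_coe_iff] at h1
    have heq : D.primalObj x = -D.dualObj l := le_antisymm hle (hge l hlS x hx)
    refine ⟨D.dualObj l, ⟨⟨l, hlS, rfl⟩, ?_⟩, ⟨⟨x, hx, heq⟩, ?_⟩, le_antisymm ?_ ?_⟩
    · rintro _ ⟨l', hl', rfl⟩
      linarith [hge l' hl' x hx]
    · rintro _ ⟨x', hx', rfl⟩
      exact hge l hlS x' hx'
    · refine iSup₂_le fun l' hl' => iSup_le fun l₀ => ?_
      rw [← heq, ← hD.primalFunction_eq hx]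
      exact hweak l' hl' l₀ x hc.1
    · rw [← hD.dualFunction_eq hlS]
      exact le_iSup₂_of_le l hl (le_iSup (fun l₀ => D.dualFunction l l₀) (l D.t₀))
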